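/- **Theorem 2.** There exists a Turing complete real-analytic diffeomorphism $F$ of the sphere $\mathbb S^{17}\subset\mathbb R^{18}$ (so analytic maps of compact spaces can be Turing universal, contrary to Moore's 1998 conjecture). Moreover, $F$ can be taken as follows. There are a polynomial vector field $P$ on $\mathbb R^{17}$ with computable coefficients, which is itself Turing complete, a polynomial vector field $Y$ on $\mathbb R^{18}$ tangent to $\mathbb S^{17}$, and a $\delta>0$ such that $F=\rho_\delta$, where $\rho_t$ is the flow of $Y$ on $\mathbb S^{17}$ and $Y$ is the lift $\varphi_*\widetilde P$ of the reparametrized field $\widetilde P=(1+|x|^2)^{-d}P$, $d=\deg P$, by the inverse stereographic projection $\varphi:\mathbb R^{17}\to\mathbb S^{17}$, $\varphi(x)=\big(\tfrac{|x|^2-1}{1+|x|^2},\tfrac{2x}{1+|x|^2}\big)$. Here a Turing machine $T$ has a finite state set with an initial and a halting state, a finite alphabet with at least two symbols, one of them blank, and a transition function with values in (states) $\times$ (symbols) $\times\{-1,0,1\}$; it acts on a two-sided infinite tape, and input tapes are blank outside a finite window. Turing completeness of $F$ means: for every $T$, every input tape $t$, every $k\ge 0$ and every string $t^*=(t^*_{-k},\dots,t^*_k)$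 of symbols there are an explicitly constructible point $p=p(T,t)$ and an explicitly constructible open set $U=U(T,t^*)$ such that the orbit of $F$ through $p$ meets $U$ if and only if $T$ with input $t$ halts with an output tape whose positions $-k,\dots,k$ carry $t^*$. This holds for the forward orbit as well as for the two-sided orbit. Turing completeness of $P$ is the same property for the orbits of its flow in $\mathbb R^{17}$. Explicitly constructible means the following, with encodings that do not depend on $T,t,t^*$ and are the same for $P$ and $F$. There is a fixed point $c\in\mathbb R^{17}$ with computable coordinates and an algorithm that computes, from $T$ and a finite window containing the non-blank part of $t$, a vector $a\in\mathbb N^{17}$; the initial point is $c+a$ for $P$ and $p=\varphi(c+a)$ for $F$. Another algorithm computes, from $T$ and $t^*$, a finite list of conditions of the form $x_i\in\bigcup_{m\in\mathbb N}(\alpha+m\gamma,\beta+m\gamma)$ with $\alpha,\beta,\gamma\in\mathbb Q$; these conditions together define an open set $V\subset\mathbb R^{17}$, and the open set is $V$ for $P$ and $U=\varphi(V)$ for $F$. -/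

import Mathlib

open scoped Manifold ContDiff

noncomputable section

/-! ### Turing machines with a two-sided tape -/

/-- A Turing machine: a finite set of states with an initial and a halting state, a finite alphabet
with at least two symbols (the symbol `0` is the blank), and a transition function
`δ : Q × Σ → Q × Σ × {-1, 0, 1}`. -/
structure TM where
  /-- The machine has `r + 1` states. -/
  r : ℕ
  /-- The alphabet has `s + 2` symbols. -/
  s : ℕ
  start : Fin (r + 1)
  halt : Fin (r + 1)
  δ : Fin (r + 1) → Fin (s + 2) → Fin (r + 1) × Fin (s + 2) × SignType

namespace TM

abbrev Symbol (T : TM) : Type := Fin (T.s + 2)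

abbrev Tape (T : TM) : Type := ℤ → T.Symbol

/-- A configuration: the current state and the current tape (the head reads position `0`). -/
abbrev Config (T : TM) : Type := Fin (T.r + 1) × T.Tape

/-- One step: nothing changes in the halting state; otherwise write at position `0`, change the
state and shift the tape (`ε = 1` is the left shift, `ε = -1` the right shift). -/
def step (T : TM) (c : T.Config) : T.Config :=
  if c.1 = T.halt then c
  else
    let a := T.δ c.1 (c.2 0)
    (a.1, fun i => Function.update c.2 0 a.2.1 (i + (a.2.2 : ℤ)))

/-- The position in `ℤ`, between `-k` and `k`, of the `i`-th entry of a string of length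
`2 * k + 1`. -/
def pos (k : ℕ) (i : Fin (2 * k + 1)) : ℤ := (i : ℤ) - (k : ℤ)

/-- `T`, started on the tape `t`, halts with an output tape whose positions `-k, …, k` carry the
string `w`. -/
def HaltsWith (T : TM) (t : T.Tape) (k : ℕ) (w : Fin (2 * k + 1) → T.Symbol) : Prop :=
  ∃ j : ℕ, (T.step^[j] (T.start, t)).1 = T.halt ∧
    ∀ i, (T.step^[j] (T.start, t)).2 (pos k i) = w i

/-- All symbols of `t` outside the positions `-k₀, …, k₀` are blank. -/
def SupportedIn (T : TM) (t : T.Tape) (k₀ : ℕ) : Prop := ∀ i : ℤ, (k₀ : ℤ) < |i| → t i = 0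

/-- The string in the positions `-k₀, …, k₀` of a tape. -/
def window (T : TM) (t : T.Tape) (k₀ : ℕ) : Fin (2 * k₀ + 1) → T.Symbol := fun i => t (pos k₀ i)

/-- The full description of a machine as a list of natural numbers. -/
def code (T : TM) : List ℕ :=
  [T.r, T.s, (T.start : ℕ), (T.halt : ℕ)] ++
    (List.finRange (T.r + 1)).flatMap fun q => (List.finRange (T.s + 2)).flatMap fun a =>
      [((T.δ q a).1 : ℕ), ((T.δ q a).2.1 : ℕ), (((T.δ q a).2.2 : ℤ) + 1).toNat]

/-- The description of a string of symbols as a list of natural numbers. -/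
def wordCode (T : TM) {m : ℕ} (w : Fin m → T.Symbol) : List ℕ := List.ofFn fun i => (w i : ℕ)

end TM

/-! ### Spaces, stereographic projection, polynomial vector fields -/

/-- `ℝⁿ` with the Euclidean norm. -/
abbrev E (n : ℕ) : Type := EuclideanSpace ℝ (Fin n)

/-- The unit sphere `𝕊ⁿ` in `ℝⁿ⁺¹`. -/
abbrev Sph (n : ℕ) : Type := Metric.sphere (0 : E (n + 1)) 1

/-- The inverse stereographic projection `ℝⁿ → ℝⁿ⁺¹`:
`y₀ = (|x|² - 1) / (1 + |x|²)`, `yₖ = 2 xₖ / (1 + |x|²)`. -/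
def stereoVec {n : ℕ} (x : E n) : E (n + 1) :=
  WithLp.toLp 2
    (Fin.cons ((‖x‖ ^ 2 - 1) / (1 + ‖x‖ ^ 2)) fun k : Fin n => 2 * x k / (1 + ‖x‖ ^ 2))

theorem stereoVec_mem {n : ℕ} (x : E n) : stereoVec x ∈ Metric.sphere (0 : E (n + 1)) 1 := by
  have h : (0 : ℝ) < 1 + ‖x‖ ^ 2 := by positivity
  have hs : ∑ k, x k ^ 2 = ‖x‖ ^ 2 := by
    rw [EuclideanSpace.norm_sq_eq]; simp
  have h1 : ‖stereoVec x‖ ^ 2 = 1 := by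
    rw [EuclideanSpace.norm_sq_eq, Fin.sum_univ_succ]
    simp only [stereoVec, Fin.cons_zero, Fin.cons_succ, Real.norm_eq_abs, sq_abs, div_pow,
      mul_pow]
    rw [← Finset.sum_div, ← Finset.mul_sum, hs]
    field_simp
    ring
  rw [mem_sphere_zero_iff_norm]
  nlinarith [norm_nonneg (stereoVec x)]

/-- The inverse stereographic projection `φ : ℝⁿ → 𝕊ⁿ`, onto the complement of the north pole. -/
def stereo {n : ℕ} (x : E n) : Sph n := ⟨stereoVec x, stereoVec_mem x⟩

/-- A polynomial vector field on `ℝⁿ`, given by its components. -/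
abbrev PolyField (n : ℕ) : Type := Fin n → MvPolynomial (Fin n) ℝ

namespace PolyField

/-- The value of a polynomial vector field at a point. -/
def val {n : ℕ} (P : PolyField n) (x : E n) : E n :=
  WithLp.toLp 2 fun i => MvPolynomial.eval (fun j => x j) (P i)

/-- The degree: the largest total degree of a component. -/
def degree {n : ℕ} (P : PolyField n) : ℕ := Finset.univ.sup fun i => (P i).totalDegree

/-- The reparametrized field `(1 + |x|²)⁻ᵈ P`, where `d` is the degree of `P`. -/
def reparam {n : ℕ} (P : PolyField n) (x : E n) : E n :=
  ((1 + ‖x‖ ^ 2) ^ P.degree)⁻¹ • P.val x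

/-- `Y` is tangent to the unit sphere, and so defines a polynomial vector field on the sphere. -/
def TangentToSphere {n : ℕ} (Y : PolyField (n + 1)) : Prop :=
  ∀ y : Sph n, inner ℝ (y : E (n + 1)) (Y.val y) = 0

/-- On the sphere minus the north pole, `Y` is the push-forward of the vector field `X` of `ℝⁿ`
by the inverse stereographic projection. -/
def IsStereoLift {n : ℕ} (Y : PolyField (n + 1)) (X : E n → E n) : Prop :=
  ∀ x : E n, Y.val (stereoVec x) = fderiv ℝ stereoVec x (X x)

/-- `ρ` is the (global) flow on the sphere of the tangent field `Y`. -/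
def IsSphereFlow {n : ℕ} (Y : PolyField (n + 1)) (ρ : ℝ → Sph n → Sph n) : Prop :=
  ∀ y : Sph n, ρ 0 y = y ∧
    ∀ t : ℝ, HasDerivAt (fun τ => (ρ τ y : E (n + 1))) (Y.val (ρ t y)) t

/-- Some integral curve of `P` that starts at `x` at time `0` is in `V` at time `τ` (which may be
negative). -/
def ReachesAt {n : ℕ} (P : PolyField n) (x : E n) (V : Set (E n)) (τ : ℝ) : Prop :=
  ∃ γ : ℝ → E n, γ 0 = x ∧
    (∀ t ∈ Set.uIcc 0 τ, HasDerivWithinAt γ (P.val (γ t)) (Set.uIcc 0 τ) t) ∧ γ τ ∈ V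

end PolyField

/-! ### Explicitly constructible points and open sets -/

/-- A computable real number: its dyadic approximations are given by an algorithm. -/
def IsComputableReal (x : ℝ) : Prop :=
  ∃ f : ℕ → ℤ, Computable f ∧ ∀ k : ℕ, |x - (f k : ℝ) / 2 ^ k| ≤ 1 / 2 ^ k

/-- The polynomial vector field is constructible: its coefficients are computable reals. -/
def PolyField.IsConstructible {n : ℕ} (P : PolyField n) : Prop :=
  ∀ i m, IsComputableReal ((P i).coeff m)

/-- The finite data `(i, a, b, c, N)` of a condition on the coordinate `xᵢ`. -/
abbrev SlabData (n : ℕ) : Type := Fin n × ℤ × ℤ × ℤ × ℕ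

/-- The open set of all `x` with
`xᵢ ∈ ⋃_{m ∈ ℕ} ((a + m c) / (N + 1), (b + m c) / (N + 1))`: a periodic family of open slabs
(a single one if `c = 0`). -/
def slab {n : ℕ} (d : SlabData n) : Set (E n) :=
  {x | ∃ m : ℕ, (d.2.1 : ℝ) + m * (d.2.2.2.1 : ℝ) < ((d.2.2.2.2 : ℝ) + 1) * x d.1 ∧
    ((d.2.2.2.2 : ℝ) + 1) * x d.1 < (d.2.2.1 : ℝ) + m * (d.2.2.2.1 : ℝ)}

/-- The open set described by a finite list of conditions: the intersection of the slabs. -/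
def slabs {n : ℕ} (l : List (SlabData n)) : Set (E n) := {x | ∀ d ∈ l, x ∈ slab d}

/-- Explicit input and output encodings in `ℝⁿ`. To a machine and an input tape an algorithm assigns
natural numbers that are put into the coordinates of the initial point, on top of one fixed
computable point; to a machine and an output string an algorithm assigns the finite description
of an open set. An initial point does not depend on the output string, and an open set does not
depend on the input tape. -/
structure Encoding (n : ℕ) where
  base : Fin n → ℝ
  base_computable : ∀ i, IsComputableReal (base i)
  input : List ℕ × List ℕ → (Fin n → ℕ)
  input_computable : Computable input
  output : List ℕ × List ℕ → List (SlabData n)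
  output_computable : Computable output

namespace Encoding

variable {n : ℕ}

/-- The initial point in `ℝⁿ` for the machine `T` and a tape `t` that is blank outside
`-k₀, …, k₀`. -/
def point (e : Encoding n) (T : TM) (t : T.Tape) (k₀ : ℕ) : E n :=
  WithLp.toLp 2 fun i => e.base i + (e.input (T.code, T.wordCode (T.window t k₀)) i : ℝ)

/-- The open set of `ℝⁿ` for the machine `T` and the output string `w`. -/
def region (e : Encoding n) (T : TM) {k : ℕ} (w : Fin (2 * k + 1) → T.Symbol) : Set (E n) :=
  slabs (e.output (T.code, T.wordCode w))

end Encoding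

/-! ### Turing completeness -/

/-- The bijection `F` of the sphere is Turing complete through the encoding `e`, transported to the
sphere by `φ`: for every Turing machine `T`, input tape `t` and string `w` in the positions
`-k, …, k`, the orbit of `F` through the point of `(T, t)` meets the open set of `(T, w)` if and
only if `T` with input `t` halts with an output that shows `w` in the positions `-k, …, k`. This
holds both for the forward orbit and for the two-sided orbit. -/
def IsTuringCompleteVia {n : ℕ} (e : Encoding n) (F : Equiv.Perm (Sph n)) : Prop :=
  ∀ (T : TM) (t : T.Tape) (k₀ : ℕ), T.SupportedIn t k₀ →
    ∀ (k : ℕ) (w : Fin (2 * k + 1) → T.Symbol),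
      IsOpen (stereo '' e.region T w) ∧
      ((∃ j : ℕ, F^[j] (stereo (e.point T t k₀)) ∈ stereo '' e.region T w) ↔
        T.HaltsWith t k w) ∧
      ((∃ j : ℤ, (F ^ j) (stereo (e.point T t k₀)) ∈ stereo '' e.region T w) ↔
        T.HaltsWith t k w)

/-- The polynomial vector field `P` on `ℝⁿ` is Turing complete through the encoding `e`: the same
property for the (forward, and two-sided) orbits of the flow of `P`. -/
def PolyField.IsTuringCompleteVia {n : ℕ} (e : Encoding n) (P : PolyField n) : Prop :=
  ∀ (T : TM) (t : T.Tape) (k₀ : ℕ), T.SupportedIn t k₀ →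
    ∀ (k : ℕ) (w : Fin (2 * k + 1) → T.Symbol),
      IsOpen (e.region T w) ∧
      ((∃ τ : ℝ, 0 ≤ τ ∧ P.ReachesAt (e.point T t k₀) (e.region T w) τ) ↔
        T.HaltsWith t k w) ∧
      ((∃ τ : ℝ, P.ReachesAt (e.point T t k₀) (e.region T w) τ) ↔ T.HaltsWith t k w)

end

/-! A computation becomes the iteration of a map on integers, the iteration becomes a polynomial
flow, and the flow is carried to the sphere, where compactness makes it complete.

Discrete part. A Turing step is primitive recursive in numerical codes, so one counter machine
simulates all Turing machines (`exists_universal_code`). Its configuration with program counter `q`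
and registers `g` is coded by the integer `n = p_{R+q} ∏ p_i ^ (g i)`. As in Conway's Fractran, a
step multiplies `n` by a rational number that depends only on the residue of `n` modulo a product
`M` of primes. Hence the step extends to a real function `f(z) = smoothRound z * T(cos (2πz/M))`
with a rational polynomial `T`, chosen so that `f(m + e) - f(m) = O((1 + m) e²)` at natural numbers
`m`.

Continuous part. The system `x' = e^{-A sin s} (f(y) - x)`, `y' = e^{A sin s} (x - y)` iterates `f`:
in one half-period `y` copies a nearly frozen `x`, in the other `x` moves to `f(y)` while `y` is
nearly frozen. Flatness makes the inherited error quadratic, and the exponentially growing `A` keeps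
the new errors below a precision inversely proportional to a bound of the orbit (`FlatOrbit.cycle`,
`FlatOrbit.relay`). A third variable `h` follows a halting indicator. With sines, cosines and
exponentials as extra coordinates the system is polynomial with rational coefficients. The time
change `s = log cosh τ` only visits `s ≥ 0`, so backward orbits see the same computation
(`exists_relayField_of_code`).

Output. The machine halts at `n = Q * 2 ^ N`, where the digits of `N` are the output tape. A
prescribed window is a congruence `N ≡ r` modulo `B`, which means that `2 ^ N` lies in the
progression `2 ^ r + m (2 ^ B - 1)` (`two_pow_eq_iff`). This gives the periodic slabs.

Sphere. The factor `(1 + |x|²)⁻ᵈ` is what makes the push-forward polynomial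
(`PolyField.lift_isStereoLift`). A time change preserves orbits, and after halting the curve stays
in the open set, so sampling it at the multiples of any `δ > 0` suffices
(`isTuringCompleteVia_of_curves`). For small `δ` the time-`δ` map is analytic by the inverse
function theorem in a space of paths (`exists_uniform_analytic_flow`). -/

noncomputable section

/-! ### Uniqueness and global existence for autonomous ODEs -/

section ODE

variable {E : Type*} [NormedAddCommGroup E] [NormedSpace ℝ E]

/-- A continuity argument: before the first time at which `h` reaches `B + d`, with `d ≤ 1`, the
weak bound `B + 1` holds, so `H` gives the strong bound `B`, which persists at that time. It serves
for a priori bounds of solutions of a truncated equation, which is the original one only where the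
weak bound holds. -/
theorem le_of_continuousOn_of_forall_le_add_one {h : ℝ → ℝ} {T B : ℝ}
    (hc : ContinuousOn h (Set.Icc 0 T))
    (H : ∀ t ∈ Set.Icc 0 T, (∀ s ∈ Set.Icc 0 t, h s ≤ B + 1) → h t ≤ B)
    (h0 : h 0 ≤ B) : ∀ t ∈ Set.Icc 0 T, h t ≤ B := by
  by_contra! hcon
  obtain ⟨t₁, ht₁, hlt⟩ := hcon
  set d := min 1 (h t₁ - B) with hd
  have hd0 : 0 < d := lt_min one_pos (by linarith)
  have hd1 : d ≤ 1 := min_le_left _ _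
  have hd2 : d ≤ h t₁ - B := min_le_right _ _
  have hc1 : ContinuousOn h (Set.Icc 0 t₁) := hc.mono (Set.Icc_subset_Icc_right ht₁.2)
  have hK : IsCompact (Set.Icc 0 t₁ ∩ h ⁻¹' Set.Ici (B + d)) :=
    isCompact_Icc.of_isClosed_subset (hc1.preimage_isClosed_of_isClosed isClosed_Icc isClosed_Ici)
      Set.inter_subset_left
  obtain ⟨s₀, hs₀, hmin⟩ := hK.exists_isLeast
    ⟨t₁, ⟨ht₁.1, le_rfl⟩, by simp only [Set.mem_preimage, Set.mem_Ici]; linarith⟩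
  have hlt0 : ∀ s ∈ Set.Ico 0 s₀, h s < B + d := by
    intro s hs
    by_contra! hge
    exact absurd (hmin ⟨⟨hs.1, hs.2.le.trans hs₀.1.2⟩, hge⟩) (not_le.2 hs.2)
  have hge : B + d ≤ h s₀ := hs₀.2
  have hpos : 0 < s₀ := lt_of_le_of_ne hs₀.1.1 (by rintro rfl; linarith)
  have hle : ∀ s ∈ Set.Ico 0 s₀, h s ≤ B := by
    intro s hs
    refine H s ⟨hs.1, hs.2.le.trans (hs₀.1.2.trans ht₁.2)⟩ fun u hu => ?_
    linarith [hlt0 u ⟨hu.1, hu.2.trans_lt hs.2⟩]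
  have hcl : s₀ ∈ closure (Set.Ico 0 s₀) := by
    rw [closure_Ico hpos.ne]; exact ⟨hpos.le, le_rfl⟩
  have : h s₀ ≤ B := by
    refine ContinuousWithinAt.closure_le hcl ((hc1 s₀ hs₀.1).mono ?_) continuousWithinAt_const hle
    exact fun u hu => ⟨hu.1, hu.2.le.trans hs₀.1.2⟩
  linarith

/-- `γ` solves `γ' = f γ` on the interval `[a, b]`. -/
def SolvesOn (f : E → E) (γ : ℝ → E) (a b : ℝ) : Prop :=
  ∀ t ∈ Set.Icc a b, HasDerivWithinAt γ (f (γ t)) (Set.Icc a b) t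

theorem SolvesOn.mono {f : E → E} {γ : ℝ → E} {a b a' b' : ℝ} (h : SolvesOn f γ a b)
    (ha : a ≤ a') (hb : b' ≤ b) : SolvesOn f γ a' b' := fun t ht =>
  (h t ⟨ha.trans ht.1, ht.2.trans hb⟩).mono (Set.Icc_subset_Icc ha hb)

theorem SolvesOn.continuousOn {f : E → E} {γ : ℝ → E} {a b : ℝ} (h : SolvesOn f γ a b) :
    ContinuousOn γ (Set.Icc a b) := fun t ht => (h t ht).continuousWithinAt

theorem SolvesOn.congr {f g : E → E} {γ : ℝ → E} {a b : ℝ} (h : SolvesOn f γ a b)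
    (hfg : ∀ t ∈ Set.Icc a b, f (γ t) = g (γ t)) : SolvesOn g γ a b := fun t ht =>
  hfg t ht ▸ h t ht

theorem solvesOn_of_hasDerivAt {f : E → E} {γ : ℝ → E} (h : ∀ t, HasDerivAt γ (f (γ t)) t)
    (a b : ℝ) : SolvesOn f γ a b := fun t _ => (h t).hasDerivWithinAt

/-- Both solutions stay in a common closed ball, on which a `C¹` field is Lipschitz, so no global
Lipschitz condition is needed. -/
theorem SolvesOn.eqOn [FiniteDimensional ℝ E] {f : E → E} (hf : ContDiff ℝ 1 f) {γ₁ γ₂ : ℝ → E}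
    {a b t₀ : ℝ} (ht₀ : t₀ ∈ Set.Icc a b) (h₁ : SolvesOn f γ₁ a b) (h₂ : SolvesOn f γ₂ a b)
    (h0 : γ₁ t₀ = γ₂ t₀) : Set.EqOn γ₁ γ₂ (Set.Icc a b) := by
  obtain ⟨R₁, hR₁⟩ := (isCompact_Icc.image_of_continuousOn h₁.continuousOn).isBounded.subset_closedBall 0
  obtain ⟨R₂, hR₂⟩ := (isCompact_Icc.image_of_continuousOn h₂.continuousOn).isBounded.subset_closedBall 0
  set R := max R₁ R₂
  obtain ⟨K, hK⟩ := (hf.contDiffOn (s := Metric.closedBall (0 : E) R)).exists_lipschitzOnWith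
    one_ne_zero (convex_closedBall 0 R) (isCompact_closedBall 0 R)
  have m₁ : ∀ t ∈ Set.Icc a b, γ₁ t ∈ Metric.closedBall (0 : E) R := fun t ht =>
    Metric.closedBall_subset_closedBall (le_max_left _ _) (hR₁ ⟨t, ht, rfl⟩)
  have m₂ : ∀ t ∈ Set.Icc a b, γ₂ t ∈ Metric.closedBall (0 : E) R := fun t ht =>
    Metric.closedBall_subset_closedBall (le_max_right _ _) (hR₂ ⟨t, ht, rfl⟩)
  intro t ht
  rcases le_total t₀ t with hle | hle
  · have s : Set.Icc t₀ t ⊆ Set.Icc a b := Set.Icc_subset_Icc ht₀.1 ht.2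
    have key : ∀ γ, SolvesOn f γ a b → ∀ u ∈ Set.Ico t₀ t, HasDerivWithinAt γ (f (γ u)) (Set.Ici u) u :=
      fun γ h u hu => (h u (s ⟨hu.1, hu.2.le⟩)).mono_of_mem_nhdsWithin
        (Icc_mem_nhdsGE_of_mem ⟨ht₀.1.trans hu.1, hu.2.trans_le ht.2⟩)
    exact ODE_solution_unique_of_mem_Icc_right (v := fun _ => f)
      (s := fun _ => Metric.closedBall (0 : E) R) (K := K) (a := t₀) (b := t)
      (fun _ _ => hK) (h₁.continuousOn.mono s) (key _ h₁) (fun u hu => m₁ u (s ⟨hu.1, hu.2.le⟩))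
      (h₂.continuousOn.mono s) (key _ h₂) (fun u hu => m₂ u (s ⟨hu.1, hu.2.le⟩)) h0 ⟨hle, le_rfl⟩
  · have s : Set.Icc t t₀ ⊆ Set.Icc a b := Set.Icc_subset_Icc ht.1 ht₀.2
    have key : ∀ γ, SolvesOn f γ a b → ∀ u ∈ Set.Ioc t t₀, HasDerivWithinAt γ (f (γ u)) (Set.Iic u) u :=
      fun γ h u hu => (h u (s ⟨hu.1.le, hu.2⟩)).mono_of_mem_nhdsWithin
        (Icc_mem_nhdsLE_of_mem ⟨ht.1.trans_lt hu.1, hu.2.trans ht₀.2⟩)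
    exact ODE_solution_unique_of_mem_Icc_left (v := fun _ => f)
      (s := fun _ => Metric.closedBall (0 : E) R) (K := K) (a := t) (b := t₀)
      (fun _ _ => hK) (h₁.continuousOn.mono s) (key _ h₁) (fun u hu => m₁ u (s ⟨hu.1.le, hu.2⟩))
      (h₂.continuousOn.mono s) (key _ h₂) (fun u hu => m₂ u (s ⟨hu.1.le, hu.2⟩)) h0 ⟨le_rfl, hle⟩

theorem eq_of_hasDerivAt [FiniteDimensional ℝ E] {f : E → E} (hf : ContDiff ℝ 1 f)
    {γ₁ γ₂ : ℝ → E} (h₁ : ∀ t, HasDerivAt γ₁ (f (γ₁ t)) t) (h₂ : ∀ t, HasDerivAt γ₂ (f (γ₂ t)) t)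
    (h0 : γ₁ 0 = γ₂ 0) : γ₁ = γ₂ := by
  funext t
  exact SolvesOn.eqOn hf (a := min 0 t) (b := max 0 t) (t₀ := 0)
    ⟨min_le_left _ _, le_max_left _ _⟩ (solvesOn_of_hasDerivAt h₁ _ _)
    (solvesOn_of_hasDerivAt h₂ _ _) h0 ⟨min_le_right _ _, le_max_right _ _⟩

theorem exists_solvesOn_of_bounded [CompleteSpace E] {f : E → E} {K L : NNReal}
    (hK : LipschitzWith K f) (hL : ∀ x, ‖f x‖ ≤ L) (x₀ : E) {T : ℝ} (hT : 0 ≤ T) :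
    ∃ γ : ℝ → E, γ 0 = x₀ ∧ SolvesOn f γ (-T) T := by
  have hp : IsPicardLindelof (fun _ => f) (tmin := -T) (tmax := T)
      ⟨0, by constructor <;> linarith⟩ x₀ (L * T.toNNReal) 0 L K := by
    refine IsPicardLindelof.of_time_independent (fun x _ => hL x) hK.lipschitzOnWith ?_
    simp [hT]
  obtain ⟨γ, h0, h⟩ := hp.exists_eq_forall_mem_Icc_hasDerivWithinAt₀
  exact ⟨γ, h0, h⟩

/-- A `C¹` vector field whose integral curves through `x₀` are bounded on bounded intervals has a
global integral curve through `x₀`. -/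
theorem exists_global_solution [FiniteDimensional ℝ E] {f : E → E} (hf : ContDiff ℝ 1 f) (x₀ : E)
    (H : ∀ T : ℝ, 0 < T → ∃ B : ℝ, ∀ a b : ℝ, -T ≤ a → a ≤ 0 → 0 ≤ b → b ≤ T → ∀ γ : ℝ → E,
      γ 0 = x₀ → SolvesOn f γ a b → ∀ t ∈ Set.Icc a b, ‖γ t‖ ≤ B) :
    ∃ γ : ℝ → E, γ 0 = x₀ ∧ ∀ t, HasDerivAt γ (f (γ t)) t := by
  have step : ∀ T : ℝ, 0 < T → ∃ γ : ℝ → E, γ 0 = x₀ ∧ SolvesOn f γ (-T) T := by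
    intro T hT
    obtain ⟨B, hB⟩ := H T hT
    have hx₀ : ‖x₀‖ ≤ B := by
      refine hB 0 0 (by linarith) le_rfl le_rfl hT.le (fun _ => x₀) rfl ?_ 0 (by simp)
      intro t ht
      rw [Set.Icc_self] at ht ⊢
      rw [Set.mem_singleton_iff] at ht
      subst ht
      exact HasFDerivWithinAt.of_subsingleton Set.subsingleton_singleton
    have hB0 : 0 ≤ B := (norm_nonneg _).trans hx₀
    -- The cut-off field is bounded and globally Lipschitz, hence has a solution on all of `[-T,
    -- T]`. It agrees with `f` on the ball of radius `B + 1`, and the continuity argument shows that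
    -- the solution never leaves the ball of radius `B`.
    let χ : ContDiffBump (0 : E) := ⟨B + 1, B + 2, by linarith, by linarith⟩
    set g : E → E := fun x => χ x • f x with hg
    have hgc : ContDiff ℝ 1 g := χ.contDiff.smul hf
    have hgs : HasCompactSupport g := χ.hasCompactSupport.smul_right
    obtain ⟨K, hK⟩ := ContDiff.lipschitzWith_of_hasCompactSupport hgs hgc one_ne_zero
    obtain ⟨L, hL⟩ := hgs.exists_bound_of_continuous hgc.continuous
    have hgf : ∀ x, ‖x‖ ≤ B + 1 → g x = f x := by
      intro x hx
      have : χ x = 1 := χ.one_of_mem_closedBall (by simpa using hx)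
      simp [hg, this]
    obtain ⟨γ, h0, hγ⟩ := exists_solvesOn_of_bounded hK (L := L.toNNReal)
      (fun x => (hL x).trans (Real.le_coe_toNNReal L)) x₀ hT.le
    have hpos : ∀ t ∈ Set.Icc 0 T, ‖γ t‖ ≤ B := by
      refine le_of_continuousOn_of_forall_le_add_one
        ((hγ.mono (by linarith) le_rfl).continuousOn.norm) ?_ (by simpa [h0] using hx₀)
      intro t ht hs
      refine hB 0 t (by linarith) le_rfl ht.1 ht.2 γ h0 ?_ t ⟨ht.1, le_rfl⟩
      exact (hγ.mono (by linarith) ht.2).congr fun s hs' => hgf _ (hs s hs')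
    have hneg : ∀ t ∈ Set.Icc 0 T, ‖γ (-t)‖ ≤ B := by
      refine le_of_continuousOn_of_forall_le_add_one (h := fun t => ‖γ (-t)‖) ?_ ?_
        (by simpa [h0] using hx₀)
      · refine (hγ.continuousOn.comp continuousOn_neg fun t ht => ?_).norm
        exact ⟨by simpa using ht.2, by linarith [ht.1]⟩
      intro t ht hs
      refine hB (-t) 0 (by linarith [ht.2]) (by linarith [ht.1]) le_rfl hT.le γ h0 ?_ (-t)
        ⟨le_rfl, by linarith [ht.1]⟩
      refine (hγ.mono (by linarith [ht.2]) hT.le).congr fun s hs' => hgf _ ?_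
      simpa using hs (-s) ⟨by linarith [hs'.2], by linarith [hs'.1]⟩
    refine ⟨γ, h0, hγ.congr fun t ht => hgf _ ?_⟩
    rcases le_total 0 t with h | h
    · linarith [hpos t ⟨h, ht.2⟩]
    · have := hneg (-t) ⟨by linarith, by linarith [ht.1]⟩
      rw [neg_neg] at this
      linarith
  choose! α hα0 hα using step
  -- By uniqueness the solutions on growing intervals extend each other, so `t ↦ α (|t| + 1) t`
  -- glues them.
  have hαeq : ∀ T T' t : ℝ, 0 < T → T ≤ T' → |t| ≤ T → α T t = α T' t := by
    intro T T' t hT hTT' ht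
    refine SolvesOn.eqOn hf (t₀ := 0) ⟨by linarith, hT.le⟩ (hα T hT)
      ((hα T' (by linarith)).mono (by linarith) hTT') ?_ (abs_le.1 ht)
    rw [hα0 T hT, hα0 T' (by linarith)]
  refine ⟨fun t => α (|t| + 1) t, by simpa using hα0 1 one_pos, fun t => ?_⟩
  have hT : 0 < |t| + 2 := by positivity
  have hd := hα (|t| + 2) hT t ⟨by linarith [neg_abs_le t], by linarith [le_abs_self t]⟩
  have hd' := hd.hasDerivAt (Icc_mem_nhds (by linarith [neg_abs_le t]) (by linarith [le_abs_self t]))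
  beta_reduce
  rw [hαeq (|t| + 1) (|t| + 2) t (by positivity) (by linarith) (by linarith)]
  refine hd'.congr_of_eventuallyEq ?_
  have : ∀ᶠ s in nhds t, |s| < |t| + 1 :=
    continuous_abs.continuousAt.eventually_lt continuousAt_const (by linarith)
  filter_upwards [this] with s hs
  exact hαeq _ _ _ (by positivity) (by linarith) (by linarith)

end ODE

end

/-! ### The polynomial lift of a field to the sphere -/

noncomputable section

namespace PolyField

theorem contDiff_val {n : ℕ} (P : PolyField n) {m : WithTop ℕ∞} : ContDiff ℝ m P.val := by
  rw [contDiff_euclidean]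
  intro i
  refine contDiff_iff_contDiffAt.2 fun x => AnalyticAt.contDiffAt ?_
  exact AnalyticAt.aeval_mvPolynomial (A := ℝ) (f := fun (x : E n) j => x j)
    (fun j => (EuclideanSpace.proj (𝕜 := ℝ) j).analyticAt x) (P i)

/-- The polynomial `(1 - y₀) ^ d * p (y' / (1 - y₀))` for `d` at least the degree of `p`. -/
def homog {n : ℕ} (d : ℕ) (p : MvPolynomial (Fin n) ℝ) : MvPolynomial (Fin (n + 1)) ℝ :=
  ∑ m ∈ p.support, MvPolynomial.C (p.coeff m) * (1 - MvPolynomial.X 0) ^ (d - m.degree) *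
    ∏ i, MvPolynomial.X i.succ ^ m i

/-- For `y` on the sphere `y' / (1 - y₀)` is the stereographic projection `x`, and `1 - y₀ = 2 / (1
+ |x|²)`. Up to a power of two, the factor that clears the denominators is thus the one of the
reparametrized field. -/
theorem eval_homog {n d : ℕ} {p : MvPolynomial (Fin n) ℝ} (hd : p.totalDegree ≤ d)
    {y : Fin (n + 1) → ℝ} (hy : 1 - y 0 ≠ 0) :
    MvPolynomial.eval y (homog d p) =
      (1 - y 0) ^ d * MvPolynomial.eval (fun i => y i.succ / (1 - y 0)) p := by
  rw [MvPolynomial.eval_eq' _ p, homog, map_sum, Finset.mul_sum]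
  refine Finset.sum_congr rfl fun m hm => ?_
  have hmd : m.degree ≤ d := (MvPolynomial.le_totalDegree hm).trans hd
  have hdeg : m.degree = ∑ i, m i := Finsupp.degree_eq_sum m
  simp only [map_mul, map_pow, map_sub, map_one, map_prod, MvPolynomial.eval_C, MvPolynomial.eval_X]
  have : ∏ i, (y i.succ / (1 - y 0)) ^ m i = (∏ i, y i.succ ^ m i) / (1 - y 0) ^ m.degree := by
    rw [hdeg, ← Finset.prod_pow_eq_pow_sum, ← Finset.prod_div_distrib]
    simp only [div_pow]
  rw [this, ← Nat.sub_add_cancel hmd, pow_add, Nat.sub_add_cancel hmd]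
  field_simp

variable {n : ℕ} (P : PolyField n)

/-- The polynomial which is `(1 - y₀) ^ d ⟨y', P (y' / (1 - y₀))⟩`. -/
def radial : MvPolynomial (Fin (n + 1)) ℝ :=
  ∑ i, MvPolynomial.X i.succ * homog P.degree (P i)

/-- The polynomial vector field on `ℝⁿ⁺¹` whose restriction to the sphere is the push-forward of
`P.reparam` by the inverse stereographic projection. -/
def lift : PolyField (n + 1) :=
  Fin.cons (MvPolynomial.C ((2 ^ P.degree)⁻¹) * ((1 - MvPolynomial.X 0) * P.radial)) fun i =>
    MvPolynomial.C ((2 ^ P.degree)⁻¹) *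
      ((1 - MvPolynomial.X 0) * homog P.degree (P i) - MvPolynomial.X i.succ * P.radial)

theorem lift_val_zero (y : E (n + 1)) : P.lift.val y 0 =
    (2 ^ P.degree)⁻¹ * ((1 - y 0) * MvPolynomial.eval (fun j => y j) P.radial) := by
  simp [lift, val]

theorem lift_val_succ (y : E (n + 1)) (i : Fin n) : P.lift.val y i.succ =
    (2 ^ P.degree)⁻¹ * ((1 - y 0) * MvPolynomial.eval (fun j => y j) (homog P.degree (P i)) -
      y i.succ * MvPolynomial.eval (fun j => y j) P.radial) := by
  simp [lift, val]

theorem eval_radial (y : Fin (n + 1) → ℝ) : MvPolynomial.eval y P.radial =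
    ∑ i, y i.succ * MvPolynomial.eval y (homog P.degree (P i)) := by
  simp [radial]

/-- An identity in the whole ambient space. It gives tangency at `‖y‖ = 1`, and it turns `1 - ‖γ‖²`
into a solution of a homogeneous linear equation along every integral curve `γ`. -/
theorem inner_lift_val (y : E (n + 1)) : inner ℝ y (P.lift.val y) =
    (2 ^ P.degree)⁻¹ * MvPolynomial.eval (fun j => y j) P.radial * (1 - ‖y‖ ^ 2) := by
  rw [PiLp.inner_apply, EuclideanSpace.norm_sq_eq, Fin.sum_univ_succ, Fin.sum_univ_succ]
  simp only [lift_val_zero, lift_val_succ, Real.norm_eq_abs, sq_abs, RCLike.inner_apply, conj_trivial]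
  have h := P.eval_radial (fun j => y j)
  set S := MvPolynomial.eval (fun j => y j) P.radial
  have : ∑ i : Fin n, (2 ^ P.degree : ℝ)⁻¹ * ((1 - y 0) * MvPolynomial.eval (fun j => y j)
      (homog P.degree (P i)) - y i.succ * S) * y i.succ =
      (2 ^ P.degree : ℝ)⁻¹ * ((1 - y 0) * S - (∑ i : Fin n, y i.succ ^ 2) * S) := by
    rw [h, Finset.mul_sum, Finset.sum_mul, ← Finset.sum_sub_distrib, Finset.mul_sum, ← h]
    refine Finset.sum_congr rfl fun i _ => ?_
    ring
  rw [this]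
  ring

theorem lift_tangentToSphere : P.lift.TangentToSphere := by
  intro y
  rw [inner_lift_val]
  simp

theorem totalDegree_le_degree (i : Fin n) : (P i).totalDegree ≤ P.degree :=
  Finset.le_sup (f := fun i => (P i).totalDegree) (Finset.mem_univ i)

end PolyField

theorem hasDerivWithinAt_euclidean {N : ℕ} {γ : ℝ → E N} {v : E N} {s : Set ℝ} {t : ℝ} :
    HasDerivWithinAt γ v s t ↔ ∀ i, HasDerivWithinAt (fun u => γ u i) (v i) s t := by
  rw [hasDerivWithinAt_iff_hasFDerivWithinAt, hasFDerivWithinAt_euclidean]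
  refine forall_congr' fun i => ?_
  rw [hasDerivWithinAt_iff_hasFDerivWithinAt]
  refine iff_of_eq (congrArg (fun L => HasFDerivWithinAt _ L s t) ?_)
  ext
  simp

theorem hasDerivAt_euclidean {N : ℕ} {γ : ℝ → E N} {v : E N} {t : ℝ} :
    HasDerivAt γ v t ↔ ∀ i, HasDerivAt (fun u => γ u i) (v i) t := by
  simp only [← hasDerivWithinAt_univ, hasDerivWithinAt_euclidean]

theorem hasDerivAt_stereoVec_line {n : ℕ} (x v : E n) :
    HasDerivAt (fun t : ℝ => stereoVec (x + t • v))
      (WithLp.toLp 2 (Fin.cons (4 * inner ℝ x v / (1 + ‖x‖ ^ 2) ^ 2) fun k : Fin n =>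
        2 * v k / (1 + ‖x‖ ^ 2) - 4 * x k * inner ℝ x v / (1 + ‖x‖ ^ 2) ^ 2) : E (n + 1)) 0 := by
  have hN : HasDerivAt (fun t : ℝ => ‖x + t • v‖ ^ 2) (2 * inner ℝ x v) 0 := by
    have h1 : HasDerivAt (fun t : ℝ => x + t • v) v 0 := by
      simpa using ((hasDerivAt_id (0 : ℝ)).smul_const v).const_add x
    simpa using h1.norm_sq
  have hD : HasDerivAt (fun t : ℝ => 1 + ‖x + t • v‖ ^ 2) (2 * inner ℝ x v) 0 := hN.const_add 1
  have hne : (1 : ℝ) + ‖x‖ ^ 2 ≠ 0 := by positivity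
  have hne' : (1 : ℝ) + ‖x + (0 : ℝ) • v‖ ^ 2 ≠ 0 := by positivity
  rw [hasDerivAt_euclidean]
  intro i
  refine Fin.cases ?_ (fun k => ?_) i
  · have := (hN.sub_const 1).div hD hne'
    simp only [stereoVec, Fin.cons_zero]
    refine this.congr_deriv ?_
    simp only [zero_smul, add_zero]
    field_simp
    ring
  · have hk : HasDerivAt (fun t : ℝ => 2 * (x + t • v) k) (2 * v k) 0 := by
      simpa using (((hasDerivAt_id (0 : ℝ)).mul_const (v k)).const_add (x k)).const_mul 2
    have := hk.div hD hne'
    simp only [stereoVec, Fin.cons_succ]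
    refine this.congr_deriv ?_
    simp only [zero_smul, add_zero]
    field_simp
    ring

theorem contDiff_stereoVec {n : ℕ} {m : WithTop ℕ∞} : ContDiff ℝ m (stereoVec (n := n)) := by
  rw [contDiff_euclidean]
  intro i
  have hne : ∀ x : E n, (1 : ℝ) + ‖x‖ ^ 2 ≠ 0 := fun x => by positivity
  have hN : ContDiff ℝ m fun x : E n => ‖x‖ ^ 2 := contDiff_norm_sq ℝ
  refine Fin.cases ?_ (fun k => ?_) i
  · exact (hN.sub contDiff_const).div (contDiff_const.add hN) hne
  · exact (contDiff_const.mul (EuclideanSpace.proj (𝕜 := ℝ) k).contDiff).div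
      (contDiff_const.add hN) hne

theorem fderiv_stereoVec {n : ℕ} (x v : E n) : fderiv ℝ stereoVec x v =
    WithLp.toLp 2 (Fin.cons (4 * inner ℝ x v / (1 + ‖x‖ ^ 2) ^ 2) fun k : Fin n =>
        2 * v k / (1 + ‖x‖ ^ 2) - 4 * x k * inner ℝ x v / (1 + ‖x‖ ^ 2) ^ 2) := by
  have h1 : HasFDerivAt stereoVec (fderiv ℝ stereoVec x) (x + (0 : ℝ) • v) := by
    simpa using (contDiff_stereoVec (m := 1).differentiable one_ne_zero x).hasFDerivAt
  have h2 : HasDerivAt (fun t : ℝ => x + t • v) v 0 := by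
    simpa using ((hasDerivAt_id (0 : ℝ)).smul_const v).const_add x
  have h3 : HasDerivAt (fun t : ℝ => stereoVec (x + t • v)) (fderiv ℝ stereoVec x v) 0 :=
    HasFDerivAt.comp_hasDerivAt (f := fun t : ℝ => x + t • v) (0 : ℝ) h1 h2
  exact h3.unique (hasDerivAt_stereoVec_line x v)

/-- Substituting `1 - y₀ = 2 / (1 + |x|²)` produces `(2 / (1 + |x|²)) ^ d`, whose `2 ^ d` is
cancelled by the constant in `lift`; the remaining factors `1 - y₀` and `yₖ` reproduce the
derivative of `stereoVec`. -/
theorem PolyField.lift_isStereoLift {n : ℕ} (P : PolyField n) : P.lift.IsStereoLift P.reparam := by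
  intro x
  have hne : (1 : ℝ) + ‖x‖ ^ 2 ≠ 0 := by positivity
  have h0 : stereoVec x 0 = (‖x‖ ^ 2 - 1) / (1 + ‖x‖ ^ 2) := rfl
  have hs : ∀ k : Fin n, stereoVec x k.succ = 2 * x k / (1 + ‖x‖ ^ 2) := fun k => rfl
  have h1 : 1 - stereoVec x 0 = 2 / (1 + ‖x‖ ^ 2) := by
    rw [h0]; field_simp; ring
  have h1' : 1 - stereoVec x 0 ≠ 0 := by rw [h1]; positivity
  have hx : (fun i : Fin n => stereoVec x i.succ / (1 - stereoVec x 0)) = fun i => x i := by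
    funext i
    rw [h1, hs]
    field_simp
  have hQ : ∀ i, MvPolynomial.eval (fun j => stereoVec x j) (homog P.degree (P i)) =
      (2 / (1 + ‖x‖ ^ 2)) ^ P.degree * P.val x i := by
    intro i
    rw [eval_homog (P.totalDegree_le_degree i) h1', hx, h1]
    rfl
  have hS : MvPolynomial.eval (fun j => stereoVec x j) P.radial =
      (2 / (1 + ‖x‖ ^ 2)) ^ P.degree * (2 / (1 + ‖x‖ ^ 2)) * inner ℝ x (P.val x) := by
    rw [eval_radial, PiLp.inner_apply, Finset.mul_sum]
    refine Finset.sum_congr rfl fun i _ => ?_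
    rw [hQ, hs]
    simp only [RCLike.inner_apply, conj_trivial]
    ring
  have hin : inner ℝ x (P.reparam x) = ((1 + ‖x‖ ^ 2) ^ P.degree)⁻¹ * inner ℝ x (P.val x) := by
    rw [reparam, inner_smul_right]
  have hre : ∀ k, P.reparam x k = ((1 + ‖x‖ ^ 2) ^ P.degree)⁻¹ * P.val x k := fun k => rfl
  rw [fderiv_stereoVec]
  ext i
  refine Fin.cases ?_ (fun k => ?_) i
  · rw [lift_val_zero, hS, h1, div_pow]
    simp only [Fin.cons_zero, hin]
    field_simp
    ring
  · rw [lift_val_succ, hS, h1, hQ, hs, div_pow]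
    simp only [Fin.cons_succ, hin, hre]
    field_simp
    ring

end

/-! ### Completeness of the flow on the sphere -/

noncomputable section

/-- The function `1 - ‖γ‖²` vanishes at `0` and solves a homogeneous linear equation with a
coefficient that is bounded on the compact interval, so it vanishes identically. -/
theorem norm_eq_one_of_solvesOn {F : Type*} [NormedAddCommGroup F] [InnerProductSpace ℝ F]
    {f : F → F} {c : F → ℝ} (hc : Continuous c) (hf : ∀ x, inner ℝ x (f x) = c x * (1 - ‖x‖ ^ 2))
    {γ : ℝ → F} {b : ℝ} (h : SolvesOn f γ 0 b) (h0 : ‖γ 0‖ = 1) :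
    ∀ t ∈ Set.Icc 0 b, ‖γ t‖ = 1 := by
  obtain ⟨K, hK⟩ := isCompact_Icc.exists_bound_of_continuousOn (hc.comp_continuousOn h.continuousOn)
  have key : ∀ t ∈ Set.Icc 0 b, 1 - ‖γ t‖ ^ 2 = 0 := by
    refine eq_zero_of_abs_deriv_le_mul_abs_self_of_eq_zero_right (K := 2 * K)
      (f' := fun t => -(2 * (c (γ t) * (1 - ‖γ t‖ ^ 2)))) ?_ ?_ (by simp [h0]) ?_
    · exact continuousOn_const.sub (h.continuousOn.norm.pow 2)
    · intro t ht
      have h1 : HasDerivWithinAt γ (f (γ t)) (Set.Ici t) t :=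
        (h t ⟨ht.1, ht.2.le⟩).mono_of_mem_nhdsWithin (Icc_mem_nhdsGE_of_mem ht)
      have := (h1.norm_sq).const_sub 1
      rwa [hf] at this
    · intro t ht
      have := hK t ⟨ht.1, ht.2.le⟩
      simp only [Function.comp_apply] at this
      rw [norm_neg, norm_mul, norm_mul, Real.norm_ofNat, ← mul_assoc]
      gcongr
  intro t ht
  have := key t ht
  nlinarith [norm_nonneg (γ t)]

theorem norm_eq_one_of_solvesOn_Icc {F : Type*} [NormedAddCommGroup F] [InnerProductSpace ℝ F]
    {f : F → F} {c : F → ℝ} (hc : Continuous c) (hf : ∀ x, inner ℝ x (f x) = c x * (1 - ‖x‖ ^ 2))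
    {γ : ℝ → F} {a b : ℝ} (ha : a ≤ 0) (hb : 0 ≤ b) (h : SolvesOn f γ a b) (h0 : ‖γ 0‖ = 1) :
    ∀ t ∈ Set.Icc a b, ‖γ t‖ = 1 := by
  intro t ht
  rcases le_total 0 t with h' | h'
  · exact norm_eq_one_of_solvesOn hc hf (h.mono ha le_rfl) h0 t ⟨h', ht.2⟩
  · have hneg : SolvesOn (fun x => -f x) (fun s => γ (-s)) 0 (-a) := by
      intro s hs
      have h1 := h (-s) ⟨by linarith [hs.2], by linarith [hs.1]⟩
      have h2 := h1.scomp s (hasDerivWithinAt_neg s (Set.Icc 0 (-a)))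
        (fun u hu => ⟨by linarith [hu.2], by linarith [hu.1]⟩)
      simpa [Function.comp_def] using h2
    have := norm_eq_one_of_solvesOn (c := fun x => -c x) hc.neg
      (fun x => by rw [inner_neg_right, hf]; ring) hneg (by simpa using h0) (-t)
      ⟨by linarith, by linarith [ht.1]⟩
    simpa using this

namespace PolyField

variable {n : ℕ}

theorem continuous_eval (p : MvPolynomial (Fin n) ℝ) :
    Continuous fun y : E n => MvPolynomial.eval (fun j => y j) p :=
  (MvPolynomial.continuous_eval p).comp (continuous_pi fun j => (EuclideanSpace.proj j).continuous)

/-- The sphere is invariant under the ambient equation, so every integral curve that starts on it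
has the a priori bound `1` and is global. -/
theorem exists_isSphereFlow (P : PolyField n) :
    ∃ ρ : ℝ → Sph n → Sph n, P.lift.IsSphereFlow ρ := by
  have hc : Continuous fun y : E (n + 1) =>
      (2 ^ P.degree : ℝ)⁻¹ * MvPolynomial.eval (fun j => y j) P.radial :=
    continuous_const.mul (continuous_eval _)
  have key : ∀ y : Sph n, ∃ γ : ℝ → E (n + 1), γ 0 = y ∧
      ∀ t, HasDerivAt γ (P.lift.val (γ t)) t := by
    intro y
    refine exists_global_solution P.lift.contDiff_val _ fun T _ => ⟨1, ?_⟩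
    intro a b _ ha hb _ γ h0 h t ht
    exact (norm_eq_one_of_solvesOn_Icc hc P.inner_lift_val ha hb h (by simp [h0]) t ht).le
  choose γ h0 hγ using key
  have hmem : ∀ y t, γ y t ∈ Metric.sphere (0 : E (n + 1)) 1 := by
    intro y t
    rw [mem_sphere_zero_iff_norm]
    exact norm_eq_one_of_solvesOn_Icc hc P.inner_lift_val (a := min 0 t) (b := max 0 t)
      (min_le_left _ _) (le_max_left _ _) (solvesOn_of_hasDerivAt (hγ y) _ _) (by simp [h0]) t
      ⟨min_le_right _ _, le_max_right _ _⟩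
  exact ⟨fun t y => ⟨γ y t, hmem y t⟩, fun y => ⟨Subtype.ext (h0 y), fun t => hγ y t⟩⟩

theorem IsSphereFlow.eq_of_hasDerivAt {Y : PolyField (n + 1)} {ρ : ℝ → Sph n → Sph n}
    (h : Y.IsSphereFlow ρ) {γ : ℝ → E (n + 1)} (hγ : ∀ t, HasDerivAt γ (Y.val (γ t)) t) {y : Sph n}
    (h0 : γ 0 = y) (t : ℝ) : (ρ t y : E (n + 1)) = γ t :=
  congrFun (_root_.eq_of_hasDerivAt Y.contDiff_val (fun t => (h y).2 t) hγ
    (by rw [(h y).1, h0])) t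

theorem IsSphereFlow.add {Y : PolyField (n + 1)} {ρ : ℝ → Sph n → Sph n}
    (h : Y.IsSphereFlow ρ) (s t : ℝ) (y : Sph n) : ρ (s + t) y = ρ s (ρ t y) := by
  refine Subtype.ext (h.eq_of_hasDerivAt (γ := fun s => (ρ (s + t) y : E (n + 1))) ?_ ?_ s).symm
  · exact fun u => ((h y).2 (u + t)).comp_add_const u t
  · simp

end PolyField

end

/-! ### Analytic dependence of the flow on the initial point -/

noncomputable section

section AnalyticDependence

/-- A Banach algebra: one coordinate of a path. The integral equation of the flow is solved in a
power of it by the analytic inverse function theorem. -/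
abbrev UnitPath : Type := C(Set.Icc (0 : ℝ) 1, ℝ)

/-- The primitive, vanishing at `0`, of a continuous function on the unit interval. -/
def primitive : UnitPath →L[ℝ] UnitPath :=
  LinearMap.mkContinuous
    { toFun := fun u => ⟨fun t => ∫ s in (0 : ℝ)..t, Set.IccExtend zero_le_one u s, by
        have : Continuous fun t : ℝ => ∫ s in (0 : ℝ)..t, Set.IccExtend zero_le_one u s :=
          intervalIntegral.continuous_primitive
            (fun a b => (u.continuous.Icc_extend' (h := zero_le_one)).intervalIntegrable a b) 0
        exact this.comp continuous_subtype_val⟩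
      map_add' := by
        intro u v
        ext t
        simp only [ContinuousMap.coe_mk, ContinuousMap.add_apply]
        rw [← intervalIntegral.integral_add
          ((u.continuous.Icc_extend' (h := zero_le_one)).intervalIntegrable _ _)
          ((v.continuous.Icc_extend' (h := zero_le_one)).intervalIntegrable _ _)]
        rfl
      map_smul' := by
        intro c u
        ext t
        simp only [ContinuousMap.coe_mk, ContinuousMap.smul_apply, RingHom.id_apply, smul_eq_mul]
        rw [← intervalIntegral.integral_const_mul]
        rfl } 1 (by
    intro u
    rw [ContinuousMap.norm_le _ (by positivity)]
    intro t
    have := intervalIntegral.norm_integral_le_of_norm_le_const (a := 0) (b := (t : ℝ)) (C := ‖u‖)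
      (f := Set.IccExtend zero_le_one u) (fun s _ => u.norm_coe_le_norm _)
    refine this.trans ?_
    rw [one_mul, sub_zero, abs_of_nonneg t.2.1]
    exact mul_le_of_le_one_right (norm_nonneg _) t.2.2)

theorem primitive_apply (u : UnitPath) (t : Set.Icc (0 : ℝ) 1) :
    primitive u t = ∫ s in (0 : ℝ)..t, Set.IccExtend zero_le_one u s := rfl

theorem hasDerivWithinAt_primitive (u : UnitPath) {t : ℝ} (ht : t ∈ Set.Icc (0 : ℝ) 1) :
    HasDerivWithinAt (Set.IccExtend zero_le_one (primitive u)) (u ⟨t, ht⟩) (Set.Icc 0 1) t := by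
  have h := intervalIntegral.integral_hasDerivAt_right (a := 0) (b := t)
    ((u.continuous.Icc_extend' (h := zero_le_one)).intervalIntegrable _ _)
    ((u.continuous.Icc_extend' (h := zero_le_one)).stronglyMeasurableAtFilter _ _)
    (u.continuous.Icc_extend' (h := zero_le_one)).continuousAt
  rw [Set.IccExtend_of_mem _ _ ht] at h
  refine h.hasDerivWithinAt.congr (fun s hs => ?_) ?_
  · rw [Set.IccExtend_of_mem _ _ hs, primitive_apply]
  · rw [Set.IccExtend_of_mem _ _ ht, primitive_apply]

variable {N : ℕ}


/-- The map whose zeros `(γ, x, δ)` are the paths `γ` on the unit interval with `γ 0 = x` which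
solve `γ' = δ • Y γ`, together with the parameters. -/
def shootMap (Y : PolyField N) (z : (Fin N → UnitPath) × E N × ℝ) :
    (Fin N → UnitPath) × E N × ℝ :=
  (fun i => z.1 i - algebraMapCLM ℝ UnitPath (z.2.1 i) -
    z.2.2 • primitive (MvPolynomial.aeval z.1 (Y i)), z.2.1, z.2.2)

/-- A polynomial in elements of a Banach algebra is analytic, and `primitive` is continuous and
linear. -/
theorem analyticAt_primitive_aeval (p : MvPolynomial (Fin N) ℝ) (γ : Fin N → UnitPath) :
    AnalyticAt ℝ (fun γ : Fin N → UnitPath => primitive (MvPolynomial.aeval γ p)) γ :=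
  (primitive.analyticAt _).comp (AnalyticAt.aeval_mvPolynomial (A := ℝ)
    (f := fun (γ : Fin N → UnitPath) i => γ i)
    (fun i => (ContinuousLinearMap.proj (R := ℝ) i).analyticAt γ) p)

theorem contDiff_shootMap (Y : PolyField N) : ContDiff ℝ ω (shootMap Y) := by
  refine ContDiff.prodMk (contDiff_pi.2 fun i => ?_) (contDiff_fst.comp contDiff_snd |>.prodMk
    (contDiff_snd.comp contDiff_snd))
  refine ContDiff.sub (ContDiff.sub ?_ ?_) ?_
  · exact (ContinuousLinearMap.proj (R := ℝ) (φ := fun _ : Fin N => UnitPath) i).contDiff.comp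
      contDiff_fst
  · exact (algebraMapCLM ℝ UnitPath).contDiff.comp
      ((EuclideanSpace.proj (𝕜 := ℝ) i).contDiff.comp (contDiff_fst.comp contDiff_snd))
  · refine (contDiff_snd.comp contDiff_snd).smul ?_
    refine ContDiff.comp (g := fun γ : Fin N → UnitPath => primitive (MvPolynomial.aeval γ (Y i)))
      (contDiff_iff_contDiffAt.2 fun γ => (analyticAt_primitive_aeval _ γ).contDiffAt) contDiff_fst

/-- The shear which is the derivative of `shootMap` at parameter `0`. -/
def shear (b : Fin N → UnitPath) :
    ((Fin N → UnitPath) × E N × ℝ) ≃L[ℝ] ((Fin N → UnitPath) × E N × ℝ) :=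
  let A : E N × ℝ →L[ℝ] (Fin N → UnitPath) := ContinuousLinearMap.pi fun i =>
    (algebraMapCLM ℝ UnitPath).comp ((EuclideanSpace.proj i).comp (ContinuousLinearMap.fst ℝ _ _)) +
      (ContinuousLinearMap.snd ℝ (E N) ℝ).smulRight (b i)
  ContinuousLinearEquiv.equivOfInverse
    ((ContinuousLinearMap.fst ℝ _ _ - A.comp (ContinuousLinearMap.snd ℝ _ _)).prod
      (ContinuousLinearMap.snd ℝ _ _))
    ((ContinuousLinearMap.fst ℝ _ _ + A.comp (ContinuousLinearMap.snd ℝ _ _)).prod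
      (ContinuousLinearMap.snd ℝ _ _))
    (fun z => by simp) (fun z => by simp)

/-- At parameter `0` the nonlinear term `δ • primitive (Y γ)` contributes only its cofactor times
the increment of `δ`. The derivative is therefore a shear, invertible for every `Y`, and no
linearized equation has to be solved. -/
theorem hasFDerivAt_shootMap (Y : PolyField N) (γ : Fin N → UnitPath) (x : E N) :
    HasFDerivAt (shootMap Y)
      (shear (fun i => primitive (MvPolynomial.aeval γ (Y i))) :
        ((Fin N → UnitPath) × E N × ℝ) →L[ℝ] ((Fin N → UnitPath) × E N × ℝ)) (γ, x, 0) := by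
  have hsnd : HasFDerivAt (fun z : (Fin N → UnitPath) × E N × ℝ => z.2)
      (ContinuousLinearMap.snd ℝ _ _) (γ, x, 0) := hasFDerivAt_snd
  have hfst : HasFDerivAt (fun z : (Fin N → UnitPath) × E N × ℝ => z.1)
      (ContinuousLinearMap.fst ℝ _ _) (γ, x, 0) := hasFDerivAt_fst
  refine HasFDerivAt.prodMk ?_ hsnd
  rw [show ((ContinuousLinearMap.fst ℝ _ _ - (ContinuousLinearMap.pi fun i =>
    (algebraMapCLM ℝ UnitPath).comp ((EuclideanSpace.proj i).comp (ContinuousLinearMap.fst ℝ _ _)) +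
      (ContinuousLinearMap.snd ℝ (E N) ℝ).smulRight
        (primitive (MvPolynomial.aeval γ (Y i)))).comp (ContinuousLinearMap.snd ℝ _ _)) :
    (Fin N → UnitPath) × E N × ℝ →L[ℝ] (Fin N → UnitPath)) = ContinuousLinearMap.pi fun i =>
      (ContinuousLinearMap.proj i).comp (ContinuousLinearMap.fst ℝ _ _) -
      ((algebraMapCLM ℝ UnitPath).comp ((EuclideanSpace.proj i).comp (ContinuousLinearMap.fst ℝ _ _)) +
      (ContinuousLinearMap.snd ℝ (E N) ℝ).smulRight
        (primitive (MvPolynomial.aeval γ (Y i)))).comp (ContinuousLinearMap.snd ℝ _ _) from rfl]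
  refine hasFDerivAt_pi.2 fun i => ?_
  have h1 : HasFDerivAt (fun z : (Fin N → UnitPath) × E N × ℝ => z.1 i)
      ((ContinuousLinearMap.proj i).comp (ContinuousLinearMap.fst ℝ _ _)) (γ, x, 0) :=
    (ContinuousLinearMap.proj (R := ℝ) (φ := fun _ : Fin N => UnitPath) i).hasFDerivAt.comp _ hfst
  have h2 : HasFDerivAt (fun z : (Fin N → UnitPath) × E N × ℝ => algebraMapCLM ℝ UnitPath (z.2.1 i))
      ((algebraMapCLM ℝ UnitPath).comp ((EuclideanSpace.proj i).comp
        ((ContinuousLinearMap.fst ℝ _ _).comp (ContinuousLinearMap.snd ℝ _ _)))) (γ, x, 0) := by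
    let l : (Fin N → UnitPath) × E N × ℝ →L[ℝ] UnitPath :=
      (algebraMapCLM ℝ UnitPath).comp ((EuclideanSpace.proj i).comp
        ((ContinuousLinearMap.fst ℝ _ _).comp (ContinuousLinearMap.snd ℝ _ _)))
    exact l.hasFDerivAt
  have h3 : HasFDerivAt (fun z : (Fin N → UnitPath) × E N × ℝ => z.2.2)
      ((ContinuousLinearMap.snd ℝ _ _).comp (ContinuousLinearMap.snd ℝ _ _)) (γ, x, 0) := by
    let l : (Fin N → UnitPath) × E N × ℝ →L[ℝ] ℝ :=
      (ContinuousLinearMap.snd ℝ _ _).comp (ContinuousLinearMap.snd ℝ _ _)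
    exact l.hasFDerivAt
  have h4 := ((analyticAt_primitive_aeval (Y i) γ).differentiableAt.hasFDerivAt).comp
    (γ, x, (0 : ℝ)) hfst
  refine ((h1.sub h2).sub (h3.smul h4)).congr_fderiv ?_
  ext z <;> simp

/-- The path on the line through a family of continuous functions on the unit interval. -/
def pathOf (γ : Fin N → UnitPath) (t : ℝ) : E N :=
  WithLp.toLp 2 fun i => Set.IccExtend zero_le_one (γ i) t

theorem solvesOn_of_shootMap {Y : PolyField N} {γ : Fin N → UnitPath} {x : E N} {δ : ℝ}
    (h : shootMap Y (γ, x, δ) = (0, x, δ)) :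
    pathOf γ 0 = x ∧ SolvesOn (fun y => δ • Y.val y) (pathOf γ) 0 1 := by
  have h1 : ∀ i, γ i = algebraMapCLM ℝ UnitPath (x i) +
      δ • primitive (MvPolynomial.aeval γ (Y i)) := by
    intro i
    have := congrFun (congrArg Prod.fst h) i
    simp only [shootMap, Pi.zero_apply] at this
    rw [sub_sub, sub_eq_zero] at this
    exact this
  have h2 : ∀ i, ∀ t ∈ Set.Icc (0 : ℝ) 1, pathOf γ t i = x i + δ *
      Set.IccExtend zero_le_one (primitive (MvPolynomial.aeval γ (Y i))) t := by
    intro i t ht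
    simp only [pathOf]
    rw [h1 i, Set.IccExtend_of_mem _ _ ht, Set.IccExtend_of_mem _ _ ht]
    simp
  constructor
  · ext i
    rw [h2 i 0 (by simp), Set.IccExtend_of_mem _ _ (by simp), primitive_apply]
    simp
  · intro t ht
    rw [hasDerivWithinAt_euclidean]
    intro i
    have h3 := ((hasDerivWithinAt_primitive (MvPolynomial.aeval γ (Y i)) ht).const_mul δ).const_add
      (x i)
    refine (h3.congr (fun s hs => h2 i s hs) (h2 i t ht)).congr_deriv ?_
    have h4 : (MvPolynomial.aeval γ (Y i) : UnitPath) ⟨t, ht⟩ =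
        MvPolynomial.eval (fun j => pathOf γ t j) (Y i) := by
      have := DFunLike.congr_fun (MvPolynomial.comp_aeval (R := ℝ) γ
        (ContinuousMap.evalAlgHom ℝ ℝ (⟨t, ht⟩ : Set.Icc (0 : ℝ) 1))) (Y i)
      rw [AlgHom.comp_apply] at this
      refine this.trans ?_
      change MvPolynomial.eval _ (Y i) = _
      refine congrArg (fun v => MvPolynomial.eval v (Y i)) (funext fun j => ?_)
      simp [pathOf, Set.IccExtend_of_mem _ _ ht]
    simp [PolyField.val, h4]

/-- The constant path at `x₀` solves the equation for `δ = 0`. The local inverse of `shootMap` there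
is analytic and yields the solutions for all nearby initial points and parameters; `G` is their
value at time `1`. -/
theorem exists_local_analytic_flow (Y : PolyField N) (x₀ : E N) :
    ∀ᶠ z : E N × ℝ in nhds (x₀, 0), ∃ G : E N → E N, ContDiffAt ℝ ω G z.1 ∧
      ∀ᶠ x in nhds z.1, ∃ γ : ℝ → E N, γ 0 = x ∧ γ 1 = G x ∧
        SolvesOn (fun y => z.2 • Y.val y) γ 0 1 := by
  set c : Fin N → UnitPath := fun i => algebraMapCLM ℝ UnitPath (x₀ i)
  have hC : ContDiffAt ℝ ω (shootMap Y) (c, x₀, 0) := (contDiff_shootMap Y).contDiffAt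
  have hD := hasFDerivAt_shootMap Y c x₀
  have hω : (ω : WithTop ℕ∞) ≠ 0 := by simp
  set e := hC.toOpenPartialHomeomorph _ hD hω
  have hval : shootMap Y (c, x₀, 0) = (0, x₀, 0) := by
    refine Prod.ext ?_ rfl
    funext i
    simp [shootMap, c]
  have htarget : ((0, x₀, 0) : (Fin N → UnitPath) × E N × ℝ) ∈ e.target := by
    rw [← hval]
    exact hC.image_mem_toOpenPartialHomeomorph_target hD hω
  have hsymm : ContDiffAt ℝ ω e.symm (0, x₀, 0) := by
    have := hC.to_localInverse hD hω
    rwa [hval] at this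
  have hev : ∀ᶠ w in nhds ((0, x₀, 0) : (Fin N → UnitPath) × E N × ℝ),
      w ∈ e.target ∧ ContDiffAt ℝ ω e.symm w :=
    (Filter.eventually_of_mem (e.open_target.mem_nhds htarget) fun _ h => h).and (hsymm.eventually (by simp))
  have hι : Continuous fun z : E N × ℝ => ((0, z.1, z.2) : (Fin N → UnitPath) × E N × ℝ) := by
    fun_prop
  have hev' := (hι.tendsto (x₀, (0 : ℝ))).eventually hev
  filter_upwards [hev'.eventually_nhds] with z hz
  have hz0 := hz.self_of_nhds
  refine ⟨fun x => pathOf (e.symm (0, x, z.2)).1 1, ?_, ?_⟩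
  · rw [contDiffAt_euclidean]
    intro i
    have h1 : ContDiffAt ℝ ω (fun x : E N => e.symm (0, x, z.2)) z.1 :=
      ContDiffAt.comp z.1 (f := fun x : E N => ((0, x, z.2) : (Fin N → UnitPath) × E N × ℝ))
        hz0.2 (by fun_prop)
    have h2 : ContDiffAt ℝ ω (fun x : E N => (e.symm (0, x, z.2)).1 i) z.1 :=
      (ContinuousLinearMap.proj (R := ℝ) (φ := fun _ : Fin N => UnitPath) i).contDiff.contDiffAt.comp
        _ h1.fst
    have h3 : (fun x : E N => pathOf (e.symm (0, x, z.2)).1 1 i) =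
        fun x => (e.symm (0, x, z.2)).1 i 1 :=
      funext fun x => Set.IccExtend_of_mem _ _ (by simp)
    rw [h3]
    exact (ContinuousMap.evalCLM ℝ (1 : Set.Icc (0 : ℝ) 1)).contDiff.contDiffAt.comp _ h2
  · have hcont : Continuous fun x : E N => (x, z.2) := by fun_prop
    have := (hcont.tendsto z.1).eventually hz
    filter_upwards [this] with x hx
    have hr : shootMap Y (e.symm (0, x, z.2)) = (0, x, z.2) := e.right_inv hx.1
    generalize e.symm (0, x, z.2) = w at hr ⊢
    obtain ⟨γ, x', d⟩ := w
    have hx' : x' = x := congrArg (fun w => w.2.1) hr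
    have hd : d = z.2 := congrArg (fun w => w.2.2) hr
    subst hx'
    subst hd
    obtain ⟨h0, hs⟩ := solvesOn_of_shootMap hr
    exact ⟨pathOf γ, h0, rfl, hs⟩

/-- The admissible parameters depend on the base point; compactness of `K` provides a common
neighbourhood of `0`. -/
theorem exists_uniform_analytic_flow (Y : PolyField N) {K : Set (E N)} (hK : IsCompact K) :
    ∀ᶠ δ : ℝ in nhds 0, ∀ x₀ ∈ K, ∃ G : E N → E N, ContDiffAt ℝ ω G x₀ ∧
      ∀ᶠ x in nhds x₀, ∃ γ : ℝ → E N, γ 0 = x ∧ γ 1 = G x ∧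
        SolvesOn (fun y => δ • Y.val y) γ 0 1 := by
  refine hK.eventually_forall_of_forall_eventually fun x₀ _ => ?_
  exact (continuous_swap.tendsto ((0 : ℝ), x₀)).eventually (exists_local_analytic_flow Y x₀)

end AnalyticDependence
end

noncomputable section

/-! ### The time-`δ` map on the sphere -/

namespace PolyField

variable {n : ℕ}

/-- By uniqueness, `t ↦ ρ (δ t) y` is the solution of the rescaled equation, so `ρ δ` is locally the
restriction of an analytic map `G` of the ambient space. -/
theorem IsSphereFlow.contMDiff {Y : PolyField (n + 1)} {ρ : ℝ → Sph n → Sph n}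
    (h : Y.IsSphereFlow ρ) {δ : ℝ}
    (hδ : ∀ x₀ ∈ Metric.sphere (0 : E (n + 1)) 1, ∃ G : E (n + 1) → E (n + 1),
      ContDiffAt ℝ ω G x₀ ∧ ∀ᶠ x in nhds x₀, ∃ γ : ℝ → E (n + 1), γ 0 = x ∧ γ 1 = G x ∧
        SolvesOn (fun y => δ • Y.val y) γ 0 1) :
    ContMDiff (𝓡 n) (𝓡 n) ω (ρ δ) := by
  have := Fact.mk (@finrank_euclideanSpace_fin ℝ _ (n + 1))
  have key : ContMDiff (𝓡 n) 𝓘(ℝ, E (n + 1)) ω fun y : Sph n => (ρ δ y : E (n + 1)) := by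
    intro y₀
    obtain ⟨G, hG, hev⟩ := hδ y₀ y₀.2
    have h1 : ContMDiffAt (𝓡 n) 𝓘(ℝ, E (n + 1)) ω (fun y : Sph n => G y) y₀ :=
      ContMDiffAt.comp y₀ (g := G) hG.contMDiffAt
        (contMDiff_coe_sphere (E := E (n + 1)) (n := n) (m := ω) y₀)
    refine h1.congr_of_eventuallyEq ?_
    have hev' := (continuous_subtype_val.tendsto y₀).eventually hev
    filter_upwards [hev'] with y hy
    obtain ⟨γ, h0, hG1, hs⟩ := hy
    have hs' : SolvesOn (fun y => δ • Y.val y) (fun t => (ρ (δ * t) y : E (n + 1))) 0 1 := by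
      refine solvesOn_of_hasDerivAt (fun t => ?_) 0 1
      have := ((h y).2 (δ * t)).scomp t ((hasDerivAt_id t).const_mul δ)
      simpa [Function.comp_def] using this
    have := SolvesOn.eqOn (Y.contDiff_val.const_smul δ) (t₀ := 0) (by simp) hs hs'
      (by simp [h0, (h y).1]) (show (1 : ℝ) ∈ Set.Icc 0 1 by simp)
    rw [← hG1, this]
    simp
  exact key.codRestrict_sphere fun y => (ρ δ y).2

/-- The time-`δ` map of the flow, for small `δ`. -/
theorem IsSphereFlow.exists_diffeomorph {Y : PolyField (n + 1)} {ρ : ℝ → Sph n → Sph n}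
    (h : Y.IsSphereFlow ρ) : ∃ δ : ℝ, 0 < δ ∧
      ∃ F : Diffeomorph (𝓡 n) (𝓡 n) (Sph n) (Sph n) ω, ∀ y, F y = ρ δ y := by
  have h1 := exists_uniform_analytic_flow Y (isCompact_sphere (0 : E (n + 1)) 1)
  -- The parameter `-δ` is needed as well, since the inverse diffeomorphism is `ρ (-δ)`.
  have h2 := ((continuous_neg.tendsto' (0 : ℝ) 0 neg_zero).eventually h1)
  obtain ⟨ε, hε, hball⟩ := Metric.eventually_nhds_iff.1 (h1.and h2)
  have hδ := hball (y := ε / 2) (by rw [dist_zero_right, Real.norm_eq_abs, abs_of_pos] <;> linarith)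
  refine ⟨ε / 2, by positivity, ⟨⟨ρ (ε / 2), ρ (-(ε / 2)), fun y => ?_, fun y => ?_⟩,
    h.contMDiff hδ.1, h.contMDiff hδ.2⟩, fun y => rfl⟩
  · rw [← h.add, neg_add_cancel, (h y).1]
  · rw [← h.add, add_neg_cancel, (h y).1]

end PolyField

/-! ### Orbits on the sphere and orbits in `ℝⁿ` -/

section Stereo

variable {n : ℕ}

/-- The stereographic projection, left inverse to `stereoVec`. -/
def stereoProj (y : E (n + 1)) : E n := WithLp.toLp 2 fun k => y k.succ / (1 - y 0)

theorem one_sub_stereoVec_zero (x : E n) : 1 - stereoVec x 0 = 2 / (1 + ‖x‖ ^ 2) := by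
  have h : (1 : ℝ) + ‖x‖ ^ 2 ≠ 0 := by positivity
  change 1 - (‖x‖ ^ 2 - 1) / (1 + ‖x‖ ^ 2) = _
  field_simp
  ring

theorem stereoProj_stereoVec (x : E n) : stereoProj (stereoVec x) = x := by
  have h : (1 : ℝ) + ‖x‖ ^ 2 ≠ 0 := by positivity
  ext k
  have hk : stereoVec x k.succ = 2 * x k / (1 + ‖x‖ ^ 2) := rfl
  change stereoVec x k.succ / (1 - stereoVec x 0) = x k
  rw [one_sub_stereoVec_zero, hk]
  field_simp

theorem stereo_injective : Function.Injective (stereo (n := n)) := fun x x' h => by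
  rw [← stereoProj_stereoVec x, ← stereoProj_stereoVec x']
  exact congrArg (fun y : Sph n => stereoProj (y : E (n + 1))) h

theorem stereoVec_stereoProj {y : E (n + 1)} (hy : ‖y‖ = 1) (h0 : y 0 < 1) :
    stereoVec (stereoProj y) = y := by
  have hne : 1 - y 0 ≠ 0 := by linarith
  have hs : y 0 ^ 2 + ∑ k : Fin n, y k.succ ^ 2 = 1 := by
    have := EuclideanSpace.norm_sq_eq y
    rw [hy, Fin.sum_univ_succ] at this
    simpa using this.symm
  have hN : ‖stereoProj y‖ ^ 2 = (1 + y 0) / (1 - y 0) := by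
    rw [EuclideanSpace.norm_sq_eq]
    simp only [stereoProj, Real.norm_eq_abs, sq_abs, div_pow]
    rw [← Finset.sum_div, eq_sub_of_add_eq' hs]
    field_simp
    ring
  have h1 : 1 + ‖stereoProj y‖ ^ 2 = 2 / (1 - y 0) := by
    rw [hN]; field_simp; ring
  ext i
  refine Fin.cases ?_ (fun k => ?_) i
  · change (‖stereoProj y‖ ^ 2 - 1) / (1 + ‖stereoProj y‖ ^ 2) = y 0
    rw [h1, hN]
    field_simp
    ring
  · change 2 * (y k.succ / (1 - y 0)) / (1 + ‖stereoProj y‖ ^ 2) = y k.succ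
    rw [h1]
    field_simp

/-- The image is the preimage of `V` under the stereographic projection, which is continuous on the
open complement of the north pole. -/
theorem isOpen_image_stereo {V : Set (E n)} (hV : IsOpen V) : IsOpen (stereo '' V) := by
  have hU : IsOpen {y : Sph n | (y : E (n + 1)) 0 < 1} :=
    isOpen_lt ((EuclideanSpace.proj (𝕜 := ℝ) 0).continuous.comp continuous_subtype_val)
      continuous_const
  have hc : ContinuousOn (fun y : Sph n => stereoProj (y : E (n + 1)))
      {y : Sph n | (y : E (n + 1)) 0 < 1} := by
    refine (PiLp.continuous_toLp 2 _).comp_continuousOn (continuousOn_pi.2 fun k => ?_)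
    refine ContinuousOn.div ?_ ?_ fun y hy => (sub_pos.2 hy).ne'
    · exact ((EuclideanSpace.proj (𝕜 := ℝ) k.succ).continuous.comp
        continuous_subtype_val).continuousOn
    · exact (continuous_const.sub ((EuclideanSpace.proj (𝕜 := ℝ) 0).continuous.comp
        continuous_subtype_val)).continuousOn
  convert hc.isOpen_inter_preimage hU hV using 1
  ext y
  constructor
  · rintro ⟨x, hx, rfl⟩
    refine ⟨?_, ?_⟩
    · have := one_sub_stereoVec_zero x
      have h2 : (0 : ℝ) < 2 / (1 + ‖x‖ ^ 2) := by positivity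
      simp only [Set.mem_ofPred_eq, stereo]
      linarith
    · simpa [stereo, stereoProj_stereoVec] using hx
  · rintro ⟨h0, hy⟩
    exact ⟨_, hy, Subtype.ext (stereoVec_stereoProj (by simp) h0)⟩

theorem isOpen_slab (d : SlabData n) : IsOpen (slab d) := by
  have : slab d = ⋃ m : ℕ, {x : E n | (d.2.1 : ℝ) + m * (d.2.2.2.1 : ℝ) <
      ((d.2.2.2.2 : ℝ) + 1) * x d.1 ∧
      ((d.2.2.2.2 : ℝ) + 1) * x d.1 < (d.2.2.1 : ℝ) + m * (d.2.2.2.1 : ℝ)} := by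
    ext x; simp [slab]
  rw [this]
  have hc : Continuous fun x : E n => ((d.2.2.2.2 : ℝ) + 1) * x d.1 :=
    continuous_const.mul (EuclideanSpace.proj (𝕜 := ℝ) d.1).continuous
  exact isOpen_iUnion fun m => (isOpen_lt continuous_const hc).inter (isOpen_lt hc continuous_const)

theorem isOpen_slabs (l : List (SlabData n)) : IsOpen (slabs l) := by
  have : slabs l = ⋂ d ∈ {d | d ∈ l}, slab d := by
    ext x; simp [slabs]
  rw [this]
  exact (List.finite_toSet l).isOpen_biInter fun d _ => isOpen_slab d

end Stereo

/-- A global integral curve of `P` can be reparametrized to one of `P.reparam`. -/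
theorem PolyField.exists_timeChange {n : ℕ} {P : PolyField n} {x : ℝ → E n}
    (hx : ∀ t, HasDerivAt x (P.val (x t)) t) : ∃ θ : ℝ → ℝ, θ 0 = 0 ∧
      Filter.Tendsto θ Filter.atTop Filter.atTop ∧
      ∀ s, HasDerivAt (fun s => x (θ s)) (P.reparam (x (θ s))) s := by
  have hxc : Continuous x := continuous_iff_continuousAt.2 fun t => (hx t).continuousAt
  set g : ℝ → ℝ := fun t => (1 + ‖x t‖ ^ 2) ^ P.degree with hg
  have hgc : Continuous g := by fun_prop
  have hg1 : ∀ t, 1 ≤ g t := fun t => one_le_pow₀ (by nlinarith [sq_nonneg ‖x t‖])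
  -- Since `S' = g ≥ 1`, `S` is an increasing bijection of the line; its inverse `θ` has derivative
  -- `1 / g`, the factor in `reparam`.
  set S : ℝ → ℝ := fun t => ∫ u in (0 : ℝ)..t, g u with hS
  have hSd : ∀ t, HasDerivAt S (g t) t := fun t => hgc.integral_hasStrictDerivAt 0 t |>.hasDerivAt
  have hSmono : StrictMono S := strictMono_of_hasDerivAt_pos hSd fun t => by linarith [hg1 t]
  have hSsub : Monotone fun t => S t - t := by
    refine monotone_of_hasDerivAt_nonneg (f' := fun t => g t - 1)
      (fun t => (hSd t).sub (hasDerivAt_id t)) fun t => ?_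
    have := hg1 t
    simp only [Pi.zero_apply]
    linarith
  have hS0 : S 0 = 0 := by simp [hS]
  have htop : Filter.Tendsto S Filter.atTop Filter.atTop := by
    refine Filter.tendsto_atTop_mono' _ ?_ Filter.tendsto_id
    filter_upwards [Filter.eventually_ge_atTop 0] with t ht
    have := hSsub ht
    simp only [hS0] at this
    simp only [id]
    linarith
  have hbot : Filter.Tendsto S Filter.atBot Filter.atBot := by
    refine Filter.tendsto_atBot_mono' _ ?_ Filter.tendsto_id
    filter_upwards [Filter.eventually_le_atBot 0] with t ht
    have := hSsub ht
    simp only [hS0] at this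
    simp only [id]
    linarith
  have hSc : Continuous S := continuous_iff_continuousAt.2 fun t => (hSd t).continuousAt
  let e : ℝ ≃o ℝ := hSmono.orderIsoOfSurjective S (hSc.surjective htop hbot)
  have hee : ∀ s, S (e.symm s) = s := fun s => e.apply_symm_apply s
  refine ⟨e.symm, ?_, e.symm.tendsto_atTop, fun s => ?_⟩
  · rw [OrderIso.symm_apply_eq]
    exact hS0.symm
  · have h1 : HasDerivAt e.symm (g (e.symm s))⁻¹ s :=
      (hSd (e.symm s)).of_local_left_inverse e.symm.continuous.continuousAt
        (by linarith [hg1 (e.symm s)]) (Filter.Eventually.of_forall hee)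
    exact (hx (e.symm s)).scomp s h1

/-- If the initial points lie on global integral curves of `P` that end up in the open set of an
output string in case of this output, and never visit it otherwise, then `P` and the time-`δ` map
of its lift to the sphere are Turing complete. -/
theorem isTuringCompleteVia_of_curves {n : ℕ} {P : PolyField n} {e : Encoding n}
    (H : ∀ (T : TM) (t : T.Tape) (k₀ : ℕ), T.SupportedIn t k₀ → ∃ x : ℝ → E n,
      x 0 = e.point T t k₀ ∧ (∀ τ, HasDerivAt x (P.val (x τ)) τ) ∧
      ∀ (k : ℕ) (w : Fin (2 * k + 1) → T.Symbol),
        (T.HaltsWith t k w → ∀ᶠ τ in Filter.atTop, x τ ∈ e.region T w) ∧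
        ∀ τ, x τ ∈ e.region T w → T.HaltsWith t k w) :
    P.IsTuringCompleteVia e ∧
      ∀ (ρ : ℝ → Sph n → Sph n) (δ : ℝ) (F : Equiv.Perm (Sph n)), P.lift.IsSphereFlow ρ → 0 < δ →
        (∀ y, F y = ρ δ y) → IsTuringCompleteVia e F := by
  constructor
  · intro T t k₀ ht k w
    obtain ⟨x, hx0, hx, hH⟩ := H T t k₀ ht
    have key : ∀ τ, P.ReachesAt (e.point T t k₀) (e.region T w) τ → T.HaltsWith t k w := by
      rintro τ ⟨γ, h0, hγ, hV⟩
      have : γ τ = x τ := SolvesOn.eqOn P.contDiff_val (a := min 0 τ) (b := max 0 τ) (t₀ := 0)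
        ⟨min_le_left _ _, le_max_left _ _⟩ hγ (solvesOn_of_hasDerivAt hx _ _) (by rw [h0, hx0])
        ⟨min_le_right _ _, le_max_right _ _⟩
      exact (hH k w).2 τ (this ▸ hV)
    have key' : T.HaltsWith t k w →
        ∃ τ : ℝ, 0 ≤ τ ∧ P.ReachesAt (e.point T t k₀) (e.region T w) τ := by
      intro h
      obtain ⟨τ, h1, h2⟩ := (((hH k w).1 h).and (Filter.eventually_ge_atTop 0)).exists
      exact ⟨τ, h2, x, hx0, fun s _ => (hx s).hasDerivWithinAt, h1⟩
    exact ⟨isOpen_slabs _, ⟨fun ⟨τ, _, h⟩ => key τ h, key'⟩,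
      ⟨fun ⟨τ, h⟩ => key τ h, fun h => (key' h).imp fun τ h => h.2⟩⟩
  · intro ρ δ F hρ hδ hF T t k₀ ht k w
    obtain ⟨x, hx0, hx, hH⟩ := H T t k₀ ht
    obtain ⟨θ, hθ0, hθ, hxθ⟩ := P.exists_timeChange hx
    -- The image of the reparametrized curve is a global integral curve of the lift, so uniqueness
    -- identifies it with the flow line; in particular this flow line never meets the north pole.
    have hcurve : ∀ s, ρ s (stereo (e.point T t k₀)) = stereo (x (θ s)) := by
      intro s
      refine Subtype.ext (hρ.eq_of_hasDerivAt (γ := fun s => stereoVec (x (θ s))) (fun s => ?_) ?_ s)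
      · have h1 : HasFDerivAt stereoVec (fderiv ℝ stereoVec (x (θ s))) (x (θ s)) :=
          (contDiff_stereoVec (m := 1).differentiable one_ne_zero _).hasFDerivAt
        rw [P.lift_isStereoLift]
        exact HasFDerivAt.comp_hasDerivAt (f := fun s => x (θ s)) s h1 (hxθ s)
      · rw [hθ0, hx0]
        rfl
    have hFn : ∀ (j : ℕ) (y : Sph n), F^[j] y = ρ (j * δ) y := by
      intro j
      induction j with
      | zero => intro y; simp [(hρ y).1]
      | succ j ih =>
        intro y
        rw [Function.iterate_succ_apply', ih, hF, ← hρ.add]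
        congr 1
        push_cast
        ring
    have hFz : ∀ (j : ℤ) (y : Sph n), (F ^ j) y = ρ (j * δ) y := by
      intro j y
      obtain ⟨m, rfl | rfl⟩ := j.eq_nat_or_neg
      · rw [zpow_natCast, Int.cast_natCast, ← hFn, Equiv.Perm.iterate_eq_pow]
      · rw [zpow_neg, zpow_natCast, Equiv.Perm.inv_eq_iff_eq, ← Equiv.Perm.iterate_eq_pow, hFn,
          ← hρ.add]
        simp [(hρ y).1]
    have hmem : ∀ s, ρ s (stereo (e.point T t k₀)) ∈ stereo '' e.region T w ↔
        x (θ s) ∈ e.region T w := by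
      intro s
      rw [hcurve, stereo_injective.mem_set_image]
    have hfin : T.HaltsWith t k w →
        ∃ j : ℕ, ρ (j * δ) (stereo (e.point T t k₀)) ∈ stereo '' e.region T w := by
      intro h
      -- Sampling at the times `j δ` misses nothing, because the curve stays in the region from some
      -- time on.
      have h1 : Filter.Tendsto (fun j : ℕ => θ (j * δ)) Filter.atTop Filter.atTop :=
        hθ.comp (tendsto_natCast_atTop_atTop.atTop_mul_const hδ)
      obtain ⟨j, hj⟩ := (h1.eventually ((hH k w).1 h)).exists
      exact ⟨j, (hmem _).2 hj⟩
    refine ⟨isOpen_image_stereo (isOpen_slabs _), ⟨?_, ?_⟩, ⟨?_, ?_⟩⟩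
    · rintro ⟨j, hj⟩
      rw [hFn, hmem] at hj
      exact (hH k w).2 _ hj
    · intro h
      obtain ⟨j, hj⟩ := hfin h
      exact ⟨j, by rwa [hFn]⟩
    · rintro ⟨j, hj⟩
      rw [hFz, hmem] at hj
      exact (hH k w).2 _ hj
    · intro h
      obtain ⟨j, hj⟩ := hfin h
      exact ⟨j, by rw [hFz]; exact_mod_cast hj⟩

end

noncomputable section

/-! ### Relaxation equations `y' = g (u - y)` -/

section Relaxation

variable {g u y : ℝ → ℝ} {a b : ℝ}

/-- With the integrating factor `exp G`, `G' = g`, the derivative of `(y - B) exp G` is `g (u - B)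
exp G ≤ 0`. Applied to `y` and to `-y`, this gives the two-sided estimates. -/
theorem relax_sub_le (hg : Continuous g) (hg0 : ∀ t, 0 ≤ g t)
    (hy : ∀ t ∈ Set.Icc a b, HasDerivAt y (g t * (u t - y t)) t) {B : ℝ}
    (hu : ∀ t ∈ Set.Icc a b, u t ≤ B) {t : ℝ} (ht : t ∈ Set.Icc a b) :
    y t - B ≤ (y a - B) * Real.exp (-∫ s in a..t, g s) := by
  set G : ℝ → ℝ := fun t => ∫ s in a..t, g s with hG
  have hGd : ∀ t, HasDerivAt G (g t) t := fun t => (hg.integral_hasStrictDerivAt a t).hasDerivAt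
  have hd : ∀ t ∈ Set.Icc a b, HasDerivAt (fun t => (y t - B) * Real.exp (G t))
      (g t * (u t - B) * Real.exp (G t)) t := by
    intro t ht
    refine (((hy t ht).sub_const B).mul (hGd t).exp).congr_deriv ?_
    ring
  have hanti : AntitoneOn (fun t => (y t - B) * Real.exp (G t)) (Set.Icc a b) := by
    refine antitoneOn_of_deriv_nonpos (convex_Icc a b)
      (fun t ht => (hd t ht).continuousAt.continuousWithinAt) ?_ ?_
    · exact fun t ht => (hd t (interior_subset ht)).differentiableAt.differentiableWithinAt
    · intro t ht
      rw [(hd t (interior_subset ht)).deriv]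
      exact mul_nonpos_of_nonpos_of_nonneg (mul_nonpos_of_nonneg_of_nonpos (hg0 t)
        (sub_nonpos.2 (hu t (interior_subset ht)))) (Real.exp_pos _).le
  have h1 := hanti (Set.left_mem_Icc.2 (ht.1.trans ht.2)) ht ht.1
  have h2 : G a = 0 := by simp [hG]
  simp only [h2, Real.exp_zero, mul_one] at h1
  rw [Real.exp_neg, ← div_eq_mul_inv, le_div_iff₀ (Real.exp_pos _)]
  exact h1

theorem integral_gain_nonneg (hg0 : ∀ t, 0 ≤ g t) {t : ℝ} (ht : t ∈ Set.Icc a b) :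
    0 ≤ ∫ s in a..t, g s :=
  intervalIntegral.integral_nonneg ht.1 fun s _ => hg0 s

/-- The solution is attracted by the values of `u`. -/
theorem relax_abs_sub_le (hg : Continuous g) (hg0 : ∀ t, 0 ≤ g t)
    (hy : ∀ t ∈ Set.Icc a b, HasDerivAt y (g t * (u t - y t)) t) {n η : ℝ}
    (hu : ∀ t ∈ Set.Icc a b, |u t - n| ≤ η) {t : ℝ} (ht : t ∈ Set.Icc a b) :
    |y t - n| ≤ η + |y a - n| * Real.exp (-∫ s in a..t, g s) := by
  have hη : 0 ≤ η := (abs_nonneg _).trans (hu t ht)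
  have h1 := relax_sub_le hg hg0 hy (B := n + η)
    (fun s hs => by linarith [(abs_le.1 (hu s hs)).2]) ht
  have h2 := relax_sub_le (y := fun t => -y t) (u := fun t => -u t) hg hg0
    (fun s hs => ((hy s hs).neg).congr_deriv (by ring)) (B := -n + η)
    (fun s hs => by linarith [(abs_le.1 (hu s hs)).1]) ht
  set q := Real.exp (-∫ s in a..t, g s)
  have hq : 0 ≤ q := (Real.exp_pos _).le
  have h3 : (y a - (n + η)) * q ≤ |y a - n| * q :=
    mul_le_mul_of_nonneg_right (by linarith [le_abs_self (y a - n)]) hq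
  have h4 : (-y a - (-n + η)) * q ≤ |y a - n| * q :=
    mul_le_mul_of_nonneg_right (by linarith [neg_abs_le (y a - n)]) hq
  rw [abs_le]
  constructor <;> linarith

theorem relax_abs_sub_le' (hg : Continuous g) (hg0 : ∀ t, 0 ≤ g t)
    (hy : ∀ t ∈ Set.Icc a b, HasDerivAt y (g t * (u t - y t)) t) {n η : ℝ}
    (hu : ∀ t ∈ Set.Icc a b, |u t - n| ≤ η) {t : ℝ} (ht : t ∈ Set.Icc a b) :
    |y t - n| ≤ η + |y a - n| := by
  refine (relax_abs_sub_le hg hg0 hy hu ht).trans ?_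
  have : Real.exp (-∫ s in a..t, g s) ≤ 1 :=
    Real.exp_le_one_iff.2 (neg_nonpos.2 (integral_gain_nonneg hg0 ht))
  linarith [mul_le_of_le_one_right (abs_nonneg (y a - n)) this]

/-- The solution moves little if the total gain is small. -/
theorem relax_abs_sub_self_le (hg : Continuous g) (hg0 : ∀ t, 0 ≤ g t)
    (hy : ∀ t ∈ Set.Icc a b, HasDerivAt y (g t * (u t - y t)) t) {D q : ℝ}
    (hu : ∀ t ∈ Set.Icc a b, |u t - y a| ≤ D) {t : ℝ} (ht : t ∈ Set.Icc a b)
    (hq : ∫ s in a..t, g s ≤ q) : |y t - y a| ≤ D * q := by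
  have hD : 0 ≤ D := (abs_nonneg _).trans (hu t ht)
  have h1 := relax_sub_le hg hg0 hy (B := y a + D)
    (fun s hs => by linarith [(abs_le.1 (hu s hs)).2]) ht
  have h2 := relax_sub_le (y := fun t => -y t) (u := fun t => -u t) hg hg0
    (fun s hs => ((hy s hs).neg).congr_deriv (by ring)) (B := -y a + D)
    (fun s hs => by linarith [(abs_le.1 (hu s hs)).1]) ht
  have h3 := Real.add_one_le_exp (-∫ s in a..t, g s)
  have h4 : D * (1 - Real.exp (-∫ s in a..t, g s)) ≤ D * q :=
    mul_le_mul_of_nonneg_left (by linarith) hD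
  rw [abs_le]
  constructor <;> linarith

end Relaxation

/-! ### The two gains -/

section Gain

variable {A : ℝ → ℝ} {a Λ : ℝ}

/-- Jordan's inequality bounds the sine on each half of the interval from below by a linear function
that vanishes at the near end. So the integrand is at most a sum of two exponentials of rate `c =
2Λ/π`, each of integral at most `1/c = π/(2Λ)`. -/
theorem integral_slow_gain_le (hA : Continuous A) (hΛ : 0 < Λ)
    (hAΛ : ∀ t ∈ Set.Icc a (a + Real.pi), Λ ≤ A t) {t : ℝ} (ht : t ∈ Set.Icc a (a + Real.pi)) :
    ∫ s in a..t, Real.exp (-(A s * Real.sin (s - a))) ≤ Real.pi / Λ := by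
  have hπ := Real.pi_pos
  set c := 2 * Λ / Real.pi with hc
  have hc0 : 0 < c := by positivity
  set Q : ℝ → ℝ := fun s => -(c⁻¹ * Real.exp (-(c * (s - a)))) +
    c⁻¹ * Real.exp (-(c * (a + Real.pi - s))) with hQ
  have hQd : ∀ s, HasDerivAt Q (Real.exp (-(c * (s - a))) + Real.exp (-(c * (a + Real.pi - s)))) s := by
    intro s
    have h1 : HasDerivAt (fun s => -(c * (s - a))) (-c) s := by
      simpa using (((hasDerivAt_id s).sub_const a).const_mul c).fun_neg
    have h2 : HasDerivAt (fun s => -(c * (a + Real.pi - s))) c s := by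
      simpa using (((hasDerivAt_id s).const_sub (a + Real.pi)).const_mul c).fun_neg
    refine (((h1.exp.const_mul c⁻¹).neg).add (h2.exp.const_mul c⁻¹)).congr_deriv ?_
    field_simp
  have hQc : Continuous fun s => Real.exp (-(c * (s - a))) + Real.exp (-(c * (a + Real.pi - s))) := by
    fun_prop
  have hgc : Continuous fun s => Real.exp (-(A s * Real.sin (s - a))) := by fun_prop
  have h1 : ∫ s in a..t, Real.exp (-(A s * Real.sin (s - a))) ≤
      ∫ s in a..t, (Real.exp (-(c * (s - a))) + Real.exp (-(c * (a + Real.pi - s)))) := by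
    refine intervalIntegral.integral_mono_on ht.1 (hgc.intervalIntegrable _ _)
      (hQc.intervalIntegrable _ _) fun s hs => ?_
    have hs' : s ∈ Set.Icc a (a + Real.pi) := ⟨hs.1, hs.2.trans ht.2⟩
    have hsin : 0 ≤ Real.sin (s - a) :=
      Real.sin_nonneg_of_nonneg_of_le_pi (by linarith [hs'.1]) (by linarith [hs'.2])
    have h2 : Λ * Real.sin (s - a) ≤ A s * Real.sin (s - a) :=
      mul_le_mul_of_nonneg_right (hAΛ s hs') hsin
    rcases le_total (s - a) (Real.pi / 2) with h | h
    · have h3 := Real.mul_le_sin (by linarith [hs'.1]) h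
      have h4 : c * (s - a) ≤ Λ * Real.sin (s - a) := by
        calc c * (s - a) = Λ * (2 / Real.pi * (s - a)) := by rw [hc]; ring
          _ ≤ _ := mul_le_mul_of_nonneg_left h3 hΛ.le
      have := Real.exp_le_exp.2 (neg_le_neg (h4.trans h2))
      linarith [Real.exp_pos (-(c * (a + Real.pi - s)))]
    · have h3 := Real.mul_le_sin (x := a + Real.pi - s) (by linarith [hs'.2]) (by linarith)
      rw [show a + Real.pi - s = Real.pi - (s - a) by ring, Real.sin_pi_sub] at h3
      have h4 : c * (a + Real.pi - s) ≤ Λ * Real.sin (s - a) := by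
        calc c * (a + Real.pi - s) = Λ * (2 / Real.pi * (Real.pi - (s - a))) := by rw [hc]; ring
          _ ≤ _ := mul_le_mul_of_nonneg_left h3 hΛ.le
      have := Real.exp_le_exp.2 (neg_le_neg (h4.trans h2))
      linarith [Real.exp_pos (-(c * (s - a)))]
  have h2 : ∫ s in a..t, (Real.exp (-(c * (s - a))) + Real.exp (-(c * (a + Real.pi - s)))) =
      Q t - Q a := intervalIntegral.integral_eq_sub_of_hasDerivAt (fun s _ => hQd s)
        (hQc.intervalIntegrable _ _)
  have h3 : Q t ≤ c⁻¹ := by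
    have e1 : 0 ≤ c⁻¹ * Real.exp (-(c * (t - a))) := by positivity
    have e2 : Real.exp (-(c * (a + Real.pi - t))) ≤ 1 :=
      Real.exp_le_one_iff.2 (neg_nonpos.2 (mul_nonneg hc0.le (by linarith [ht.2])))
    have e3 := mul_le_of_le_one_right (inv_nonneg.2 hc0.le) e2
    simp only [hQ]
    linarith
  have h4 : -c⁻¹ ≤ Q a := by
    have e1 : 0 ≤ c⁻¹ * Real.exp (-(c * (a + Real.pi - a))) := by positivity
    simp only [hQ, sub_self, mul_zero, neg_zero, Real.exp_zero]
    linarith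
  have h5 : c⁻¹ + c⁻¹ = Real.pi / Λ := by rw [hc]; field_simp; ring
  linarith

/-- The crude bound `exp u ≥ u` suffices, as an error factor of `1/(2Λ)` is all that is needed
later. -/
theorem le_integral_fast_gain (hA : Continuous A)
    (hAΛ : ∀ t ∈ Set.Icc a (a + Real.pi), Λ ≤ A t) :
    2 * Λ ≤ ∫ s in a..a + Real.pi, Real.exp (A s * Real.sin (s - a)) := by
  have hπ := Real.pi_pos
  have h1 : ∫ s in a..a + Real.pi, Λ * Real.sin (s - a) = 2 * Λ := by
    rw [intervalIntegral.integral_const_mul, intervalIntegral.integral_comp_sub_right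
      (fun s => Real.sin s), integral_sin]
    simp
    ring
  rw [← h1]
  have hc1 : Continuous fun s => Λ * Real.sin (s - a) := by fun_prop
  have hc2 : Continuous fun s => Real.exp (A s * Real.sin (s - a)) := by fun_prop
  refine intervalIntegral.integral_mono_on (by linarith) (hc1.intervalIntegrable _ _)
    (hc2.intervalIntegrable _ _) fun s hs => ?_
  have hsin : 0 ≤ Real.sin (s - a) :=
    Real.sin_nonneg_of_nonneg_of_le_pi (by linarith [hs.1]) (by linarith [hs.2])
  have h2 : Λ * Real.sin (s - a) ≤ A s * Real.sin (s - a) :=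
    mul_le_mul_of_nonneg_right (hAΛ s hs) hsin
  linarith [Real.add_one_le_exp (A s * Real.sin (s - a))]

end Gain

end

noncomputable section

/-! ### Iteration of an integer map by a pair of relaxation equations -/

section Phases

variable {gs gf x y h f H : ℝ → ℝ} {a b C σ ε Λ n : ℝ}

theorem exp_neg_le_of_two_mul_le {G : ℝ} (hΛ : 0 < Λ) (hG : 2 * Λ ≤ G) :
    Real.exp (-G) ≤ 1 / (2 * Λ) := by
  rw [Real.exp_neg, inv_eq_one_div]
  exact one_div_le_one_div_of_le (by positivity) (by linarith [Real.add_one_le_exp G])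

theorem pi_div_mul_le (hC : 0 ≤ C) (hΛ : 0 < Λ) {D : ℝ} (h : 4 * C ≤ D * Λ) :
    C * (Real.pi / Λ) ≤ D := by
  rw [← mul_div_assoc, div_le_iff₀ hΛ]
  nlinarith [Real.pi_le_four]

/-- The phase in which `x` rests near `n` and `y` moves to `x`. -/
theorem copy_phase (hab : a ≤ b) (hgs : Continuous gs) (hgs0 : ∀ t, 0 ≤ gs t) (hgf : Continuous gf)
    (hgf0 : ∀ t, 0 ≤ gf t) (hslow : ∀ t ∈ Set.Icc a b, ∫ s in a..t, gs s ≤ Real.pi / Λ)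
    (hfast : 2 * Λ ≤ ∫ s in a..b, gf s)
    (hx : ∀ t ∈ Set.Icc a b, HasDerivAt x (gs t * (f (y t) - x t)) t)
    (hy : ∀ t ∈ Set.Icc a b, HasDerivAt y (gf t * (x t - y t)) t)
    (hh : ∀ t ∈ Set.Icc a b, HasDerivAt h (gs t * (H (y t) - h t)) t)
    (hC : 1 ≤ C) (hσ : 1 ≤ σ) (hε : 0 < ε) (hε1 : ε ≤ 1) (hΛ : 60 * C * σ ≤ Λ * ε)
    (hf : ∀ z, |f z| ≤ C * (1 + |z|)) (hH : ∀ z, |H z| ≤ C)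
    (hn : |n| ≤ σ) (hxa : |x a - n| ≤ ε) (hya : |y a| ≤ σ + 1) (hha : |h a| ≤ 2) :
    (∀ t ∈ Set.Icc a b, |x t - n| ≤ 2 * ε ∧ |y t - n| ≤ 2 * ε + |y a - n| ∧ |h t - h a| ≤ ε) ∧
      |y b - n| ≤ 3 * ε := by
  have hΛ1 : 60 * C * σ ≤ Λ := by nlinarith [mul_pos (by linarith : 0 < C) (by linarith : 0 < σ)]
  have hCσ : C ≤ C * σ := le_mul_of_one_le_right (by linarith) hσ
  have hΛ0 : 0 < Λ := by nlinarith
  have hxc : ContinuousOn x (Set.Icc a b) := fun t ht => (hx t ht).continuousAt.continuousWithinAt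
  -- As `f` may grow linearly, an a priori bound is needed. The drift of `x` is estimated by the
  -- maximum `S` of `|x|` itself, which enters with a factor at most `1/2`; absorbing it gives `S ≤
  -- 9σ`.
  obtain ⟨τ, hτ, hmax⟩ := isCompact_Icc.exists_isMaxOn (Set.nonempty_Icc.2 hab) hxc.abs
  set S := |x τ| with hS
  have hxS : ∀ t ∈ Set.Icc a b, |x t| ≤ S := fun t ht => hmax ht
  have hxa' : |x a| ≤ σ + 1 := by
    have := abs_sub_abs_le_abs_sub (x a) n
    linarith
  have hyS : ∀ t ∈ Set.Icc a b, |y t| ≤ S + (σ + 1) := by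
    intro t ht
    have := relax_abs_sub_le' hgf hgf0 hy (n := 0) (η := S) (fun s hs => by simpa using hxS s hs) ht
    simp only [sub_zero] at this
    linarith
  have hdrift : ∀ t ∈ Set.Icc a b, |x t - x a| ≤ C * (S + 5 * σ) * (Real.pi / Λ) := by
    intro t ht
    refine relax_abs_sub_self_le hgs hgs0 hx (fun s hs => ?_) ht (hslow t ht)
    have h1 := hf (y s)
    have h2 := abs_sub (f (y s)) (x a)
    have h3 := hyS s hs
    have h4 : C * (1 + |y s|) ≤ C * (S + σ + 2) := mul_le_mul_of_nonneg_left (by linarith) (by linarith)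
    have h5 : σ + 1 ≤ C * (2 * σ) := by nlinarith
    have h6 : C * 2 ≤ C * (2 * σ) := by nlinarith
    nlinarith
  have hS9 : S ≤ 9 * σ := by
    have h1 := hdrift τ hτ
    have hS0 : 0 ≤ S := abs_nonneg _
    have h2 : C * (S + 5 * σ) * (Real.pi / Λ) ≤ (S + 5 * σ) / 2 := by
      refine pi_div_mul_le (by positivity) hΛ0 ?_
      nlinarith [mul_nonneg (by linarith : 0 ≤ C) hS0]
    have h3 := abs_sub_abs_le_abs_sub (x τ) (x a)
    linarith
  have hdrift' : ∀ t ∈ Set.Icc a b, |x t - x a| ≤ ε := by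
    intro t ht
    refine (hdrift t ht).trans (pi_div_mul_le (by positivity) hΛ0 ?_)
    nlinarith
  have hxn : ∀ t ∈ Set.Icc a b, |x t - n| ≤ 2 * ε := by
    intro t ht
    have := abs_sub_le (x t) (x a) n
    linarith [hdrift' t ht]
  refine ⟨fun t ht => ⟨hxn t ht, relax_abs_sub_le' hgf hgf0 hy hxn ht, ?_⟩, ?_⟩
  · refine (relax_abs_sub_self_le hgs hgs0 hh (D := C + 2) (fun s hs => ?_) ht
      (hslow t ht)).trans (pi_div_mul_le (by positivity) hΛ0 ?_)
    · linarith [abs_sub (H (y s)) (h a), hH (y s)]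
    · nlinarith
  · have h1 := relax_abs_sub_le hgf hgf0 hy hxn (Set.right_mem_Icc.2 hab)
    have h2 := exp_neg_le_of_two_mul_le hΛ0 hfast
    have h3 : |y a - n| ≤ 3 * σ := by linarith [abs_sub (y a) n]
    have h4 : |y a - n| * Real.exp (-∫ s in a..b, gf s) ≤ 3 * σ * (1 / (2 * Λ)) :=
      mul_le_mul h3 h2 (Real.exp_pos _).le (by linarith)
    have h5 : 3 * σ * (1 / (2 * Λ)) ≤ ε := by
      rw [mul_one_div, div_le_iff₀ (by positivity)]
      nlinarith
    linarith

/-- The phase in which `y` rests near `n` and `x` moves to `f n`. -/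
theorem apply_phase {ε' : ℝ} (hab : a ≤ b) (hgs : Continuous gs) (hgs0 : ∀ t, 0 ≤ gs t)
    (hgf : Continuous gf) (hgf0 : ∀ t, 0 ≤ gf t)
    (hslow : ∀ t ∈ Set.Icc a b, ∫ s in a..t, gs s ≤ Real.pi / Λ)
    (hfast : 2 * Λ ≤ ∫ s in a..b, gf s)
    (hx : ∀ t ∈ Set.Icc a b, HasDerivAt x (gf t * (f (y t) - x t)) t)
    (hy : ∀ t ∈ Set.Icc a b, HasDerivAt y (gs t * (x t - y t)) t)
    (hh : ∀ t ∈ Set.Icc a b, HasDerivAt h (gf t * (H (y t) - h t)) t)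
    (hC : 1 ≤ C) (hσ : 1 ≤ σ) (hε : 0 < ε) (hε1 : ε ≤ 1 / 16) (hΛ : 60 * C * σ ≤ Λ * ε)
    (hf : ∀ z, |f z| ≤ C * (1 + |z|)) (hfn : |f n| ≤ σ) (hn : |n| ≤ σ)
    (hflat : ∀ e, |e| ≤ 1 → |f (n + e) - f n| ≤ C * (1 + |n|) * e ^ 2)
    (hHflat : ∀ e, |e| ≤ 1 → |H (n + e) - H n| ≤ C * e ^ 2)
    (hεε' : 64 * C * σ * ε ^ 2 ≤ ε') (hΛ' : 3 * σ ≤ Λ * ε')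
    (hε2 : 16 * C * ε ^ 2 ≤ 1 / 16)
    (hxa : |x a - n| ≤ 2 * ε) (hya : |y a - n| ≤ 3 * ε) (hha : |h a - H n| ≤ 4) :
    (∀ t ∈ Set.Icc a b, |y t - n| ≤ 4 * ε ∧ |h t - H n| ≤ 1 / 16 + |h a - H n|) ∧
      |x b - f n| ≤ ε' ∧ |h b - H n| ≤ 1 / 8 := by
  have hΛ1 : 60 * C * σ ≤ Λ := by nlinarith [mul_pos (by linarith : 0 < C) (by linarith : 0 < σ)]
  have hCσ : C ≤ C * σ := le_mul_of_one_le_right (by linarith) hσ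
  have hΛ0 : 0 < Λ := by nlinarith
  have hyc : ContinuousOn y (Set.Icc a b) := fun t ht => (hy t ht).continuousAt.continuousWithinAt
  -- The same absorption argument, now for the slow variable `y`.
  obtain ⟨τ, hτ, hmax⟩ := isCompact_Icc.exists_isMaxOn (Set.nonempty_Icc.2 hab) hyc.abs
  set S := |y τ| with hS
  have hyS : ∀ t ∈ Set.Icc a b, |y t| ≤ S := fun t ht => hmax ht
  have hxa' : |x a| ≤ σ + 1 := by
    have := abs_sub_abs_le_abs_sub (x a) n
    linarith
  have hya' : |y a| ≤ σ + 1 := by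
    have := abs_sub_abs_le_abs_sub (y a) n
    linarith
  have hxS : ∀ t ∈ Set.Icc a b, |x t| ≤ C * (1 + S) + (σ + 1) := by
    intro t ht
    have := relax_abs_sub_le' hgf hgf0 hx (n := 0) (η := C * (1 + S)) (fun s hs => by
      rw [sub_zero]
      exact (hf _).trans (mul_le_mul_of_nonneg_left (by linarith [hyS s hs]) (by linarith))) ht
    simp only [sub_zero] at this
    linarith
  have hdrift : ∀ t ∈ Set.Icc a b, |y t - y a| ≤ C * (S + 5 * σ) * (Real.pi / Λ) := by
    intro t ht
    refine relax_abs_sub_self_le hgs hgs0 hy (fun s hs => ?_) ht (hslow t ht)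
    have h2 := abs_sub (x s) (y a)
    have h3 := hxS s hs
    have h5 : σ + 1 ≤ C * (2 * σ) := by nlinarith
    nlinarith
  have hS9 : S ≤ 9 * σ := by
    have h1 := hdrift τ hτ
    have hS0 : 0 ≤ S := abs_nonneg _
    have h2 : C * (S + 5 * σ) * (Real.pi / Λ) ≤ (S + 5 * σ) / 2 := by
      refine pi_div_mul_le (by positivity) hΛ0 ?_
      nlinarith [mul_nonneg (by linarith : 0 ≤ C) hS0]
    have h3 := abs_sub_abs_le_abs_sub (y τ) (y a)
    linarith
  have hyn : ∀ t ∈ Set.Icc a b, |y t - n| ≤ 4 * ε := by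
    intro t ht
    have h1 := abs_sub_le (y t) (y a) n
    have h2 : |y t - y a| ≤ ε := by
      refine (hdrift t ht).trans (pi_div_mul_le (by positivity) hΛ0 ?_)
      nlinarith
    linarith
  have hsq : ∀ t ∈ Set.Icc a b, (y t - n) ^ 2 ≤ 16 * ε ^ 2 := by
    intro t ht
    rw [← sq_abs]
    nlinarith [hyn t ht, abs_nonneg (y t - n)]
  -- Flatness turns the error `4ε` of `y` into `C · 2σ · 16ε² = 32 C σ ε²`, half of the precision
  -- allowed in the next cycle.
  have hfy : ∀ t ∈ Set.Icc a b, |f (y t) - f n| ≤ ε' / 2 := by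
    intro t ht
    have h1 := hflat (y t - n) (by linarith [hyn t ht])
    rw [add_sub_cancel] at h1
    have h2 : C * (1 + |n|) * (y t - n) ^ 2 ≤ C * (2 * σ) * (16 * ε ^ 2) :=
      mul_le_mul (mul_le_mul_of_nonneg_left (by linarith) (by linarith)) (hsq t ht) (sq_nonneg _)
        (by positivity)
    linarith
  have hHy : ∀ t ∈ Set.Icc a b, |H (y t) - H n| ≤ 1 / 16 := by
    intro t ht
    have h1 := hHflat (y t - n) (by linarith [hyn t ht])
    rw [add_sub_cancel] at h1
    have := mul_le_mul_of_nonneg_left (hsq t ht) (by linarith : 0 ≤ C)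
    linarith
  have hexp := exp_neg_le_of_two_mul_le hΛ0 hfast
  refine ⟨fun t ht => ⟨hyn t ht, relax_abs_sub_le' hgf hgf0 hh hHy ht⟩, ?_, ?_⟩
  · have h1 := relax_abs_sub_le hgf hgf0 hx hfy (Set.right_mem_Icc.2 hab)
    have h3 : |x a - f n| ≤ 3 * σ := by
      linarith [abs_sub_le (x a) n (f n), abs_sub n (f n)]
    have h4 : |x a - f n| * Real.exp (-∫ s in a..b, gf s) ≤ 3 * σ * (1 / (2 * Λ)) :=
      mul_le_mul h3 hexp (Real.exp_pos _).le (by linarith)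
    have h5 : 3 * σ * (1 / (2 * Λ)) ≤ ε' / 2 := by
      rw [mul_one_div, div_le_iff₀ (by positivity)]
      nlinarith
    linarith
  · have h1 := relax_abs_sub_le hgf hgf0 hh hHy (Set.right_mem_Icc.2 hab)
    have h4 : |h a - H n| * Real.exp (-∫ s in a..b, gf s) ≤ 4 * (1 / (2 * Λ)) :=
      mul_le_mul hha hexp (Real.exp_pos _).le (by linarith)
    have h5 : 4 * (1 / (2 * Λ)) ≤ 1 / 16 := by
      rw [mul_one_div, div_le_iff₀ (by positivity)]
      nlinarith
    linarith

end Phases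

end

/-! ### Error control along the simulated orbit -/

noncomputable section

/-- An integer orbit `n` of `f`, with a halting indicator `H`; both functions are of bounded growth
and flat at the natural numbers. -/
structure FlatOrbit (C : ℕ) (f H : ℝ → ℝ) (n : ℕ → ℕ) : Prop where
  one_le : 1 ≤ C
  bound : ∀ z, |f z| ≤ C * (1 + |z|)
  bound_halt : ∀ z, |H z| ≤ C
  flat : ∀ (m : ℕ) (e : ℝ), |e| ≤ 1 → |f (m + e) - f m| ≤ C * (1 + |(m : ℝ)|) * e ^ 2
  flat_halt : ∀ (m : ℕ) (e : ℝ), |e| ≤ 1 → |H (m + e) - H m| ≤ C * e ^ 2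
  succ : ∀ k, (n (k + 1) : ℝ) = f (n k)
  growth : ∀ k, n (k + 1) ≤ C * n k
  halt : ∀ k, H (n k) = 0 ∨ H (n k) = 1
  stay : ∀ k, H (n k) = 1 → n (k + 1) = n k

/-- The functions `x`, `y`, `h` solve the system of relaxation equations for `f` and `H`, with the
exponent `A` of the gains. -/
structure IsRelay (f H A x y h : ℝ → ℝ) : Prop where
  hasDerivAt_x : ∀ t, HasDerivAt x (Real.exp (-(A t * Real.sin t)) * (f (y t) - x t)) t
  hasDerivAt_y : ∀ t, HasDerivAt y (Real.exp (A t * Real.sin t) * (x t - y t)) t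
  hasDerivAt_h : ∀ t, HasDerivAt h (Real.exp (-(A t * Real.sin t)) * (H (y t) - h t)) t

namespace FlatOrbit

variable {C : ℕ} {f H : ℝ → ℝ} {n : ℕ → ℕ}

/-- A bound of the first `k + 1` terms of the orbit. -/
def size (C : ℕ) (n : ℕ → ℕ) (k : ℕ) : ℝ := C ^ (k + 1) * (n 0 + 1)

/-- The precision with which the `k`-th term is represented. -/
def prec (C : ℕ) (n : ℕ → ℕ) (k : ℕ) : ℝ := 1 / (64 * C ^ 2 * size C n k)

/-- The state at the beginning of the `k`-th cycle. -/
structure CycleStart (C : ℕ) (H : ℝ → ℝ) (n : ℕ → ℕ) (x y h : ℝ → ℝ) (k : ℕ) (a : ℝ) : Prop where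
  x_near : |x a - n k| ≤ prec C n k
  y_le : |y a| ≤ size C n k + 1
  h_near : |h a| ≤ 1 / 8 ∨ (H (n k) = 1 ∧ |h a - 1| ≤ 1 / 8 ∧ |y a - n k| ≤ 1 / 16)

theorem le_size (hO : FlatOrbit C f H n) (k : ℕ) : (n k : ℝ) + 1 ≤ size C n k ∧
    (n (k + 1) : ℝ) ≤ size C n k := by
  have hC : (1 : ℝ) ≤ C := by exact_mod_cast hO.one_le
  have h1 : ∀ k, (n k : ℝ) ≤ C ^ k * n 0 := by
    intro k
    induction k with
    | zero => simp
    | succ k ih =>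
      have : (n (k + 1) : ℝ) ≤ C * n k := by exact_mod_cast hO.growth k
      calc (n (k + 1) : ℝ) ≤ C * (C ^ k * n 0) := this.trans (by gcongr)
        _ = _ := by ring
  have h2 : (1 : ℝ) ≤ C ^ (k + 1) := one_le_pow₀ hC
  have h3 : (C : ℝ) ^ k ≤ C ^ (k + 1) := pow_le_pow_right₀ hC (Nat.le_succ k)
  have h4 : (C : ℝ) ^ k * n 0 ≤ C ^ (k + 1) * n 0 := by gcongr
  constructor
  · rw [size, mul_add, mul_one]
    linarith [h1 k]
  · rw [size, mul_add, mul_one]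
    linarith [h1 (k + 1)]

theorem one_le_size (hO : FlatOrbit C f H n) (k : ℕ) : 1 ≤ size C n k := by
  have := (hO.le_size k).1
  have h0 : (0 : ℝ) ≤ n k := Nat.cast_nonneg _
  linarith

/-- The exponent of the gains. -/
def exponent (C : ℕ) (n : ℕ → ℕ) (t : ℝ) : ℝ :=
  ((3840 * C ^ 5 * (n 0 + 1) ^ 2 : ℕ) : ℝ) * Real.exp ((C ^ 2 : ℕ) * t)

/-- The phases need an exponent of order `size²`, which grows like `(C²) ^ k`; and `exp (C² t) ≥
(C²) ^ k` for `t ≥ k`. The `k`-th cycle starts at `2πk ≥ k`. -/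
theorem le_exponent (hO : FlatOrbit C f H n) {k : ℕ} {t : ℝ} (ht : (k : ℝ) ≤ t) :
    3840 * C ^ 3 * size C n k ^ 2 ≤ exponent C n t := by
  have hC : (1 : ℝ) ≤ C := by exact_mod_cast hO.one_le
  have h1 : ((C : ℝ) ^ 2) ^ k ≤ Real.exp ((C ^ 2 : ℕ) * t) := by
    calc ((C : ℝ) ^ 2) ^ k ≤ Real.exp (C ^ 2) ^ k := by
          gcongr
          linarith [Real.add_one_le_exp ((C : ℝ) ^ 2)]
      _ = Real.exp (k * C ^ 2) := (Real.exp_nat_mul _ _).symm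
      _ ≤ _ := by
          apply Real.exp_le_exp.2
          push_cast
          rw [mul_comm]
          gcongr
  rw [exponent, size]
  calc 3840 * (C : ℝ) ^ 3 * (C ^ (k + 1) * (n 0 + 1)) ^ 2
      = 3840 * C ^ 5 * (n 0 + 1) ^ 2 * ((C : ℝ) ^ 2) ^ k := by ring
    _ ≤ 3840 * C ^ 5 * (n 0 + 1) ^ 2 * Real.exp ((C ^ 2 : ℕ) * t) := by gcongr
    _ = _ := by push_cast; ring

/-- One period, the induction step of the simulation: `copy_phase` takes the error `ε` of `x` to
`3ε` in `y`, and `apply_phase` returns it to `64 C σ ε² = ε / C`, which by the choice of `prec` is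
the next precision. The indicator `h` can rise only in the second phase, when `y` is already near `n
k`. Once it is near `1` the orbit is stationary, so `y` is near the halting term in both phases. -/
theorem cycle (hO : FlatOrbit C f H n) {x y h : ℝ → ℝ} (hR : IsRelay f H (exponent C n) x y h)
    {k : ℕ} (hk : CycleStart C H n x y h k (k * (2 * Real.pi))) :
    CycleStart C H n x y h (k + 1) ((k + 1 : ℕ) * (2 * Real.pi)) ∧
    (H (n k) = 1 → |h ((k + 1 : ℕ) * (2 * Real.pi)) - 1| ≤ 1 / 8) ∧
    ∀ t ∈ Set.Icc (k * (2 * Real.pi)) ((k + 1 : ℕ) * (2 * Real.pi)),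
      (1 / 2 < h t → H (n k) = 1 ∧ |y t - n k| < 1 / 4) ∧
      (|h (k * (2 * Real.pi)) - 1| ≤ 1 / 8 → 1 / 2 < h t ∧ h t < 2 ∧ |y t - n k| < 1 / 4) := by
  have hC : (1 : ℝ) ≤ C := by exact_mod_cast hO.one_le
  have hC0 : (0 : ℝ) < C := by linarith
  have hπ := Real.pi_pos
  have hπ3 := Real.pi_gt_three
  set a := (k : ℝ) * (2 * Real.pi) with ha
  set m := a + Real.pi with hm
  have hb : ((k + 1 : ℕ) : ℝ) * (2 * Real.pi) = m + Real.pi := by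
    rw [hm, ha]; push_cast; ring
  rw [hb]
  set σ := size C n k with hσd
  set ε := prec C n k with hεd
  set Λ := 3840 * (C : ℝ) ^ 3 * σ ^ 2 with hΛd
  have hσ : 1 ≤ σ := hO.one_le_size k
  have hσ0 : 0 < σ := by linarith
  have hΛ0 : 0 < Λ := by positivity
  have hεeq : ε * (64 * C ^ 2 * σ) = 1 := by
    rw [hεd, prec]; field_simp; rw [← hσd]; field_simp
  have hε0 : 0 < ε := by rw [hεd, prec]; positivity
  have hC2 : (1 : ℝ) ≤ C ^ 2 := one_le_pow₀ hC
  have hε64 : ε * C ^ 2 ≤ 1 / 64 := by nlinarith [mul_pos hε0 (by positivity : (0 : ℝ) < C ^ 2)]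
  have hε16 : ε ≤ 1 / 64 := by nlinarith
  have hε' : prec C n (k + 1) = ε / C := by
    rw [hεd, prec, prec, size, size, pow_succ (C : ℝ) (k + 1)]
    field_simp
  have hΛ1 : 60 * C * σ ≤ Λ * ε := by
    have : Λ * ε = 60 * C * σ * (ε * (64 * C ^ 2 * σ)) := by rw [hΛd]; ring
    rw [this, hεeq, mul_one]
  have hΛ2 : 3 * σ ≤ Λ * prec C n (k + 1) := by
    rw [hε', ← mul_div_assoc, le_div_iff₀ hC0]
    nlinarith [mul_pos hC0 hσ0]
  have hεε : 64 * C * σ * ε ^ 2 ≤ prec C n (k + 1) := by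
    rw [hε', le_div_iff₀ hC0]
    have : 64 * C * σ * ε ^ 2 * C = ε * (ε * (64 * C ^ 2 * σ)) := by ring
    rw [this, hεeq, mul_one]
  have hε2 : 16 * C * ε ^ 2 ≤ 1 / 16 := by
    have : (C : ℝ) ≤ C ^ 2 := by nlinarith
    nlinarith [mul_le_mul_of_nonneg_left this hε0.le]
  have hAc : Continuous (exponent C n) := by unfold exponent; fun_prop
  have hAΛ : ∀ t, a ≤ t → Λ ≤ exponent C n t := by
    intro t ht
    refine hO.le_exponent (le_trans ?_ ht)
    rw [ha]
    nlinarith [Nat.cast_nonneg (α := ℝ) k]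
  obtain ⟨hnσ, hn'σ⟩ := hO.le_size k
  have hn0 : (0 : ℝ) ≤ n k := Nat.cast_nonneg _
  have hnabs : |(n k : ℝ)| ≤ σ := by rw [abs_of_nonneg hn0]; linarith
  have hfn : |f (n k)| ≤ σ := by
    rw [← hO.succ, abs_of_nonneg (Nat.cast_nonneg _)]; exact hn'σ
  have g1c : Continuous fun t => Real.exp (-(exponent C n t * Real.sin t)) := by fun_prop
  have g2c : Continuous fun t => Real.exp (exponent C n t * Real.sin t) := by fun_prop
  have hsin1 : ∀ t, Real.sin (t - a) = Real.sin t := fun t => by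
    rw [ha, Real.sin_sub_nat_mul_two_pi]
  have hsin2 : ∀ t, Real.sin (t - m) = -Real.sin t := fun t => by
    rw [hm, ← sub_sub, Real.sin_sub_pi, hsin1]
  have hha : |h a| ≤ 2 := by
    rcases hk.h_near with h' | ⟨-, h', -⟩
    · linarith
    · have := abs_sub_abs_le_abs_sub (h a) 1
      rw [abs_one] at this
      linarith
  obtain ⟨hcopy, hym⟩ := copy_phase (a := a) (b := m) (n := n k) (σ := σ) (ε := ε) (Λ := Λ) (C := C)
    (by linarith) g1c (fun t => (Real.exp_pos _).le) g2c (fun t => (Real.exp_pos _).le)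
    (fun t ht => by
      simpa only [hsin1] using integral_slow_gain_le hAc hΛ0 (fun t ht => hAΛ t ht.1) ht)
    (by simpa only [hsin1] using le_integral_fast_gain (a := a) hAc (fun t ht => hAΛ t ht.1))
    (fun t _ => hR.hasDerivAt_x t) (fun t _ => hR.hasDerivAt_y t) (fun t _ => hR.hasDerivAt_h t)
    hC hσ hε0 (by linarith) hΛ1 hO.bound hO.bound_halt hnabs hk.x_near hk.y_le hha
  have ham : a ≤ m := by linarith
  have hm' := hcopy m (Set.right_mem_Icc.2 ham)
  have hH4 : |h m - H (n k)| ≤ 4 := by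
    have h1 := abs_sub_abs_le_abs_sub (h m) (h a)
    have h2 := abs_sub (h m) (H (n k))
    have h3 : |H (n k)| ≤ 1 := by rcases hO.halt k with h | h <;> rw [h] <;> simp
    linarith [hm'.2.2]
  obtain ⟨happ, hxb, hhb⟩ := apply_phase (a := m) (b := m + Real.pi) (n := n k) (σ := σ) (ε := ε)
    (Λ := Λ) (C := C) (ε' := prec C n (k + 1))
    (by linarith) g2c (fun t => (Real.exp_pos _).le) g1c (fun t => (Real.exp_pos _).le)
    (fun t ht => by
      simpa only [hsin2, mul_neg, neg_neg] using
        integral_slow_gain_le hAc hΛ0 (fun t ht => hAΛ t (ham.trans ht.1)) ht)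
    (by simpa only [hsin2, mul_neg] using
        le_integral_fast_gain (a := m) hAc (fun t ht => hAΛ t (ham.trans ht.1)))
    (fun t _ => hR.hasDerivAt_x t) (fun t _ => hR.hasDerivAt_y t) (fun t _ => hR.hasDerivAt_h t)
    hC hσ hε0 (by linarith) hΛ1 hO.bound hfn hnabs (hO.flat (n k)) (hO.flat_halt (n k)) hεε
    hΛ2 hε2 hm'.1 hym hH4
  have hyb := (happ (m + Real.pi) (Set.right_mem_Icc.2 (by linarith))).1
  have hσ' : σ ≤ size C n (k + 1) := by
    rw [hσd, size, size]
    gcongr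
    exact Nat.le_succ _
  refine ⟨⟨?_, ?_, ?_⟩, fun h1 => by rwa [h1] at hhb, fun t ht => ?_⟩
  · rw [hO.succ]; exact hxb
  · have := abs_sub_abs_le_abs_sub (y (m + Real.pi)) (n k)
    linarith
  · rcases hO.halt k with h0 | h1
    · left
      simpa [h0] using hhb
    · right
      exact ⟨by rw [hO.stay k h1, h1], by rwa [h1] at hhb, by rw [hO.stay k h1]; linarith⟩
  · rcases le_total t m with htm | htm
    · obtain ⟨-, hy1, hh1⟩ := hcopy t ⟨ht.1, htm⟩
      have hh2 := abs_le.1 hh1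
      rcases hk.h_near with h0 | ⟨h1, h2, h3⟩
      · have h0' := abs_le.1 h0
        refine ⟨fun hgt => ?_, fun hgt => ?_⟩
        · linarith
        · have := abs_le.1 hgt
          linarith
      · have h2' := abs_le.1 h2
        exact ⟨fun _ => ⟨h1, by linarith⟩, fun _ => ⟨by linarith, by linarith, by linarith⟩⟩
    · obtain ⟨hy1, hh1⟩ := happ t ⟨htm, ht.2⟩
      have hh2 := abs_le.1 hh1
      have hhm := abs_le.1 hm'.2.2
      rcases hk.h_near with h0 | ⟨h1, h2, h3⟩
      · have h0' := abs_le.1 h0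
        refine ⟨fun hgt => ?_, fun hgt => ?_⟩
        · rcases hO.halt k with h4 | h4
          · rw [h4, sub_zero] at hh2
            have : |h m| ≤ 1 / 8 + ε := by rw [abs_le]; constructor <;> linarith
            linarith
          · exact ⟨h4, by linarith⟩
        · have := abs_le.1 hgt
          linarith
      · have h2' := abs_le.1 h2
        rw [h1] at hh2
        have : |h m - 1| ≤ 1 / 8 + ε := by rw [abs_le]; constructor <;> linarith
        exact ⟨fun _ => ⟨h1, by linarith⟩, fun _ => ⟨by linarith, by linarith, by linarith⟩⟩

/-- The relay represents the orbit: `h` rises above `1 / 2` only after halting, and then `y` is near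
to the halting term. -/
theorem relay (hO : FlatOrbit C f H n) {x y h : ℝ → ℝ} (hR : IsRelay f H (exponent C n) x y h)
    (hx0 : x 0 = n 0) (hy0 : y 0 = 0) (hh0 : h 0 = 0) :
    (∀ t, 0 ≤ t → 1 / 2 < h t → ∃ k, H (n k) = 1 ∧ |y t - n k| < 1 / 4) ∧
    ∀ k, H (n k) = 1 →
      ∀ᶠ t in Filter.atTop, 1 / 2 < h t ∧ h t < 2 ∧ |y t - n k| < 1 / 4 := by
  have hπ := Real.pi_pos
  have hstart : ∀ k : ℕ, CycleStart C H n x y h k (k * (2 * Real.pi)) := by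
    intro k
    induction k with
    | zero =>
      have hs := hO.one_le_size 0
      simp only [CharP.cast_eq_zero, zero_mul]
      refine ⟨?_, ?_, Or.inl ?_⟩
      · rw [hx0, sub_self, abs_zero, prec]
        positivity
      · rw [hy0, abs_zero]; linarith
      · rw [hh0]; norm_num
    | succ k ih => exact (hO.cycle hR ih).1
  have hcyc : ∀ t, 0 ≤ t → ∃ k : ℕ, t ∈ Set.Icc (k * (2 * Real.pi)) ((k + 1 : ℕ) * (2 * Real.pi)) := by
    intro t ht
    refine ⟨⌊t / (2 * Real.pi)⌋₊, ?_, ?_⟩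
    · rw [← le_div_iff₀ (by positivity)]
      exact Nat.floor_le (by positivity)
    · rw [← div_le_iff₀ (by positivity)]
      push_cast
      exact (Nat.lt_floor_add_one _).le
  refine ⟨fun t ht hgt => ?_, fun k hk => ?_⟩
  · obtain ⟨k, hk⟩ := hcyc t ht
    exact ⟨k, ((hO.cycle hR (hstart k)).2.2 t hk).1 hgt⟩
  · have hstay : ∀ j, n (k + j) = n k := by
      intro j
      induction j with
      | zero => rfl
      | succ j ih => rw [← add_assoc, hO.stay (k + j) (by rw [ih, hk]), ih]
    filter_upwards [Filter.eventually_ge_atTop ((k + 1 : ℕ) * (2 * Real.pi))] with t ht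
    obtain ⟨i, hi⟩ := hcyc t (le_trans (by positivity) ht)
    -- The indicator is known to be near `1` only at the end of cycle `k`. As the closed cycles
    -- share their ends, `i ≤ k` is possible only if `t` is the starting time of cycle `k + 1`.
    rcases lt_or_ge i (k + 1) with hik | hik
    · have h1 : ((i + 1 : ℕ) : ℝ) * (2 * Real.pi) ≤ (k + 1 : ℕ) * (2 * Real.pi) := by
        gcongr
        omega
      have hik' : i + 1 = k + 1 ∨ i + 1 < k + 1 := by omega
      have h2 : t = (k + 1 : ℕ) * (2 * Real.pi) := le_antisymm (hi.2.trans h1) ht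
      have h3 := (hO.cycle hR (hstart k)).2.1 hk
      have h4 := ((hO.cycle hR (hstart (k + 1))).2.2 t ⟨h2.ge, by
        rw [h2]; gcongr; omega⟩).2 h3
      rwa [hstay 1] at h4
    · obtain ⟨j, rfl⟩ := Nat.exists_eq_add_of_le hik
      have e1 : k + 1 + j = k + j + 1 := by omega
      have h3 : |h ((k + 1 + j : ℕ) * (2 * Real.pi)) - 1| ≤ 1 / 8 := by
        rw [e1]
        exact (hO.cycle hR (hstart (k + j))).2.1 (by rw [hstay, hk])
      have h4 := ((hO.cycle hR (hstart (k + 1 + j))).2.2 t hi).2 h3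
      rwa [show k + 1 + j = k + (1 + j) by omega, hstay] at h4

end FlatOrbit

end

/-! ### Global existence for the relaxation equations -/

noncomputable section

theorem SolvesOn.norm_le_of_linear_growth {E : Type*} [NormedAddCommGroup E] [NormedSpace ℝ E]
    {γ γ' : ℝ → E} {b K : ℝ} (hγ : ∀ t ∈ Set.Icc 0 b, HasDerivWithinAt γ (γ' t) (Set.Icc 0 b) t)
    (hK : 0 ≤ K) (bound : ∀ t ∈ Set.Icc 0 b, ‖γ' t‖ ≤ K * ‖γ t‖ + K) {T : ℝ} (hT : b ≤ T) :
    ∀ t ∈ Set.Icc 0 b, ‖γ t‖ ≤ gronwallBound ‖γ 0‖ K K T := by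
  intro t ht
  refine (norm_le_gronwallBound_of_norm_deriv_right_le (f' := γ') (K := K) (ε := K)
    (fun t ht => (hγ t ht).continuousWithinAt) (fun t ht => ?_) le_rfl
    (fun t ht => bound t ⟨ht.1, ht.2.le⟩) t ht).trans ?_
  · exact (hγ t ⟨ht.1, ht.2.le⟩).mono_of_mem_nhdsWithin (Icc_mem_nhdsGE_of_mem ht)
  · exact gronwallBound_mono (norm_nonneg _) hK hK (by linarith [ht.2])

/-- A time-dependent field of linear growth in the space variable has global integral curves. -/
theorem exists_global_solution_of_linear_growth {E : Type*} [NormedAddCommGroup E]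
    [NormedSpace ℝ E] [FiniteDimensional ℝ E] {g : ℝ × E → E} (hg : ContDiff ℝ 1 g)
    (hlin : ∀ T, 0 < T → ∃ K, 0 ≤ K ∧ ∀ t ∈ Set.Icc (-T) T, ∀ x, ‖g (t, x)‖ ≤ K * ‖x‖ + K)
    (x₀ : E) : ∃ γ : ℝ → E, γ 0 = x₀ ∧ ∀ t, HasDerivAt γ (g (t, γ t)) t := by
  -- Time becomes a coordinate, so that the autonomous theory applies; Grönwall's inequality bounds
  -- the other coordinates.
  have hf : ContDiff ℝ 1 fun p : ℝ × E => ((1 : ℝ), g p) := contDiff_const.prodMk hg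
  have htime : ∀ (γ : ℝ → ℝ × E) (a b : ℝ), a ≤ 0 → 0 ≤ b → γ 0 = (0, x₀) →
      SolvesOn (fun p : ℝ × E => ((1 : ℝ), g p)) γ a b → ∀ t ∈ Set.Icc a b, (γ t).1 = t := by
    intro γ a b ha hb h0 hγ t ht
    have h1 : SolvesOn (fun _ : ℝ => (1 : ℝ)) (fun t => (γ t).1) a b := fun t ht =>
      (hasFDerivAt_fst (p := γ t)).comp_hasDerivWithinAt (f := γ) t (hγ t ht)
    have h2 : SolvesOn (fun _ : ℝ => (1 : ℝ)) (fun t => t) a b := fun t ht => hasDerivWithinAt_id t _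
    exact SolvesOn.eqOn contDiff_const (t₀ := 0) ⟨ha, hb⟩ h1 h2 (by simp [h0]) ht
  obtain ⟨γ, h0, hγ⟩ := exists_global_solution hf (0, x₀) (by
    intro T hT
    obtain ⟨K, hK, hb⟩ := hlin T hT
    refine ⟨max T (gronwallBound ‖x₀‖ K K T), ?_⟩
    intro a b ha ha0 hb0 hbT γ h0 hγ t ht
    have hs := htime γ a b ha0 hb0 h0 hγ
    have hT1 : |t| ≤ T := abs_le.2 ⟨ha.trans ht.1, ht.2.trans hbT⟩
    have hd : ∀ t ∈ Set.Icc a b, HasDerivWithinAt (fun t => (γ t).2) (g (t, (γ t).2))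
        (Set.Icc a b) t := by
      intro t ht
      have := (hasFDerivAt_snd (p := γ t)).comp_hasDerivWithinAt (f := γ) t (hγ t ht)
      have e : γ t = (t, (γ t).2) := Prod.ext (hs t ht) rfl
      simp only [ContinuousLinearMap.coe_snd'] at this
      rw [e] at this
      exact this
    rw [Prod.norm_def]
    refine max_le_max ?_ ?_
    · rw [hs t ht]; exact hT1
    · rcases le_total 0 t with h | h
      · have := SolvesOn.norm_le_of_linear_growth (γ := fun t => (γ t).2)
          (fun t ht => (hd t ⟨ha0.trans ht.1, ht.2⟩).mono (Set.Icc_subset_Icc_left ha0)) hK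
          (fun t ht => hb t ⟨by linarith [ht.1], ht.2.trans hbT⟩ _) hbT t ⟨h, ht.2⟩
        simpa [h0] using this
      · have := SolvesOn.norm_le_of_linear_growth (γ := fun t => (γ (-t)).2) (b := -a)
          (γ' := fun t => -g (-t, (γ (-t)).2)) (K := K)
          (fun t ht => by
            have h1 := hd (-t) ⟨by linarith [ht.2], by linarith [ht.1]⟩
            have h2 := HasDerivWithinAt.scomp (g₁ := fun t => (γ t).2) (h := fun t : ℝ => -t)
              (t' := Set.Icc a b) (s := Set.Icc 0 (-a)) t h1
              (hasDerivWithinAt_id t (Set.Icc 0 (-a))).fun_neg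
              (fun u hu => ⟨by linarith [hu.2], by linarith [hu.1]⟩)
            simpa [Function.comp_def] using h2) hK
          (fun t ht => by
            rw [norm_neg]
            exact hb (-t) ⟨by linarith [ht.2], by linarith [ht.1]⟩ _) (T := T) (by linarith)
            (-t) ⟨by linarith, by linarith [ht.1]⟩
        simpa [h0] using this)
  have hs : ∀ t, (γ t).1 = t := fun t =>
    htime γ (min t 0) (max t 0) (min_le_right _ _) (le_max_right _ _) h0
      (fun u _ => (hγ u).hasDerivWithinAt) t ⟨min_le_left _ _, le_max_left _ _⟩
  refine ⟨fun t => (γ t).2, by simp [h0], fun t => ?_⟩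
  have := (hasFDerivAt_snd (p := γ t)).comp_hasDerivAt (f := γ) t (hγ t)
  have e : γ t = (t, (γ t).2) := Prod.ext (hs t) rfl
  simp only [ContinuousLinearMap.coe_snd'] at this
  rw [e] at this
  exact this

theorem exists_isRelay {f H A : ℝ → ℝ} (hf : ContDiff ℝ 1 f) (hH : ContDiff ℝ 1 H)
    (hA : ContDiff ℝ 1 A) {C : ℝ} (hfC : ∀ z, |f z| ≤ C * (1 + |z|)) (hHC : ∀ z, |H z| ≤ C)
    (x₀ : ℝ) : ∃ x y h : ℝ → ℝ, IsRelay f H A x y h ∧ x 0 = x₀ ∧ y 0 = 0 ∧ h 0 = 0 := by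
  have hC : 0 ≤ C := (abs_nonneg _).trans (hHC 0)
  obtain ⟨γ, h0, hγ⟩ := exists_global_solution_of_linear_growth
    (g := fun p : ℝ × ℝ × ℝ × ℝ =>
      (Real.exp (-(A p.1 * Real.sin p.1)) * (f p.2.2.1 - p.2.1),
       Real.exp (A p.1 * Real.sin p.1) * (p.2.1 - p.2.2.1),
       Real.exp (-(A p.1 * Real.sin p.1)) * (H p.2.2.1 - p.2.2.2)))
    (by fun_prop) (by
      intro T hT
      have hcA := hA.continuous
      obtain ⟨G, hG⟩ := (isCompact_Icc (a := -T) (b := T)).bddAbove_image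
        (f := fun t => |A t * Real.sin t|) (by fun_prop)
      have hG' : ∀ t ∈ Set.Icc (-T) T, |A t * Real.sin t| ≤ G := fun t ht =>
        hG (Set.mem_image_of_mem _ ht)
      refine ⟨Real.exp G * (C + 2), by positivity, fun t ht p => ?_⟩
      have e1 : Real.exp (-(A t * Real.sin t)) ≤ Real.exp G :=
        Real.exp_le_exp.2 (by linarith [neg_abs_le (A t * Real.sin t), hG' t ht])
      have e2 : Real.exp (A t * Real.sin t) ≤ Real.exp G :=
        Real.exp_le_exp.2 (by linarith [le_abs_self (A t * Real.sin t), hG' t ht])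
      obtain ⟨x, y, h⟩ := p
      have hx : |x| ≤ ‖(x, y, h)‖ := norm_fst_le (x, y, h)
      have hyh : ‖(y, h)‖ ≤ ‖(x, y, h)‖ := norm_snd_le (x, y, h)
      have hy : |y| ≤ ‖(x, y, h)‖ := (norm_fst_le (y, h)).trans hyh
      have hh : |h| ≤ ‖(x, y, h)‖ := (norm_snd_le (y, h)).trans hyh
      set N := ‖(x, y, h)‖
      have hN : 0 ≤ N := norm_nonneg _
      have key : ∀ u v : ℝ, 0 ≤ u → u ≤ Real.exp G → |v| ≤ (C + 2) * N + (C + 2) →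
          ‖u * v‖ ≤ Real.exp G * (C + 2) * N + Real.exp G * (C + 2) := by
        intro u v hu hu' hv
        rw [Real.norm_eq_abs, abs_mul, abs_of_nonneg hu]
        calc u * |v| ≤ Real.exp G * ((C + 2) * N + (C + 2)) := by gcongr
          _ = _ := by ring
      have hCy := mul_le_mul_of_nonneg_left hy hC
      have hCN : 0 ≤ C * N := mul_nonneg hC hN
      simp only [Prod.norm_def (E := ℝ) (F := ℝ × ℝ), Prod.norm_def (E := ℝ) (F := ℝ)] at *
      refine max_le (key _ _ (Real.exp_pos _).le e1 ?_) (max_le (key _ _ (Real.exp_pos _).le e2 ?_)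
        (key _ _ (Real.exp_pos _).le e1 ?_))
      · have := abs_sub (f y) x
        linarith [hfC y]
      · have := abs_sub x y
        linarith
      · have := abs_sub (H y) h
        linarith [hHC y]) (x₀, 0, 0)
  have hsnd : ∀ t, HasDerivAt (fun t => (γ t).2) _ t := fun t =>
    (hasFDerivAt_snd (p := γ t)).comp_hasDerivAt (f := γ) t (hγ t)
  refine ⟨fun t => (γ t).1, fun t => (γ t).2.1, fun t => (γ t).2.2,
    ⟨fun t => ?_, fun t => ?_, fun t => ?_⟩, by simp [h0], by simp [h0], by simp [h0]⟩
  · exact (hasFDerivAt_fst (p := γ t)).comp_hasDerivAt (f := γ) t (hγ t)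
  · exact (hasFDerivAt_fst (p := (γ t).2)).comp_hasDerivAt (f := fun t => (γ t).2) t (hsnd t)
  · exact (hasFDerivAt_snd (p := (γ t).2)).comp_hasDerivAt (f := fun t => (γ t).2) t (hsnd t)

end

/-! ### The polynomial field of the relaxation equations -/

noncomputable section

/-- A smooth function that is the identity on the integers, where it is flat. -/
def smoothRound (z : ℝ) : ℝ := z - Real.sin (2 * Real.pi * z) / (2 * Real.pi)

/-- A smooth function of the residue of an integer modulo `M`. -/
def cosMod (M : ℕ) (z : ℝ) : ℝ := Real.cos (2 * Real.pi / M * z)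

/-- This is `sin (Mθ) = sin θ · U_{M-1}(cos θ)` for `θ = ωz`, `ω = 2π/M`. The rounding is thus a
rational polynomial in `z`, `sin (ωz) / ω` and `cos (ωz)`, so `π` enters the initial point but not
the coefficients of the field. -/
theorem smoothRound_eq {M : ℕ} (hM : M ≠ 0) (z : ℝ) :
    smoothRound z = z - Real.sin (2 * Real.pi / M * z) / (2 * Real.pi / M) *
      (Polynomial.aeval (cosMod M z) (Polynomial.Chebyshev.U ℚ (M - 1))) / M := by
  have hM' : (M : ℝ) ≠ 0 := by exact_mod_cast hM
  have hU := Polynomial.Chebyshev.U_real_cos (2 * Real.pi / M * z) (M - 1)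
  have h1 : Polynomial.aeval (cosMod M z) (Polynomial.Chebyshev.U ℚ (M - 1)) =
      (Polynomial.Chebyshev.U ℝ (M - 1)).eval (cosMod M z) := by
    rw [← Polynomial.Chebyshev.map_U (algebraMap ℚ ℝ), Polynomial.eval_map_algebraMap]
  have h2 : (((M : ℤ) - 1 : ℤ) + 1 : ℝ) * (2 * Real.pi / M * z) = 2 * Real.pi * z := by
    push_cast; field_simp; ring
  rw [h2] at hU
  rw [smoothRound, h1, ← hU, cosMod]
  field_simp

/-- The map that multiplies the smooth rounding by a polynomial in the residue. -/
def relayMap (M : ℕ) (T : Polynomial ℚ) (z : ℝ) : ℝ :=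
  smoothRound z * Polynomial.aeval (cosMod M z) T

/-- A polynomial in the residue. -/
def residueMap (M : ℕ) (H : Polynomial ℚ) (z : ℝ) : ℝ := Polynomial.aeval (cosMod M z) H

theorem contDiff_aeval_real (T : Polynomial ℚ) {n : WithTop ℕ∞} :
    ContDiff ℝ n fun z : ℝ => Polynomial.aeval z T := T.contDiff_aeval n

theorem contDiff_residueMap (M : ℕ) (H : Polynomial ℚ) {n : WithTop ℕ∞} :
    ContDiff ℝ n (residueMap M H) :=
  (contDiff_aeval_real H).comp (f := cosMod M) (by unfold cosMod; fun_prop)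

theorem contDiff_relayMap (M : ℕ) (T : Polynomial ℚ) {n : WithTop ℕ∞} :
    ContDiff ℝ n (relayMap M T) := by
  have h : ContDiff ℝ n smoothRound := by unfold smoothRound; fun_prop
  exact h.mul (contDiff_residueMap M T)

open MvPolynomial in
/-- The polynomial field that contains the relaxation equations. The coordinates are
`x, y, h, sin (ω y) / ω, cos (ω y), ω², A, sin s, cos s, exp (-A sin s), exp (A sin s), v`, where
`ω = 2π / M`, and time is reparametrized by `ds = v dτ`, `v = tanh τ`. -/
def relayFieldRat (M κ : ℕ) (T H : Polynomial ℚ) : Fin 17 → MvPolynomial (Fin 17) ℚ :=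
  -- The constant coordinate `ω²` appears because the derivative of `cos (ωy)` is `-ω² · (sin (ωy) /
  -- ω) · y'`. The polynomial `l` is the derivative of `A sin s`. The last five coordinates are
  -- idle.
  let y' := X 11 * X 10 * (X 0 - X 1)
  let l := X 11 * (C (κ : ℚ) * X 6 * X 7 + X 6 * X 8)
  ![X 11 * X 9 * ((X 1 - X 3 * Polynomial.aeval (X 4) (Polynomial.Chebyshev.U ℚ (M - 1)) *
      C ((M : ℚ)⁻¹)) * Polynomial.aeval (X 4) T - X 0),
    y',
    X 11 * X 9 * (Polynomial.aeval (X 4) H - X 2),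
    X 4 * y',
    -(X 5 * X 3 * y'),
    0,
    X 11 * C (κ : ℚ) * X 6,
    X 11 * X 8,
    -(X 11 * X 7),
    -(l * X 9),
    l * X 10,
    1 - X 11 ^ 2,
    0, 0, 0, 0, 0]

/-- The real polynomial field of the relaxation equations. -/
def relayField (M κ : ℕ) (T H : Polynomial ℚ) : PolyField 17 :=
  fun i => MvPolynomial.map (algebraMap ℚ ℝ) (relayFieldRat M κ T H i)

theorem relayField_val (M κ : ℕ) (T H : Polynomial ℚ) (z : E 17) (i : Fin 17) :
    (relayField M κ T H).val z i = MvPolynomial.aeval (fun j => z j) (relayFieldRat M κ T H i) := by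
  simp [PolyField.val, relayField, MvPolynomial.eval_map, MvPolynomial.aeval_def]

/-- The values of the coordinates of the relay field along a solution of the relaxation
equations. -/
def relayCurve (M : ℕ) (A x y h : ℝ → ℝ) (s v : ℝ) : Fin 17 → ℝ :=
  ![x s, y s, h s, Real.sin (2 * Real.pi / M * y s) / (2 * Real.pi / M), cosMod M (y s),
    (2 * Real.pi / M) ^ 2, A s, Real.sin s, Real.cos s, Real.exp (-(A s * Real.sin s)),
    Real.exp (A s * Real.sin s), v, 0, 0, 0, 0, 0]

theorem IsRelay.hasDerivAt_relayCurve {M κ : ℕ} (hM : M ≠ 0) {T H : Polynomial ℚ}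
    {A x y h : ℝ → ℝ} (hR : IsRelay (relayMap M T) (residueMap M H) A x y h)
    (hA : ∀ s, HasDerivAt A (κ * A s) s) {s v : ℝ → ℝ} (hs : ∀ τ, HasDerivAt s (v τ) τ)
    (hv : ∀ τ, HasDerivAt v (1 - v τ ^ 2) τ) (τ : ℝ) :
    HasDerivAt (fun τ => (WithLp.toLp 2 (relayCurve M A x y h (s τ) (v τ)) : E 17))
      ((relayField M κ T H).val (WithLp.toLp 2 (relayCurve M A x y h (s τ) (v τ)))) τ := by
  have hω : 2 * Real.pi / M ≠ 0 := by
    have : (M : ℝ) ≠ 0 := by exact_mod_cast hM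
    have := Real.pi_pos
    positivity
  have hx := (hR.hasDerivAt_x (s τ)).comp τ (hs τ)
  have hy := (hR.hasDerivAt_y (s τ)).comp τ (hs τ)
  have hh := (hR.hasDerivAt_h (s τ)).comp τ (hs τ)
  have hA' := (hA (s τ)).comp τ (hs τ)
  have hsn := (hs τ).sin
  have hcs := (hs τ).cos
  have hl := hA'.fun_mul hsn
  rw [hasDerivAt_euclidean]
  intro i
  rw [relayField_val]
  have hpol : ∀ p : Polynomial ℚ,
      MvPolynomial.aeval (fun j => relayCurve M A x y h (s τ) (v τ) j)
        (Polynomial.aeval (MvPolynomial.X (R := ℚ) (σ := Fin 17) 4) p) =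
      Polynomial.aeval (cosMod M (y (s τ))) p := by
    intro p
    rw [← Polynomial.aeval_algHom_apply, MvPolynomial.aeval_X]
    rfl
  fin_cases i
  · refine HasDerivAt.congr_deriv (f := fun τ => x (s τ)) hx ?_
    simp only [relayMap, smoothRound_eq hM]
    simp [relayFieldRat, hpol, -Polynomial.Chebyshev.aeval_U]
    simp [relayCurve, -Polynomial.Chebyshev.aeval_U]
    ring
  · refine HasDerivAt.congr_deriv (f := fun τ => y (s τ)) hy ?_
    simp [relayFieldRat]
    simp [relayCurve]
    ring
  · refine HasDerivAt.congr_deriv (f := fun τ => h (s τ)) hh ?_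
    simp [relayFieldRat, hpol]
    simp [relayCurve, residueMap]
    ring
  · refine HasDerivAt.congr_deriv (f := fun τ => Real.sin (2 * Real.pi / M * y (s τ)) /
      (2 * Real.pi / M)) ((hy.const_mul (2 * Real.pi / M)).sin.div_const _) ?_
    simp [relayFieldRat]
    simp [relayCurve, cosMod]
    field_simp
  · refine HasDerivAt.congr_deriv (f := fun τ => Real.cos (2 * Real.pi / M * y (s τ)))
      (hy.const_mul (2 * Real.pi / M)).cos ?_
    simp [relayFieldRat]
    simp [relayCurve]
    field_simp
  · refine HasDerivAt.congr_deriv (f := fun _ => (2 * Real.pi / M) ^ 2) (hasDerivAt_const _ _) ?_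
    simp [relayFieldRat]
  · refine HasDerivAt.congr_deriv (f := fun τ => A (s τ)) hA' ?_
    simp [relayFieldRat]
    simp [relayCurve]
    ring
  · refine HasDerivAt.congr_deriv (f := fun τ => Real.sin (s τ)) hsn ?_
    simp [relayFieldRat]
    simp [relayCurve]
    ring
  · refine HasDerivAt.congr_deriv (f := fun τ => Real.cos (s τ)) hcs ?_
    simp [relayFieldRat]
    simp [relayCurve]
    ring
  · refine HasDerivAt.congr_deriv (f := fun τ => Real.exp (-(A (s τ) * Real.sin (s τ))))
      hl.fun_neg.exp ?_
    simp [relayFieldRat]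
    simp [relayCurve]
    ring
  · refine HasDerivAt.congr_deriv (f := fun τ => Real.exp (A (s τ) * Real.sin (s τ))) hl.exp ?_
    simp [relayFieldRat]
    simp [relayCurve]
    ring
  · refine HasDerivAt.congr_deriv (f := v) (hv τ) ?_
    simp [relayFieldRat]
    simp [relayCurve]
  all_goals
    refine HasDerivAt.congr_deriv (f := fun _ => (0 : ℝ)) (hasDerivAt_const _ _) ?_
    simp [relayFieldRat]

/-- A solution of the relaxation equations on the positive half-line gives an integral curve of the
relay field on the whole line. -/
theorem IsRelay.exists_integralCurve {M κ : ℕ} (hM : M ≠ 0) {T H : Polynomial ℚ} {A₀ : ℝ}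
    {x y h : ℝ → ℝ} (hR : IsRelay (relayMap M T) (residueMap M H)
      (fun t => A₀ * Real.exp (κ * t)) x y h) (hy0 : y 0 = 0) (hh0 : h 0 = 0) :
    ∃ γ : ℝ → E 17, γ 0 = WithLp.toLp 2
        ![x 0, 0, 0, 0, 1, (2 * Real.pi / M) ^ 2, A₀, 0, 1, 1, 1, 0, 0, 0, 0, 0, 0] ∧
      (∀ τ, HasDerivAt γ ((relayField M κ T H).val (γ τ)) τ) ∧
      ∀ τ, γ τ 1 = y (Real.log (Real.cosh τ)) ∧ γ τ 2 = h (Real.log (Real.cosh τ)) := by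
  -- The time `s = log cosh τ` has `s' = tanh τ = v`, is even and never negative: for negative `τ`
  -- the computation on `s ≥ 0` is retraced, so backward time produces nothing new.
  refine ⟨fun τ => WithLp.toLp 2 (relayCurve M (fun t => A₀ * Real.exp (κ * t)) x y h
    (Real.log (Real.cosh τ)) (Real.tanh τ)), ?_, hR.hasDerivAt_relayCurve hM ?_ ?_ ?_,
    fun τ => ⟨rfl, rfl⟩⟩
  · simp [relayCurve, hy0, hh0, cosMod]
  · intro s
    refine (((hasDerivAt_id s).const_mul (κ : ℝ)).exp.const_mul A₀).congr_deriv ?_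
    simp
    ring
  · intro τ
    refine ((Real.hasDerivAt_cosh τ).log (Real.cosh_pos τ).ne').congr_deriv ?_
    rw [Real.tanh_eq_sinh_div_cosh]
  · intro τ
    have h0 := (Real.cosh_pos τ).ne'
    have : HasDerivAt (fun τ => Real.sinh τ / Real.cosh τ) _ τ :=
      (Real.hasDerivAt_sinh τ).fun_div (Real.hasDerivAt_cosh τ) h0
    simp only [← Real.tanh_eq_sinh_div_cosh] at this
    refine this.congr_deriv ?_
    rw [Real.tanh_eq_sinh_div_cosh]
    field_simp

end

/-! ### Computable reals -/

noncomputable section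

theorem encode_int_natCast (n : ℕ) : Encodable.encode (n : ℤ) = 2 * n := rfl

theorem encode_int_negSucc (n : ℕ) : Encodable.encode (Int.negSucc n) = 2 * n + 1 := rfl

theorem Primrec.int_natCast : Primrec fun n : ℕ => (n : ℤ) :=
  Primrec.encode_iff.1 ((Primrec.nat_mul.comp (Primrec.const 2) Primrec.id).of_eq fun n => by
    rw [encode_int_natCast]; rfl)

theorem Primrec.int_neg : Primrec fun n : ℤ => -n := by
  refine Primrec.encode_iff.1 ?_
  have h0 : Primrec fun n : ℤ => Encodable.encode n := Primrec.encode
  refine (Primrec.ite (c := fun n : ℤ => Encodable.encode n = 0)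
    (Primrec.eq.comp h0 (Primrec.const 0)) (Primrec.const 0)
    (Primrec.ite (c := fun n : ℤ => Encodable.encode n % 2 = 0)
      (Primrec.eq.comp (Primrec.nat_mod.comp h0 (Primrec.const 2)) (Primrec.const 0))
      (Primrec.nat_sub.comp h0 (Primrec.const 1))
      (Primrec.nat_add.comp h0 (Primrec.const 1)))).of_eq fun n => ?_
  rcases n with n | n
  · rw [Int.ofNat_eq_natCast, encode_int_natCast]
    rcases n with _ | n
    · rfl
    · rw [if_neg (by omega), if_pos (by omega)]
      have : -((n + 1 : ℕ) : ℤ) = Int.negSucc n := rfl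
      rw [this, encode_int_negSucc]
      omega
  · rw [encode_int_negSucc, if_neg (by omega), if_neg (by omega), Int.neg_negSucc]
    have := encode_int_natCast (n + 1)
    rw [this]
    omega

theorem IsComputableReal.neg {x : ℝ} (hx : IsComputableReal x) : IsComputableReal (-x) := by
  obtain ⟨f, hf, h⟩ := hx
  refine ⟨fun k => -f k, Primrec.int_neg.to_comp.comp hf, fun k => ?_⟩
  rw [← abs_neg]
  convert h k using 2
  push_cast
  ring

/-- A real with a primitive recursive sequence of rational approximations is computable. -/
theorem isComputableReal_of_approx {x : ℝ} {num den : ℕ → ℕ} (hnum : Primrec num)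
    (hden : Primrec den) (hpos : ∀ k, 0 < den k)
    (h : ∀ k, |x - num k / den k| ≤ 1 / 2 ^ (k + 1)) : IsComputableReal x := by
  have hpow : Primrec fun k : ℕ => 2 ^ k :=
    (Primrec.nat_rec₁ 1 ((Primrec.nat_mul.comp Primrec.snd (Primrec.const 2)).to₂)).of_eq fun k => by
      induction k with
      | zero => rfl
      | succ k ih => rw [pow_succ, ← ih]
  -- Rounding `2 ^ k · num / den` to the nearest integer costs another `1 / 2 ^ (k + 1)`.
  have hf : Primrec fun k => (2 * num k * 2 ^ k + den k) / (2 * den k) :=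
    Primrec.nat_div.comp
      (Primrec.nat_add.comp
        (Primrec.nat_mul.comp (Primrec.nat_mul.comp (Primrec.const 2) hnum) hpow) hden)
      (Primrec.nat_mul.comp (Primrec.const 2) hden)
  refine ⟨fun k => (((2 * num k * 2 ^ k + den k) / (2 * den k) : ℕ) : ℤ),
    (Primrec.int_natCast.comp hf).to_comp, fun k => ?_⟩
  set q := (2 * num k * 2 ^ k + den k) / (2 * den k) with hq
  have hd : (0 : ℝ) < den k := by exact_mod_cast hpos k
  have h1 : q * (2 * den k) ≤ 2 * num k * 2 ^ k + den k := Nat.div_mul_le_self _ _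
  have h2 : 2 * num k * 2 ^ k + den k < (q + 1) * (2 * den k) := by
    rw [mul_comm (q + 1)]
    exact Nat.lt_mul_div_succ _ (by have := hpos k; omega)
  have h1' : (q : ℝ) * (2 * den k) ≤ 2 * num k * 2 ^ k + den k := by exact_mod_cast h1
  have h2' : (2 : ℝ) * num k * 2 ^ k + den k < (q + 1) * (2 * den k) := by exact_mod_cast h2
  have h3 : |(num k : ℝ) / den k - q / 2 ^ k| ≤ 1 / 2 ^ (k + 1) := by
    have e : (num k : ℝ) / den k - q / 2 ^ k =
        (2 * num k * 2 ^ k - q * (2 * den k)) / den k / 2 ^ (k + 1) := by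
      field_simp
      ring
    rw [e, abs_div, abs_of_pos (by positivity : (0 : ℝ) < 2 ^ (k + 1))]
    gcongr
    rw [abs_div, abs_of_pos hd, div_le_one hd, abs_le]
    constructor <;> linarith
  have h4 := abs_sub_le x (num k / den k) ((q : ℝ) / 2 ^ k)
  have h5 : (1 : ℝ) / 2 ^ (k + 1) + 1 / 2 ^ (k + 1) = 1 / 2 ^ k := by
    field_simp; ring
  simp only [Int.cast_natCast]
  linarith [h k]

theorem isComputableReal_ratCast (q : ℚ) : IsComputableReal q := by
  have key : ∀ q : ℚ, 0 ≤ q → IsComputableReal q := by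
    intro q hq
    refine isComputableReal_of_approx (Primrec.const q.num.toNat) (Primrec.const q.den)
      (fun _ => q.den_pos) fun k => ?_
    have : (q : ℝ) = (q.num.toNat : ℝ) / q.den := by
      have h1 : ((q.num.toNat : ℤ) : ℝ) = q.num := by
        rw [Int.toNat_of_nonneg (Rat.num_nonneg.2 hq)]
      rw [← Int.cast_natCast q.num.toNat, h1]
      exact (Rat.cast_def q)
    rw [this, sub_self, abs_zero]
    positivity
  rcases le_total 0 q with h | h
  · exact key q h
  · have := (key (-q) (by linarith)).neg
    simpa using this

theorem relayField_isConstructible (M κ : ℕ) (T H : Polynomial ℚ) :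
    (relayField M κ T H).IsConstructible := by
  intro i m
  rw [relayField, MvPolynomial.coeff_map]
  exact isComputableReal_ratCast _

theorem wallis_eq (k : ℕ) : Real.Wallis.W k =
    ((Nat.rec 1 (fun i p => p * (2 * i + 2) ^ 2) k : ℕ) : ℝ) /
      (Nat.rec 1 (fun i p => p * ((2 * i + 1) * (2 * i + 3))) k : ℕ) := by
  induction k with
  | zero => simp [Real.Wallis.W]
  | succ k ih =>
    rw [Real.Wallis.W_succ, ih]
    push_cast
    field_simp

/-- The Wallis products `W` tend to `π/2`, so `16 W² / M²` approximates the number. The error of `W`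
is at most the reciprocal of the number of factors, whence `160 · 2 ^ k` factors suffice. Numerator
and denominator are kept unreduced, which makes both primitive recursive. -/
theorem isComputableReal_sq_two_pi_div (M : ℕ) : IsComputableReal ((2 * Real.pi / M) ^ 2) := by
  rcases Nat.eq_zero_or_pos M with rfl | hM
  · simpa using isComputableReal_ratCast 0
  have hsq : ∀ {α : Type} [Primcodable α] {f : α → ℕ}, Primrec f → Primrec fun a => f a ^ 2 :=
    fun hf => (Primrec.nat_mul.comp hf hf).of_eq fun a => (sq _).symm
  have hlin : ∀ c : ℕ, Primrec fun p : ℕ × ℕ => 2 * p.1 + c := fun c =>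
    Primrec.nat_add.comp (Primrec.nat_mul.comp (Primrec.const 2) Primrec.fst) (Primrec.const c)
  have hn : Primrec (Nat.rec 1 (fun i p => p * (2 * i + 2) ^ 2) : ℕ → ℕ) :=
    Primrec.nat_rec₁ 1 (Primrec.nat_mul.comp Primrec.snd (hsq (hlin 2))).to₂
  have hd : Primrec (Nat.rec 1 (fun i p => p * ((2 * i + 1) * (2 * i + 3))) : ℕ → ℕ) :=
    Primrec.nat_rec₁ 1
      (Primrec.nat_mul.comp Primrec.snd (Primrec.nat_mul.comp (hlin 1) (hlin 3))).to₂
  have hk : Primrec fun k : ℕ => 160 * 2 ^ k :=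
    (Primrec.nat_rec₁ 160 ((Primrec.nat_mul.comp Primrec.snd (Primrec.const 2)).to₂)).of_eq fun k => by
      induction k with
      | zero => rfl
      | succ k ih => rw [pow_succ, ← mul_assoc, ← ih]
  refine isComputableReal_of_approx
    (Primrec.nat_mul.comp (Primrec.const 16) (hsq (hn.comp hk)))
    (Primrec.nat_mul.comp (Primrec.const (M ^ 2)) (hsq (hd.comp hk))) (fun k => ?_) fun k => ?_
  · have : ∀ k, 0 < (Nat.rec 1 (fun i p => p * ((2 * i + 1) * (2 * i + 3))) k : ℕ) := by
      intro k
      induction k with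
      | zero => exact Nat.one_pos
      | succ k ih => exact Nat.mul_pos ih (by positivity)
    have := this (160 * 2 ^ k)
    positivity
  · have hW := wallis_eq (160 * 2 ^ k)
    set a : ℕ := Nat.rec 1 (fun i p => p * (2 * i + 2) ^ 2) (160 * 2 ^ k)
    set b : ℕ := Nat.rec 1 (fun i p => p * ((2 * i + 1) * (2 * i + 3))) (160 * 2 ^ k)
    have e : (((16 * a ^ 2 : ℕ) : ℝ) / ((M ^ 2 * b ^ 2 : ℕ) : ℝ)) =
        16 * Real.Wallis.W (160 * 2 ^ k) ^ 2 / M ^ 2 := by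
      rw [hW]
      push_cast
      rw [div_pow]
      ring
    rw [e]
    have hM1 : (1 : ℝ) ≤ M := by exact_mod_cast hM
    have hM2 : (1 : ℝ) ≤ (M : ℝ) ^ 2 := one_le_pow₀ hM1
    have h1 := Real.Wallis.W_le (160 * 2 ^ k)
    have h2 := Real.Wallis.le_W (160 * 2 ^ k)
    have h0 := Real.Wallis.W_pos (160 * 2 ^ k)
    set W := Real.Wallis.W (160 * 2 ^ k)
    have hπ := Real.pi_lt_d2
    have hπ0 := Real.pi_pos
    have hX : (0 : ℝ) < 2 ^ k := by positivity
    have h3 : (Real.pi / 2 - W) * (160 * 2 ^ k) ≤ 1 := by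
      push_cast at h2
      have h4 : (2 * (160 * (2 : ℝ) ^ k) + 1) / (2 * (160 * 2 ^ k) + 2) =
          1 - 1 / (2 * (160 * 2 ^ k) + 2) := by field_simp; ring
      rw [h4] at h2
      have h5 : Real.pi / 2 - W ≤ 1 / (2 * (160 * 2 ^ k) + 2) * (Real.pi / 2) := by linarith
      calc (Real.pi / 2 - W) * (160 * 2 ^ k)
          ≤ 1 / (2 * (160 * 2 ^ k) + 2) * (Real.pi / 2) * (160 * 2 ^ k) := by gcongr
        _ = (Real.pi / 2) * (160 * 2 ^ k) / (2 * (160 * 2 ^ k) + 2) := by ring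
        _ ≤ 1 := by
          rw [div_le_one (by positivity)]
          nlinarith
    have h6 : (2 * Real.pi / M) ^ 2 - 16 * W ^ 2 / M ^ 2 =
        16 * ((Real.pi / 2 - W) * (Real.pi / 2 + W)) / M ^ 2 := by
      field_simp
      ring
    rw [h6, abs_of_nonneg (by
      have : 0 ≤ Real.pi / 2 - W := by linarith
      positivity)]
    rw [div_le_iff₀ (by positivity), pow_succ]
    have h7 : 16 * ((Real.pi / 2 - W) * (Real.pi / 2 + W)) ≤ 1 / (2 ^ k * 2) := by
      rw [le_div_iff₀ (by positivity)]
      have : 0 ≤ Real.pi / 2 - W := by linarith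
      calc 16 * ((Real.pi / 2 - W) * (Real.pi / 2 + W)) * (2 ^ k * 2)
          = ((Real.pi / 2 - W) * (160 * 2 ^ k)) * ((Real.pi / 2 + W) * (1 / 5)) := by ring
        _ ≤ 1 * (Real.pi * (1 / 5)) := by
          nlinarith
        _ ≤ _ := by linarith
    nlinarith [(by positivity : (0 : ℝ) < 1 / (2 ^ k * 2))]

end

/-! ### Flat polynomials in the residue -/

noncomputable section

/-- The polynomial `p` in the residue modulo `M` is flat at the natural numbers. -/
def IsFlat (M : ℕ) (p : Polynomial ℚ) : Prop :=
  ∃ C : ℝ, 0 ≤ C ∧ ∀ (m : ℕ) (e : ℝ), |residueMap M p (m + e) - residueMap M p m| ≤ C * e ^ 2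

theorem exists_abs_residueMap_le (M : ℕ) (p : Polynomial ℚ) :
    ∃ B : ℝ, 0 ≤ B ∧ ∀ z, |residueMap M p z| ≤ B := by
  obtain ⟨B, hB⟩ := (isCompact_Icc (a := (-1 : ℝ)) (b := 1)).bddAbove_image
    (f := fun c => |Polynomial.aeval c p|)
    ((contDiff_aeval_real p (n := 0)).continuous.abs.continuousOn)
  have h : ∀ z, |residueMap M p z| ≤ B := fun z =>
    hB (Set.mem_image_of_mem _ (Real.cos_mem_Icc _))
  exact ⟨B, (abs_nonneg _).trans (h 0), h⟩

namespace IsFlat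

variable {M : ℕ} {p q : Polynomial ℚ}

theorem const (a : ℚ) : IsFlat M (Polynomial.C a) := by
  refine ⟨0, le_rfl, fun m e => ?_⟩
  simp [residueMap]

theorem add (hp : IsFlat M p) (hq : IsFlat M q) : IsFlat M (p + q) := by
  obtain ⟨C, hC, h⟩ := hp
  obtain ⟨D, hD, h'⟩ := hq
  refine ⟨C + D, by positivity, fun m e => ?_⟩
  have h1 := abs_le.1 (h m e)
  have h2 := abs_le.1 (h' m e)
  simp only [residueMap, map_add] at *
  rw [abs_le]
  constructor <;> linarith

theorem mul (hp : IsFlat M p) (hq : IsFlat M q) : IsFlat M (p * q) := by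
  obtain ⟨C, hC, h⟩ := hp
  obtain ⟨D, hD, h'⟩ := hq
  obtain ⟨A, hA, h1⟩ := exists_abs_residueMap_le M p
  obtain ⟨B, hB, h2⟩ := exists_abs_residueMap_le M q
  refine ⟨A * D + C * B, by positivity, fun m e => ?_⟩
  have hm : ∀ z, residueMap M (p * q) z = residueMap M p z * residueMap M q z := fun z => by
    simp [residueMap]
  rw [hm, hm]
  calc |residueMap M p (m + e) * residueMap M q (m + e) - residueMap M p m * residueMap M q m|
      = |residueMap M p (m + e) * (residueMap M q (m + e) - residueMap M q m) +
          (residueMap M p (m + e) - residueMap M p m) * residueMap M q m| := by ring_nf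
    _ ≤ |residueMap M p (m + e)| * |residueMap M q (m + e) - residueMap M q m| +
          |residueMap M p (m + e) - residueMap M p m| * |residueMap M q m| := by
        rw [← abs_mul, ← abs_mul]; exact abs_add_le _ _
    _ ≤ A * (D * e ^ 2) + C * e ^ 2 * B := by
        gcongr
        · exact h1 _
        · exact h' m e
        · exact h m e
        · exact h2 _
    _ = _ := by ring

theorem sum {ι : Type*} (s : Finset ι) {p : ι → Polynomial ℚ} (h : ∀ i ∈ s, IsFlat M (p i)) :
    IsFlat M (∑ i ∈ s, p i) := by
  classical
  induction s using Finset.induction_on with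
  | empty => simpa using const (M := M) 0
  | insert a s ha ih =>
    rw [Finset.sum_insert ha]
    exact (h a (Finset.mem_insert_self _ _)).add (ih fun i hi => h i (Finset.mem_insert_of_mem hi))

end IsFlat

/-- The mean of the `p`-th roots of unity to the power `n`, as a polynomial in the residue. -/
def divisorPoly (M p : ℕ) : Polynomial ℚ :=
  Polynomial.C ((p : ℚ)⁻¹) *
    ∑ j ∈ Finset.range p, Polynomial.Chebyshev.T ℚ ((j * (M / p) : ℕ) : ℤ)

/-- The Chebyshev polynomial of index `j M / p` turns `cos (2πz/M)` into `cos (2πjz/p)`. -/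
theorem residueMap_divisorPoly {M p : ℕ} (hM : M ≠ 0) (hp : p ∣ M) (z : ℝ) :
    residueMap M (divisorPoly M p) z =
      (p : ℝ)⁻¹ * ∑ j ∈ Finset.range p, Real.cos (j * (2 * Real.pi / p * z)) := by
  obtain ⟨d, rfl⟩ := hp
  have hp0 : 0 < p := Nat.pos_of_ne_zero (left_ne_zero_of_mul hM)
  have hd0 : (d : ℝ) ≠ 0 := by exact_mod_cast right_ne_zero_of_mul hM
  have hp0' : (p : ℝ) ≠ 0 := by exact_mod_cast hp0.ne'
  simp only [residueMap, divisorPoly, map_mul, map_sum, Polynomial.aeval_C, cosMod,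
    Polynomial.Chebyshev.aeval_T, Polynomial.Chebyshev.T_real_cos, Nat.mul_div_cancel_left _ hp0]
  congr 1
  · simp
  · refine Finset.sum_congr rfl fun j _ => ?_
    congr 1
    push_cast
    field_simp

/-- The sum is the real part of a geometric sum over the powers of `exp (2πi n/p)`, which vanishes
unless this root of unity is `1`. -/
theorem residueMap_divisorPoly_natCast {M p : ℕ} (hM : M ≠ 0) (hp : p ∣ M) (n : ℕ) :
    residueMap M (divisorPoly M p) n = if p ∣ n then 1 else 0 := by
  rw [residueMap_divisorPoly hM hp]
  have hp0 : p ≠ 0 := fun h => hM (by simpa [h] using hp)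
  have hp0' : (p : ℝ) ≠ 0 := by exact_mod_cast hp0
  split_ifs with h
  · obtain ⟨k, rfl⟩ := h
    have : ∀ j : ℕ, Real.cos (j * (2 * Real.pi / p * (p * k : ℕ))) = 1 := by
      intro j
      have : (j : ℝ) * (2 * Real.pi / p * (p * k : ℕ)) = (j * k : ℕ) * (2 * Real.pi) := by
        push_cast; field_simp
      rw [this, Real.cos_nat_mul_two_pi]
    rw [Finset.sum_congr rfl fun j _ => this j]
    simp [hp0']
  · set ζ : ℂ := Complex.exp (2 * Real.pi * Complex.I * (n / p)) with hζ
    have hpc : (p : ℂ) ≠ 0 := by exact_mod_cast hp0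
    have hζp : ζ ^ p = 1 := by
      rw [hζ, ← Complex.exp_nat_mul, Complex.exp_eq_one_iff]
      refine ⟨n, ?_⟩
      push_cast
      field_simp
    have hζ1 : ζ ≠ 1 := by
      rw [hζ, Ne, Complex.exp_eq_one_iff]
      rintro ⟨m, hm⟩
      have h2 : (2 * Real.pi * Complex.I : ℂ) ≠ 0 := Complex.two_pi_I_ne_zero
      have h3 : (n / p : ℂ) = m := by
        apply mul_left_cancel₀ h2
        rw [hm]; ring
      rw [div_eq_iff hpc] at h3
      have h4 : (n : ℤ) = m * p := by exact_mod_cast h3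
      exact h (Int.natCast_dvd_natCast.1 ⟨m, by rw [h4]; ring⟩)
    have hgeom : ∑ j ∈ Finset.range p, ζ ^ j = 0 := by
      rw [geom_sum_eq hζ1, hζp, sub_self, zero_div]
    have hre : ∑ j ∈ Finset.range p, Real.cos (j * (2 * Real.pi / p * n)) = 0 := by
      have := congrArg Complex.re hgeom
      rw [Complex.re_sum, Complex.zero_re] at this
      rw [← this]
      refine Finset.sum_congr rfl fun j _ => ?_
      rw [hζ, ← Complex.exp_nat_mul]
      have e : (j : ℂ) * (2 * Real.pi * Complex.I * (n / p)) =
          ((j * (2 * Real.pi / p * n) : ℝ) : ℂ) * Complex.I := by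
        push_cast; ring
      rw [e, Complex.exp_ofReal_mul_I_re]
    rw [hre, mul_zero]

theorem abs_residueMap_divisorPoly_le {M p : ℕ} (hM : M ≠ 0) (hp : p ∣ M) (z : ℝ) :
    |residueMap M (divisorPoly M p) z| ≤ 1 := by
  have hp0 : 0 < p := Nat.pos_of_ne_zero fun h => hM (by simpa [h] using hp)
  have hp0' : (0 : ℝ) < p := by exact_mod_cast hp0
  rw [residueMap_divisorPoly hM hp, abs_mul, abs_of_pos (inv_pos.2 hp0'), inv_mul_le_iff₀ hp0',
    mul_one]
  refine (Finset.abs_sum_le_sum_abs _ _).trans ?_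
  refine (Finset.sum_le_sum fun j _ => Real.abs_cos_le_one _).trans ?_
  simp

theorem abs_residueMap_divisorPoly_sub_le {M p : ℕ} (hM : M ≠ 0) (hp : p ∣ M) (z e : ℝ) :
    |residueMap M (divisorPoly M p) (z + e) - residueMap M (divisorPoly M p) z| ≤ 7 * |e| := by
  have hp0 : 0 < p := Nat.pos_of_ne_zero fun h => hM (by simpa [h] using hp)
  have hp0' : (0 : ℝ) < p := by exact_mod_cast hp0
  rw [residueMap_divisorPoly hM hp, residueMap_divisorPoly hM hp, ← mul_sub,
    ← Finset.sum_sub_distrib, abs_mul, abs_of_pos (inv_pos.2 hp0'), inv_mul_le_iff₀ hp0']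
  refine (Finset.abs_sum_le_sum_abs _ _).trans ?_
  refine (Finset.sum_le_card_nsmul _ _ (7 * |e|) fun j hj => ?_).trans (by simp)
  have hj' : (j : ℝ) ≤ p := by exact_mod_cast (Finset.mem_range.1 hj).le
  refine (Real.abs_cos_sub_cos_le _ _).trans ?_
  have e1 : (j : ℝ) * (2 * Real.pi / p * (z + e)) - j * (2 * Real.pi / p * z) =
      (j / p) * (2 * Real.pi) * e := by ring
  have hπ := Real.pi_pos
  have h1 : (j : ℝ) / p ≤ 1 := (div_le_one hp0').2 hj'
  rw [e1, abs_mul, abs_of_nonneg (by positivity)]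
  gcongr
  have := Real.pi_lt_d2
  nlinarith

/-- The flat indicator of the multiples of `p`. -/
def flatDivisorPoly (M p : ℕ) : Polynomial ℚ :=
  3 * divisorPoly M p ^ 2 - 2 * divisorPoly M p ^ 3

theorem residueMap_flatDivisorPoly (M p : ℕ) (z : ℝ) : residueMap M (flatDivisorPoly M p) z =
    3 * residueMap M (divisorPoly M p) z ^ 2 - 2 * residueMap M (divisorPoly M p) z ^ 3 := by
  have h2 : Polynomial.aeval (cosMod M z) (2 : Polynomial ℚ) = 2 := map_ofNat _ 2
  have h3 : Polynomial.aeval (cosMod M z) (3 : Polynomial ℚ) = 3 := map_ofNat _ 3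
  simp only [residueMap, flatDivisorPoly, map_sub, map_mul, map_pow, h2, h3]

theorem residueMap_flatDivisorPoly_natCast {M p : ℕ} (hM : M ≠ 0) (hp : p ∣ M) (n : ℕ) :
    residueMap M (flatDivisorPoly M p) n = if p ∣ n then 1 else 0 := by
  rw [residueMap_flatDivisorPoly, residueMap_divisorPoly_natCast hM hp]
  split_ifs <;> norm_num

/-- The polynomial `3u² - 2u³` fixes `0` and `1` and is critical there: it equals `u² (3 - 2u)`, and
`1 - (u - 1)² (1 + 2u)`. As `u` is within `7|e|` of its value at `m` and `|u| ≤ 1`, the constant is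
`49 · 5 = 245`. -/
theorem isFlat_flatDivisorPoly {M p : ℕ} (hM : M ≠ 0) (hp : p ∣ M) :
    IsFlat M (flatDivisorPoly M p) := by
  refine ⟨245, by norm_num, fun m e => ?_⟩
  rw [residueMap_flatDivisorPoly_natCast hM hp, residueMap_flatDivisorPoly]
  have h1 := abs_residueMap_divisorPoly_sub_le hM hp m e
  have h2 := abs_residueMap_divisorPoly_le hM hp (m + e)
  rw [residueMap_divisorPoly_natCast hM hp] at h1
  set u := residueMap M (divisorPoly M p) (m + e)
  have h3 : ∀ v : ℝ, |v| ≤ 7 * |e| → v ^ 2 ≤ 49 * e ^ 2 := by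
    intro v hv
    rw [← sq_abs v, ← sq_abs e]
    nlinarith [abs_nonneg v, abs_nonneg e]
  have h4 := h3 _ h1
  obtain ⟨h5, h6⟩ := abs_le.1 h2
  split_ifs at h4 ⊢
  · have e1 : 3 * u ^ 2 - 2 * u ^ 3 - 1 = -((u - 1) ^ 2 * (1 + 2 * u)) := by ring
    rw [e1, abs_neg, abs_mul, abs_of_nonneg (sq_nonneg _)]
    have : |1 + 2 * u| ≤ 3 := by rw [abs_le]; constructor <;> linarith
    nlinarith [sq_nonneg (u - 1), sq_nonneg e]
  · rw [sub_zero] at h4 ⊢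
    have e1 : 3 * u ^ 2 - 2 * u ^ 3 = u ^ 2 * (3 - 2 * u) := by ring
    rw [e1, abs_mul, abs_of_nonneg (sq_nonneg _)]
    have : |3 - 2 * u| ≤ 5 := by rw [abs_le]; constructor <;> linarith
    nlinarith [sq_nonneg u, sq_nonneg e]

theorem abs_sub_sin_le (x : ℝ) : |x - Real.sin x| ≤ 2 * x ^ 2 := by
  have key : ∀ x : ℝ, 0 ≤ x → |x - Real.sin x| ≤ 2 * x ^ 2 := by
    intro x hx
    rw [abs_of_nonneg (sub_nonneg.2 (Real.sin_le hx))]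
    rcases le_total x 1 with h | h
    · rcases hx.eq_or_lt with rfl | hx
      · simp
      have := Real.sin_gt_sub_cube hx
      nlinarith [mul_pos hx hx]
    · nlinarith [Real.neg_one_le_sin x]
  rcases le_total 0 x with h | h
  · exact key x h
  · have := key (-x) (by linarith)
    rw [Real.sin_neg, neg_sq, ← abs_neg] at this
    convert this using 2
    ring

/-- By periodicity only `e` matters, and `2 (2πe)² / (2π) = 4π e² ≤ 13 e²`. -/
theorem abs_smoothRound_sub_le (m : ℕ) (e : ℝ) : |smoothRound (m + e) - m| ≤ 13 * e ^ 2 := by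
  have hπ := Real.pi_pos
  have h := abs_sub_sin_le (2 * Real.pi * e)
  have e1 : smoothRound (m + e) - m =
      (2 * Real.pi * e - Real.sin (2 * Real.pi * e)) / (2 * Real.pi) := by
    have : 2 * Real.pi * (m + e) = 2 * Real.pi * e + m * (2 * Real.pi) := by ring
    rw [smoothRound, this, Real.sin_add_nat_mul_two_pi]
    field_simp
    ring
  rw [e1, abs_div, abs_of_pos (by positivity : (0 : ℝ) < 2 * Real.pi),
    div_le_iff₀ (by positivity)]
  have := Real.pi_lt_d2
  nlinarith [mul_nonneg hπ.le (sq_nonneg e)]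

theorem smoothRound_natCast (m : ℕ) : smoothRound m = m := by
  have := abs_smoothRound_sub_le m 0
  rw [add_zero] at this
  exact sub_eq_zero.1 (abs_nonpos_iff.1 (by simpa using this))

theorem abs_smoothRound_le (z : ℝ) : |smoothRound z| ≤ 1 + |z| := by
  have hπ := Real.pi_gt_three
  rw [smoothRound]
  refine (abs_sub _ _).trans ?_
  rw [abs_div, abs_of_pos (by positivity : (0 : ℝ) < 2 * Real.pi), add_comm]
  gcongr
  rw [div_le_one (by positivity)]
  linarith [Real.abs_sin_le_one (2 * Real.pi * z)]

/-- The maps that are given by flat polynomials in the residue have flat orbits, with a constant that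
does not depend on the orbit. -/
theorem exists_flatOrbit {M : ℕ} {T H : Polynomial ℚ} (hT : IsFlat M T) (hH : IsFlat M H) :
    ∃ C : ℕ, (1 ≤ C ∧ (∀ z, |relayMap M T z| ≤ C * (1 + |z|)) ∧ ∀ z, |residueMap M H z| ≤ C) ∧
      ∀ n : ℕ → ℕ, (∀ k, (n (k + 1) : ℝ) = n k * residueMap M T (n k)) →
        (∀ k, residueMap M H (n k) = 0 ∨ residueMap M H (n k) = 1) →
        (∀ k, residueMap M H (n k) = 1 → n (k + 1) = n k) →
        FlatOrbit C (relayMap M T) (residueMap M H) n := by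
  obtain ⟨A, hA0, hA⟩ := hT
  obtain ⟨B, hB0, hB⟩ := hH
  obtain ⟨a, ha0, ha⟩ := exists_abs_residueMap_le M T
  obtain ⟨b, hb0, hb⟩ := exists_abs_residueMap_le M H
  obtain ⟨C, hC⟩ := exists_nat_ge (13 * a + A + B + b + 1)
  have h1 : 1 ≤ C := by
    have : (1 : ℝ) ≤ C := by linarith
    exact_mod_cast this
  have hbound : ∀ z, |relayMap M T z| ≤ C * (1 + |z|) := by
    intro z
    rw [relayMap, abs_mul, mul_comm]
    exact mul_le_mul ((ha z).trans (by linarith)) (abs_smoothRound_le z) (abs_nonneg _)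
      (Nat.cast_nonneg _)
  have hboundH : ∀ z, |residueMap M H z| ≤ C := fun z => (hb z).trans (by linarith)
  refine ⟨C, ⟨h1, hbound, hboundH⟩, fun n hn hhalt hstay => ⟨h1, hbound, hboundH, ?_, ?_, ?_, ?_,
    hhalt, hstay⟩⟩
  · intro m e _
    have e1 : relayMap M T (m + e) - relayMap M T m =
        (smoothRound (m + e) - m) * residueMap M T (m + e) +
          m * (residueMap M T (m + e) - residueMap M T m) := by
      simp only [relayMap, residueMap, smoothRound_natCast]
      ring
    have hm : (0 : ℝ) ≤ m := Nat.cast_nonneg m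
    rw [e1, abs_of_nonneg hm]
    refine (abs_add_le _ _).trans ?_
    rw [abs_mul, abs_mul, abs_of_nonneg hm]
    calc |smoothRound (m + e) - m| * |residueMap M T (m + e)| +
          m * |residueMap M T (m + e) - residueMap M T m|
        ≤ 13 * e ^ 2 * a + m * (A * e ^ 2) := by
          gcongr
          · exact abs_smoothRound_sub_le m e
          · exact ha _
          · exact hA m e
      _ ≤ (13 * a + A) * (1 + m) * e ^ 2 := by
          nlinarith [sq_nonneg e, mul_nonneg hA0 (sq_nonneg e),
            mul_nonneg (mul_nonneg hm ha0) (sq_nonneg e)]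
      _ ≤ _ := by gcongr; linarith
  · intro m e _
    refine (hB m e).trans ?_
    gcongr
    linarith
  · intro k
    rw [hn, relayMap, smoothRound_natCast]
    rfl
  · intro k
    have h2 : (n (k + 1) : ℝ) ≤ C * n k := by
      rw [hn, mul_comm]
      gcongr
      exact (le_abs_self _).trans ((ha _).trans (by linarith))
    exact_mod_cast h2

end

/-! ### Counter machines as residue-dependent multiplication -/

noncomputable section

/-- An instruction of a counter machine: increment a register; decrement a register, or jump if it is
zero; jump. -/
inductive Instr : Type
  | inc (r : ℕ)
  | test (r l : ℕ)
  | goto (l : ℕ)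

/-- The execution of an instruction; a configuration consists of the program counter and the
contents of the registers. -/
def Instr.exec : Instr → ℕ × (ℕ → ℕ) → ℕ × (ℕ → ℕ)
  | inc r, c => (c.1 + 1, Function.update c.2 r (c.2 r + 1))
  | test r l, c => if c.2 r = 0 then (l, c.2) else (c.1 + 1, Function.update c.2 r (c.2 r - 1))
  | goto l, c => (l, c.2)

/-- One step of a counter machine; it halts when the program counter leaves the code. -/
def codeStep (code : List Instr) (c : ℕ × (ℕ → ℕ)) : ℕ × (ℕ → ℕ) :=
  (code[c.1]?).elim c fun i => i.exec c

/-- The `i`-th prime. -/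
def nthPrime (i : ℕ) : ℕ := Nat.nth Nat.Prime i

theorem prime_nthPrime (i : ℕ) : (nthPrime i).Prime := Nat.prime_nth_prime i

theorem nthPrime_ne_zero (i : ℕ) : nthPrime i ≠ 0 := (prime_nthPrime i).ne_zero

theorem nthPrime_dvd_nthPrime {i j : ℕ} : nthPrime i ∣ nthPrime j ↔ i = j := by
  rw [Nat.prime_dvd_prime_iff_eq (prime_nthPrime i) (prime_nthPrime j)]
  exact (Nat.nth_injective Nat.infinite_setOfPred_prime).eq_iff

/-- The product of the powers of primes whose exponents are the contents of the registers. -/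
def regCode (R : ℕ) (g : ℕ → ℕ) : ℕ := ∏ i ∈ Finset.range R, nthPrime i ^ g i

/-- The number that represents a configuration. -/
def confCode (R : ℕ) (c : ℕ × (ℕ → ℕ)) : ℕ := nthPrime (R + c.1) * regCode R c.2

theorem nthPrime_dvd_regCode {R : ℕ} {g : ℕ → ℕ} {j : ℕ} :
    nthPrime j ∣ regCode R g ↔ j < R ∧ g j ≠ 0 := by
  rw [regCode, (prime_nthPrime j).prime.dvd_finsetProd_iff]
  constructor
  · rintro ⟨i, hi, h⟩
    have h1 := (prime_nthPrime j).dvd_of_dvd_pow h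
    rw [nthPrime_dvd_nthPrime] at h1
    subst h1
    refine ⟨Finset.mem_range.1 hi, fun h0 => ?_⟩
    rw [h0, pow_zero] at h
    exact (prime_nthPrime j).one_lt.ne' (Nat.dvd_one.1 h)
  · rintro ⟨h, h0⟩
    exact ⟨j, Finset.mem_range.2 h, dvd_pow_self _ h0⟩

theorem nthPrime_dvd_confCode_of_lt {R : ℕ} {c : ℕ × (ℕ → ℕ)} {j : ℕ} (hj : j < R) :
    nthPrime j ∣ confCode R c ↔ c.2 j ≠ 0 := by
  rw [confCode, (prime_nthPrime j).dvd_mul, nthPrime_dvd_nthPrime, nthPrime_dvd_regCode]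
  constructor
  · rintro (h | h)
    · omega
    · exact h.2
  · exact fun h => Or.inr ⟨hj, h⟩

theorem nthPrime_add_dvd_confCode {R : ℕ} {c : ℕ × (ℕ → ℕ)} {q : ℕ} :
    nthPrime (R + q) ∣ confCode R c ↔ q = c.1 := by
  rw [confCode, (prime_nthPrime _).dvd_mul, nthPrime_dvd_nthPrime, nthPrime_dvd_regCode]
  omega

theorem regCode_update_succ {R r : ℕ} (g : ℕ → ℕ) (hr : r < R) :
    regCode R (Function.update g r (g r + 1)) = nthPrime r * regCode R g := by
  have hm := Finset.mem_range.2 hr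
  rw [regCode, regCode, ← Finset.mul_prod_erase _ _ hm, ← Finset.mul_prod_erase _ _ hm,
    Function.update_self, pow_succ', mul_assoc]
  congr 2
  refine Finset.prod_congr rfl fun i hi => ?_
  rw [Function.update_of_ne (Finset.ne_of_mem_erase hi)]

namespace Instr

/-- The register of the instruction is below `b`, and so is the target of the jump. -/
def Below (b : ℕ) : Instr → Prop
  | inc r => r < b
  | test r l => r < b ∧ l < b
  | goto l => l < b

/-- The multiplier of the instruction at position `q`, as a polynomial in the residue. -/
def poly (M R q : ℕ) : Instr → Polynomial ℚ
  | inc r => Polynomial.C ((nthPrime r : ℚ) * nthPrime (R + (q + 1)) / nthPrime (R + q))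
  | test r l => flatDivisorPoly M (nthPrime r) *
        Polynomial.C ((nthPrime (R + (q + 1)) : ℚ) / (nthPrime r * nthPrime (R + q))) +
      (Polynomial.C 1 + Polynomial.C (-1) * flatDivisorPoly M (nthPrime r)) *
        Polynomial.C ((nthPrime (R + l) : ℚ) / nthPrime (R + q))
  | goto l => Polynomial.C ((nthPrime (R + l) : ℚ) / nthPrime (R + q))

theorem isFlat_poly {M R : ℕ} (hM : M ≠ 0) (hR : ∀ r < R, nthPrime r ∣ M) (q : ℕ) {i : Instr}
    (hi : i.Below R) : IsFlat M (i.poly M R q) := by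
  cases i with
  | inc r => exact IsFlat.const _
  | goto l => exact IsFlat.const _
  | test r l =>
    have := isFlat_flatDivisorPoly hM (hR r hi.1)
    exact (this.mul (IsFlat.const _)).add
      (((IsFlat.const _).add ((IsFlat.const _).mul this)).mul (IsFlat.const _))

/-- Changing a register multiplies or divides by its prime, and moving the program counter replaces
one marker prime by another. The zero test asks whether the prime of the register divides the code,
which is visible in the residue modulo `M`. -/
theorem confCode_exec {M R : ℕ} (hM : M ≠ 0) (hR : ∀ r < R, nthPrime r ∣ M) {i : Instr}
    (hi : i.Below R) (c : ℕ × (ℕ → ℕ)) :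
    (confCode R (i.exec c) : ℝ) = confCode R c * residueMap M (i.poly M R c.1) (confCode R c) := by
  have h0 : ∀ i, (nthPrime i : ℝ) ≠ 0 := fun i => by exact_mod_cast nthPrime_ne_zero i
  have hC : ∀ (a : ℚ) z, residueMap M (Polynomial.C a) z = a := fun a z => by simp [residueMap]
  cases i with
  | inc r =>
    rw [poly, hC, exec, confCode, confCode, regCode_update_succ _ hi]
    push_cast
    field_simp [h0]
  | goto l =>
    rw [poly, hC, exec, confCode, confCode]
    push_cast
    field_simp [h0]
  | test r l =>
    have hr := residueMap_flatDivisorPoly_natCast hM (hR r hi.1) (confCode R c)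
    simp only [nthPrime_dvd_confCode_of_lt hi.1] at hr
    have e : residueMap M ((test r l).poly M R c.1) (confCode R c) =
        residueMap M (flatDivisorPoly M (nthPrime r)) (confCode R c) *
          ((nthPrime (R + (c.1 + 1)) : ℝ) / (nthPrime r * nthPrime (R + c.1))) +
        (1 - residueMap M (flatDivisorPoly M (nthPrime r)) (confCode R c)) *
          ((nthPrime (R + l) : ℝ) / nthPrime (R + c.1)) := by
      simp only [residueMap, poly, map_add, map_mul, Polynomial.aeval_C, eq_ratCast]
      push_cast
      ring
    rw [e, hr, exec]
    by_cases h : c.2 r = 0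
    · simp only [h, if_true, ne_eq, not_true_eq_false, if_false, confCode]
      push_cast
      field_simp [h0]
      ring
    · simp only [h, if_false, ne_eq, not_false_eq_true, if_true, confCode]
      have e2 : regCode R c.2 =
          nthPrime r * regCode R (Function.update c.2 r (c.2 r - 1)) := by
        rw [← regCode_update_succ _ hi.1, Function.update_self, Function.update_idem,
          Nat.sub_add_cancel (Nat.one_le_iff_ne_zero.2 h), Function.update_eq_self]
      rw [e2]
      push_cast
      field_simp [h0]
      ring

theorem exists_below (code : List Instr) : ∃ b, ∀ i ∈ code, i.Below b := by
  induction code with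
  | nil => exact ⟨0, by simp⟩
  | cons i l ih =>
    obtain ⟨b, hb⟩ := ih
    have hmono : ∀ (i : Instr) (b b' : ℕ), b ≤ b' → i.Below b → i.Below b' := by
      intro i b b' h hi
      cases i with
      | inc r => exact lt_of_lt_of_le hi h
      | goto r => exact lt_of_lt_of_le hi h
      | test r l => exact ⟨hi.1.trans_le h, hi.2.trans_le h⟩
    have hi : ∃ b, i.Below b := by
      cases i with
      | inc r => exact ⟨r + 1, Nat.lt_succ_self r⟩
      | goto r => exact ⟨r + 1, Nat.lt_succ_self r⟩
      | test r l => exact ⟨max r l + 1, by simp [Below]⟩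
    obtain ⟨b', hb'⟩ := hi
    refine ⟨max b b', fun j hj => ?_⟩
    rcases List.mem_cons.1 hj with rfl | hj
    · exact hmono _ _ _ (le_max_right _ _) hb'
    · exact hmono _ _ _ (le_max_left _ _) (hb j hj)

end Instr

/-- The multiplier of the map on the codes of the configurations. -/
def codePoly (M R : ℕ) (code : List Instr) : Polynomial ℚ :=
  ∑ q ∈ Finset.range R, flatDivisorPoly M (nthPrime (R + q)) *
    (code[q]?).elim (Polynomial.C 1) (Instr.poly M R q)

theorem isFlat_codePoly {M R : ℕ} (hM : M ≠ 0) (hR : ∀ i < R + R, nthPrime i ∣ M)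
    {code : List Instr} (hcode : ∀ i ∈ code, i.Below R) : IsFlat M (codePoly M R code) := by
  refine IsFlat.sum _ fun q hq => ?_
  refine (isFlat_flatDivisorPoly hM (hR _ (by have := Finset.mem_range.1 hq; omega))).mul ?_
  rcases h : code[q]? with _ | i
  · exact IsFlat.const _
  · exact Instr.isFlat_poly hM (fun r hr => hR r (by omega)) q
      (hcode i (List.mem_of_getElem? h))

/-- Exactly one marker prime divides the code of a configuration, so the sum in `codePoly` reduces
to the multiplier of the current instruction. -/
theorem confCode_codeStep {M R : ℕ} (hM : M ≠ 0) (hR : ∀ i < R + R, nthPrime i ∣ M)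
    {code : List Instr} (hcode : ∀ i ∈ code, i.Below R) {c : ℕ × (ℕ → ℕ)} (hc : c.1 < R) :
    (confCode R (codeStep code c) : ℝ) =
      confCode R c * residueMap M (codePoly M R code) (confCode R c) := by
  have e : residueMap M (codePoly M R code) (confCode R c) =
      residueMap M ((code[c.1]?).elim (Polynomial.C 1) (Instr.poly M R c.1)) (confCode R c) := by
    have h1 : residueMap M (codePoly M R code) (confCode R c) = ∑ q ∈ Finset.range R,
        residueMap M (flatDivisorPoly M (nthPrime (R + q))) (confCode R c) *
        residueMap M ((code[q]?).elim (Polynomial.C 1) (Instr.poly M R q)) (confCode R c) := by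
      simp only [residueMap, codePoly, map_sum, map_mul]
    rw [h1, Finset.sum_eq_single c.1]
    · rw [residueMap_flatDivisorPoly_natCast hM (hR _ (by omega)),
        if_pos (nthPrime_add_dvd_confCode.2 rfl), one_mul]
    · intro q hq hne
      have := Finset.mem_range.1 hq
      rw [residueMap_flatDivisorPoly_natCast hM (hR _ (by omega)),
        if_neg (fun h => hne (nthPrime_add_dvd_confCode.1 h)), zero_mul]
    · intro h
      exact absurd (Finset.mem_range.2 hc) h
  rw [e, codeStep]
  rcases h : code[c.1]? with _ | i
  · simp [residueMap]
  · exact Instr.confCode_exec hM (fun r hr => hR r (by omega)) (hcode i (List.mem_of_getElem? h)) c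

theorem codeStep_fst_lt {R : ℕ} {code : List Instr} (hcode : ∀ i ∈ code, i.Below R)
    (hlen : code.length < R) {c : ℕ × (ℕ → ℕ)} (hc : c.1 < R) : (codeStep code c).1 < R := by
  rw [codeStep]
  rcases h : code[c.1]? with _ | i
  · exact hc
  · obtain ⟨h1, -⟩ := List.getElem?_eq_some_iff.1 h
    have hi := hcode i (List.mem_of_getElem? h)
    cases i with
    | inc r => simp only [Option.elim_some, Instr.exec]; omega
    | goto l => exact hi
    | test r l =>
      simp only [Option.elim_some, Instr.exec]
      split_ifs
      · exact hi.2
      · simp only; omega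

theorem tendsto_log_cosh : Filter.Tendsto (fun τ => Real.log (Real.cosh τ)) Filter.atTop
    Filter.atTop := by
  refine Filter.tendsto_atTop_mono (f := fun τ => τ - Real.log 2) (fun τ => ?_)
    (Filter.tendsto_atTop_add_const_right _ _ Filter.tendsto_id)
  have h : Real.exp τ / 2 ≤ Real.cosh τ := by
    rw [Real.cosh_eq]
    linarith [Real.exp_pos (-τ)]
  have := Real.log_le_log (by positivity) h
  rwa [Real.log_div (Real.exp_pos τ).ne' two_ne_zero, Real.log_exp] at this

/-- A counter machine is simulated by a polynomial vector field. -/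
theorem exists_relayField_of_code (code : List Instr) :
    ∃ (M C R : ℕ) (T H : Polynomial ℚ), 2 ≤ R ∧ ∀ g : ℕ → ℕ, ∃ γ : ℝ → E 17,
      γ 0 = WithLp.toLp 2 ![(confCode R (0, g) : ℝ), 0, 0, 0, 1, (2 * Real.pi / M) ^ 2,
        ((3840 * C ^ 5 * (confCode R (0, g) + 1) ^ 2 : ℕ) : ℝ), 0, 1, 1, 1, 0, 0, 0, 0, 0, 0] ∧
      (∀ τ, HasDerivAt γ ((relayField M (C ^ 2) T H).val (γ τ)) τ) ∧
      (∀ τ, 1 / 2 < γ τ 2 → ∃ k, ((codeStep code)^[k] (0, g)).1 = code.length ∧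
        |γ τ 1 - confCode R ((codeStep code)^[k] (0, g))| < 1 / 4) ∧
      ∀ k, ((codeStep code)^[k] (0, g)).1 = code.length → ∀ᶠ τ in Filter.atTop,
        1 / 2 < γ τ 2 ∧ γ τ 2 < 2 ∧ |γ τ 1 - confCode R ((codeStep code)^[k] (0, g))| < 1 / 4 := by
  -- The additional jump forces `code.length + 1 < b`, so the halting position has a marker prime
  -- too, and `2 ≤ b` leaves room for the two main registers.
  obtain ⟨b, hb⟩ := Instr.exists_below (Instr.goto (code.length + 1) :: code)
  have hlen : code.length + 1 < b := hb _ List.mem_cons_self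
  have hcode : ∀ i ∈ code, i.Below b := fun i hi => hb i (List.mem_cons_of_mem _ hi)
  set M := ∏ i ∈ Finset.range (b + b), nthPrime i with hMd
  have hM : M ≠ 0 := Finset.prod_ne_zero_iff.2 fun i _ => nthPrime_ne_zero i
  have hMp : ∀ i < b + b, nthPrime i ∣ M := fun i hi =>
    Finset.dvd_prod_of_mem _ (Finset.mem_range.2 hi)
  set T := codePoly M b code
  set H := flatDivisorPoly M (nthPrime (b + code.length))
  have hH := isFlat_flatDivisorPoly hM (hMp (b + code.length) (by omega))
  obtain ⟨C, ⟨hC1, hCT, hCH⟩, horb⟩ := exists_flatOrbit (isFlat_codePoly hM hMp hcode) hH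
  refine ⟨M, C, b, T, H, by omega, fun g => ?_⟩
  set c : ℕ → ℕ × (ℕ → ℕ) := fun k => (codeStep code)^[k] (0, g) with hcd
  have hcs : ∀ k, c (k + 1) = codeStep code (c k) := fun k => Function.iterate_succ_apply' _ _ _
  have hlt : ∀ k, (c k).1 < b := by
    intro k
    induction k with
    | zero => simp only [hcd, Function.iterate_zero, id_eq]; omega
    | succ k ih => rw [hcs]; exact codeStep_fst_lt hcode (by omega) ih
  have hHk : ∀ k, residueMap M H (confCode b (c k)) =
      if code.length = (c k).1 then 1 else 0 := fun k => by
    rw [residueMap_flatDivisorPoly_natCast hM (hMp _ (by omega))]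
    simp only [nthPrime_add_dvd_confCode]
  have hO := horb (fun k => confCode b (c k))
    (fun k => by rw [hcs]; exact confCode_codeStep hM hMp hcode (hlt k))
    (fun k => by rw [hHk]; split_ifs <;> simp)
    (fun k hk => by
      rw [hHk] at hk
      have : code.length = (c k).1 := by
        by_contra h
        simp [h] at hk
      rw [hcs, codeStep, ← this]
      simp)
  obtain ⟨x, y, h, hR, hx0, hy0, hh0⟩ := exists_isRelay (contDiff_relayMap M T)
    (contDiff_residueMap M H) (A := FlatOrbit.exponent C fun k => confCode b (c k))
    (by unfold FlatOrbit.exponent; fun_prop) hCT hCH (confCode b (c 0))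
  obtain ⟨hr1, hr2⟩ := hO.relay hR hx0 hy0 hh0
  obtain ⟨γ, hγ0, hγ, hγ'⟩ := IsRelay.exists_integralCurve (κ := C ^ 2) hM
    (A₀ := ((3840 * C ^ 5 * (confCode b (c 0) + 1) ^ 2 : ℕ) : ℝ)) hR hy0 hh0
  refine ⟨γ, ?_, hγ, fun τ hτ => ?_, fun k hk => ?_⟩
  · rw [hγ0, hx0]
    rfl
  · rw [(hγ' τ).2] at hτ
    obtain ⟨k, hk, hk'⟩ := hr1 _ (Real.log_nonneg (Real.one_le_cosh τ)) hτ
    refine ⟨k, ?_, by rw [(hγ' τ).1]; exact hk'⟩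
    rw [hHk] at hk
    by_contra h
    rw [if_neg (Ne.symm h)] at hk
    simp at hk
  · have := hr2 k (by rw [hHk, if_pos hk.symm])
    filter_upwards [tendsto_log_cosh.eventually this] with τ hτ
    rw [(hγ' τ).1, (hγ' τ).2]
    exact hτ

end

/-! ### Structured programs for primitive recursive functions -/

noncomputable section

/-- Structured programs for counter machines; `loop r a` repeats to decrement `r` and to run `a` until
`r` is zero. -/
inductive Prog : Type
  | skip
  | inc (r : ℕ)
  | seq (a b : Prog)
  | loop (r : ℕ) (a : Prog)

namespace Prog

/-- The program, started with the registers `g`, terminates with the registers `g'`. -/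
inductive Run : Prog → (ℕ → ℕ) → (ℕ → ℕ) → Prop
  | skip (g) : Run skip g g
  | inc (r g) : Run (inc r) g (Function.update g r (g r + 1))
  | seq {a b g g' g''} : Run a g g' → Run b g' g'' → Run (seq a b) g g''
  | loop_zero {r a g} : g r = 0 → Run (loop r a) g g
  | loop_succ {r a g g' g''} : g r ≠ 0 → Run a (Function.update g r (g r - 1)) g' →
      Run (loop r a) g' g'' → Run (loop r a) g g''

/-- The code of a program, placed at the position `s`. -/
def compile : Prog → ℕ → List Instr
  | skip, _ => []
  | inc r, _ => [Instr.inc r]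
  | seq a b, s => a.compile s ++ b.compile (s + (a.compile s).length)
  | loop r a, s => Instr.test r (s + (a.compile (s + 1)).length + 2) ::
      (a.compile (s + 1) ++ [Instr.goto s])

/-- The program is compiled into the code at the position `s`. -/
def PlacedAt (p : Prog) (code : List Instr) (s : ℕ) : Prop :=
  ∃ l₁ l₂, code = l₁ ++ p.compile s ++ l₂ ∧ l₁.length = s

theorem codeStep_append {l₁ l₂ : List Instr} {i : Instr} {s : ℕ} (h : l₁.length = s) (g : ℕ → ℕ) :
    codeStep (l₁ ++ i :: l₂) (s, g) = i.exec (s, g) := by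
  subst h
  simp [codeStep]

/-- The machine gets from the configuration `c` to `c'`. -/
def Reaches (code : List Instr) (c c' : ℕ × (ℕ → ℕ)) : Prop := ∃ k, (codeStep code)^[k] c = c'

theorem Reaches.refl {code : List Instr} (c : ℕ × (ℕ → ℕ)) : Reaches code c c := ⟨0, rfl⟩

theorem Reaches.trans {code : List Instr} {c c' c'' : ℕ × (ℕ → ℕ)} (h : Reaches code c c')
    (h' : Reaches code c' c'') : Reaches code c c'' := by
  obtain ⟨k, rfl⟩ := h
  obtain ⟨k', rfl⟩ := h'
  exact ⟨k' + k, Function.iterate_add_apply _ _ _ _⟩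

theorem Reaches.head {code : List Instr} {c c' : ℕ × (ℕ → ℕ)}
    (h : Reaches code (codeStep code c) c') : Reaches code c c' :=
  Reaches.trans ⟨1, rfl⟩ h

/-- The code of a loop, with the body placed in it. -/
theorem PlacedAt.loop {r : ℕ} {a : Prog} {code : List Instr} {s : ℕ}
    (h : (loop r a).PlacedAt code s) : a.PlacedAt code (s + 1) ∧
      (∀ g : ℕ → ℕ, codeStep code (s, g) =
        (Instr.test r (s + (a.compile (s + 1)).length + 2)).exec (s, g)) ∧
      ∀ g : ℕ → ℕ, codeStep code (s + 1 + (a.compile (s + 1)).length, g) = (s, g) := by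
  obtain ⟨l₁, l₂, rfl, hs⟩ := h
  refine ⟨⟨l₁ ++ [Instr.test r (s + (a.compile (s + 1)).length + 2)], Instr.goto s :: l₂,
    by simp [compile], by simp [hs]⟩, fun g => ?_, fun g => ?_⟩
  · rw [compile, List.append_assoc, List.cons_append, codeStep_append hs]
  · have e : l₁ ++ (Prog.loop r a).compile s ++ l₂ =
        (l₁ ++ Instr.test r (s + (a.compile (s + 1)).length + 2) :: a.compile (s + 1)) ++
          Instr.goto s :: l₂ := by
      simp [compile]
    rw [e, codeStep_append (by simp [hs]; omega)]
    rfl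

theorem length_compile_loop (r : ℕ) (a : Prog) (s : ℕ) :
    ((loop r a).compile s).length = (a.compile (s + 1)).length + 2 := by
  simp [compile]

theorem Run.reaches {p : Prog} {g g' : ℕ → ℕ} (h : p.Run g g') {code : List Instr} {s : ℕ}
    (hp : p.PlacedAt code s) : Reaches code (s, g) (s + (p.compile s).length, g') := by
  induction h generalizing s with
  | skip g => exact Reaches.refl _
  | inc r g =>
    obtain ⟨l₁, l₂, rfl, hs⟩ := hp
    refine Reaches.head ?_
    rw [compile, List.append_assoc, List.singleton_append, codeStep_append hs]
    exact Reaches.refl _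
  | @seq a b g g' g'' _ _ iha ihb =>
    obtain ⟨l₁, l₂, rfl, hs⟩ := hp
    refine (iha ⟨l₁, b.compile (s + (a.compile s).length) ++ l₂, by simp [compile], hs⟩).trans ?_
    have := ihb (s := s + (a.compile s).length)
      ⟨l₁ ++ a.compile s, l₂, by simp [compile], by simp [hs]⟩
    rw [compile, List.length_append, ← add_assoc]
    exact this
  | @loop_zero r a g h0 =>
    refine Reaches.head ?_
    rw [hp.loop.2.1, Instr.exec, if_pos h0, length_compile_loop, ← add_assoc]
    exact Reaches.refl _
  | @loop_succ r a g g' g'' h0 _ _ iha ihl =>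
    obtain ⟨ha, h1, h2⟩ := hp.loop
    refine Reaches.head ?_
    rw [h1, Instr.exec, if_neg h0]
    refine (iha ha).trans (Reaches.head ?_)
    rw [h2]
    exact ihl hp

/-- The loop rule with an explicit invariant: `S j` is the state with `j` rounds left, and the body
starts from `S (j + 1)` with `r` already decremented. -/
theorem Run.loop_iterate {r : ℕ} {a : Prog} (S : ℕ → ℕ → ℕ) (hS : ∀ j, S j r = j) (k : ℕ)
    (h : ∀ j < k, a.Run (Function.update (S (j + 1)) r j) (S j)) : (loop r a).Run (S k) (S 0) := by
  induction k with
  | zero => exact Run.loop_zero (hS 0)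
  | succ k ih =>
    refine Run.loop_succ (by rw [hS]; omega) ?_ (ih fun j hj => h j (by omega))
    rw [hS]
    exact h k (Nat.lt_succ_self k)

theorem Run.congr {p : Prog} {g g₁ g₂ : ℕ → ℕ} (h : p.Run g g₁) (e : ∀ i, g₁ i = g₂ i) :
    p.Run g g₂ := funext e ▸ h

theorem Run.congr' {p : Prog} {g g' g₁ g₂ : ℕ → ℕ} (h : p.Run g g₁) (e : ∀ i, g i = g' i)
    (e' : ∀ i, g₁ i = g₂ i) : p.Run g' g₂ := funext e ▸ funext e' ▸ h

theorem run_clear (r : ℕ) (g : ℕ → ℕ) : (loop r skip).Run g (Function.update g r 0) := by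
  have := Run.loop_iterate (r := r) (a := skip) (fun j => Function.update g r j)
    (fun j => by simp) (g r) (fun j _ => by simpa using Run.skip _)
  simpa using this

theorem run_move {r c : ℕ} (h : r ≠ c) (g : ℕ → ℕ) : (loop r (inc c)).Run g
    (Function.update (Function.update g c (g c + g r)) r 0) := by
  have := Run.loop_iterate (r := r) (a := inc c)
    (fun j => Function.update (Function.update g c (g c + (g r - j))) r j)
    (fun j => by simp) (g r) (fun j hj => (Run.inc c _).congr fun i => by
      simp only [Function.update_apply]
      split_ifs <;> omega)
  exact this.congr' (fun i => by
    simp only [Function.update_apply]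
    split_ifs with h1 h2 <;> simp [h1]; simp [h2]) (fun i => by simp)

/-- The program that adds the register `a` to `c`, with the help of `t`. -/
def copy (a c t : ℕ) : Prog := seq (loop a (seq (inc t) (inc c))) (loop t (inc a))

theorem run_copy {a c t : ℕ} (hac : a ≠ c) (hat : a ≠ t) (hct : c ≠ t) {g : ℕ → ℕ} (ht : g t = 0) :
    (copy a c t).Run g (Function.update g c (g c + g a)) := by
  have h1 := Run.loop_iterate (r := a) (a := seq (inc t) (inc c))
    (fun j => Function.update (Function.update (Function.update g t (g a - j)) c
      (g c + (g a - j))) a j)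
    (fun j => by simp) (g a) (fun j hj => (Run.seq (Run.inc t _) (Run.inc c _)).congr fun i => by
      simp only [Function.update_apply]
      split_ifs <;> omega)
  refine Run.seq (h1.congr' (g' := g) (fun i => by
    simp only [Function.update_apply]
    split_ifs with h1 h2 h3 <;> simp_all) fun i => rfl) ((run_move hat.symm _).congr fun i => ?_)
  simp only [Function.update_apply]
  split_ifs <;> simp_all

/-- The program `p` computes `f` of the contents of the registers `args` into the register `b`, if all
registers from `b` on are zero at the beginning. -/
def Computes {n : ℕ} (p : Prog) (f : List.Vector ℕ n → ℕ) (b : ℕ) (args : Fin n → ℕ) : Prop :=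
  ∀ g : ℕ → ℕ, (∀ i, b ≤ i → g i = 0) →
    p.Run g (Function.update g b (f (List.Vector.ofFn fun i => g (args i))))

/-- For compositions: the inner values go into consecutive registers from `b` on. The arguments lie
below `b` and survive, and each program finds zeros above its own result register. -/
theorem exists_run_fill {m n : ℕ} {F : Fin m → List.Vector ℕ n → ℕ} {b : ℕ} {args : Fin n → ℕ}
    (hargs : ∀ i, args i < b)
    (H : ∀ j, ∀ b, (∀ i, args i < b) → ∃ p : Prog, p.Computes (F j) b args) (k : ℕ) (hk : k ≤ m) :
    ∃ p : Prog, ∀ g : ℕ → ℕ, (∀ i, b ≤ i → g i = 0) → p.Run g fun i =>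
      if h : b ≤ i ∧ i < b + k then
        F ⟨i - b, by omega⟩ (List.Vector.ofFn fun i => g (args i)) else g i := by
  induction k with
  | zero => exact ⟨skip, fun g _ => (Run.skip g).congr fun i => by rw [dif_neg]; omega⟩
  | succ k ih =>
    obtain ⟨p, hp⟩ := ih (by omega)
    obtain ⟨q, hq⟩ := H ⟨k, hk⟩ (b + k) (fun i => by have := hargs i; omega)
    refine ⟨seq p q, fun g hg => Run.seq (hp g hg) ((hq _ fun i hi => ?_).congr fun i => ?_)⟩
    · rw [dif_neg (by omega)]
      exact hg i (by omega)
    · have e : ∀ j, (if h : b ≤ args j ∧ args j < b + k then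
          F ⟨args j - b, by omega⟩ (List.Vector.ofFn fun i => g (args i)) else g (args j)) =
            g (args j) := fun j => dif_neg (by have := hargs j; omega)
      simp only [e]
      rcases eq_or_ne i (b + k) with rfl | hi
      · rw [Function.update_self, dif_pos (by omega)]
        simp
      · rw [Function.update_of_ne hi]
        by_cases h : b ≤ i ∧ i < b + k
        · rw [dif_pos h, dif_pos (by omega)]
        · rw [dif_neg h, dif_neg (by omega)]

theorem exists_run_clear (b k : ℕ) : ∃ p : Prog, ∀ g : ℕ → ℕ,
    p.Run g fun i => if b ≤ i ∧ i < b + k then 0 else g i := by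
  induction k with
  | zero => exact ⟨skip, fun g => (Run.skip g).congr fun i => by rw [if_neg]; omega⟩
  | succ k ih =>
    obtain ⟨p, hp⟩ := ih
    refine ⟨seq p (loop (b + k) skip), fun g => Run.seq (hp g) ((run_clear _ _).congr fun i => ?_)⟩
    simp only [Function.update_apply]
    split_ifs <;> first | rfl | omega

theorem exists_computes {n : ℕ} {f : List.Vector ℕ n → ℕ} (hf : Nat.Primrec' f) :
    ∀ (b : ℕ) (args : Fin n → ℕ), (∀ i, args i < b) → ∃ p : Prog, p.Computes f b args := by
  induction hf with
  | zero =>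
    exact fun b args _ => ⟨skip, fun g hg => (Run.skip g).congr fun i => by
      simp only [Function.update_apply]
      split_ifs with h
      · rw [h]; exact hg b le_rfl
      · rfl⟩
  | succ =>
    intro b args hargs
    have h0 := hargs 0
    refine ⟨seq (copy (args 0) b (b + 1)) (inc b), fun g hg =>
      (Run.seq (run_copy (by omega) (by omega) (by omega) (hg (b + 1) (by omega)))
        (Run.inc b _)).congr fun i => ?_⟩
    simp only [Function.update_apply, hg b le_rfl]
    split_ifs <;> simp
  | get j =>
    intro b args hargs
    have h0 := hargs j
    refine ⟨copy (args j) b (b + 1), fun g hg =>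
      (run_copy (by omega) (by omega) (by omega) (hg (b + 1) (by omega))).congr fun i => ?_⟩
    simp [hg b le_rfl]
  | @comp m n f F _ _ ihf ihF =>
    intro b args hargs
    have h1 : ∀ i, args i < b + 1 := fun i => by have := hargs i; omega
    obtain ⟨p, hp⟩ := exists_run_fill (F := F) h1 (fun j b => ihF j b args) _ le_rfl
    obtain ⟨q, hq⟩ := ihf (b + 1 + n) (fun j => b + 1 + j) (fun j => by have := j.2; omega)
    obtain ⟨c, hc⟩ := exists_run_clear (b + 1) n
    -- Register `b` is kept for the result. The inner values occupy `b + 1, …, b + n`, the outer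
    -- value is computed in `b + 1 + n` and moved to `b`, and the work registers are zero again.
    refine ⟨seq (seq p q) (seq c (loop (b + 1 + n) (inc b))), fun g hg =>
      (Run.seq (Run.seq (hp g fun i hi => hg i (by omega)) (hq _ fun i hi => ?_))
        (Run.seq (hc _) (run_move (by omega) _))).congr fun i => ?_⟩
    · rw [dif_neg (by omega)]
      exact hg i (by omega)
    · have e1 : ∀ j, (if h : b + 1 ≤ args j ∧ args j < b + 1 + n then
          F ⟨args j - (b + 1), by omega⟩ (List.Vector.ofFn fun i => g (args i)) else g (args j)) =
            g (args j) := fun j => dif_neg (by have := hargs j; omega)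
      have e2 : ∀ j : Fin n, (if h : b + 1 ≤ b + 1 + (j : ℕ) ∧ b + 1 + (j : ℕ) < b + 1 + n then
          F ⟨b + 1 + j - (b + 1), by omega⟩ (List.Vector.ofFn fun i => g (args i))
            else g (b + 1 + j)) = F j (List.Vector.ofFn fun i => g (args i)) := fun j => by
        rw [dif_pos (by omega)]
        congr 1
        simp
      simp only [e2]
      have hb := hg b le_rfl
      rcases eq_or_ne i b with rfl | hib
      · have h1 : ¬ (i + 1 ≤ i ∧ i < i + 1 + n) := by omega
        have h2 : ¬ (i + 1 ≤ i + 1 + n ∧ i + 1 + n < i + 1 + n) := by omega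
        have h3 : i ≠ i + 1 + n := by omega
        simp [h3, hb]
      · rw [Function.update_of_ne hib]
        rcases eq_or_ne i (b + 1 + n) with rfl | hi
        · rw [Function.update_self]
          exact (hg _ (by omega)).symm
        · rw [Function.update_of_ne hi, Function.update_of_ne hib, Function.update_of_ne hi]
          split_ifs with h
          · exact (hg _ (by omega)).symm
          · rfl
  | @prec n f F _ _ ihf ihF =>
    intro b args hargs
    have ha0 := hargs 0
    obtain ⟨p, hp⟩ := ihf (b + 3) (fun i => args i.succ)
      (fun i => by have := hargs i.succ; omega)
    obtain ⟨q, hq⟩ := ihF (b + 3) (Fin.cons (b + 1) (Fin.cons b fun i => args i.succ)) (by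
      refine Fin.cases (by simp) (Fin.cases (by simp) fun i => ?_)
      have := hargs i.succ
      simp only [Fin.cons_succ]
      omega)
    -- Register `b` holds the current value of the recursion, `b + 1` the number of completed
    -- rounds, `b + 2` the number of remaining rounds, and `b + 3` receives each new value before it
    -- is moved to `b`.
    refine ⟨seq (seq (copy (args 0) (b + 2) (b + 3)) (seq p (loop (b + 3) (inc b))))
      (seq (loop (b + 2) (seq (seq q (loop b skip)) (seq (loop (b + 3) (inc b)) (inc (b + 1)))))
        (loop (b + 1) skip)), fun g hg => ?_⟩
    set w : List.Vector ℕ n := List.Vector.ofFn fun i => g (args i.succ) with hw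
    set N := g (args 0) with hN
    set val : ℕ → ℕ := fun j => Nat.rec (f w) (fun y IH => F (y ::ᵥ IH ::ᵥ w)) j with hval
    have hv : List.Vector.ofFn (fun i => g (args i)) = N ::ᵥ w := rfl
    rw [hv]
    have hb0 := hg b le_rfl
    have hb1 := hg (b + 1) (by omega)
    have hb2 := hg (b + 2) (by omega)
    have hb3 := hg (b + 3) (by omega)
    set S : ℕ → ℕ → ℕ := fun j i => if i = b then val (N - j) else if i = b + 1 then N - j else
      if i = b + 2 then j else g i with hS
    have h1 : (seq (copy (args 0) (b + 2) (b + 3)) (seq p (loop (b + 3) (inc b)))).Run g (S N) := by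
      refine Run.seq (run_copy (by omega) (by omega) (by omega) hb3)
        (Run.seq (hp _ fun i hi => ?_) ((run_move (by omega) _).congr fun i => ?_))
      · rw [Function.update_of_ne (by omega)]
        exact hg i (by omega)
      · have e : ∀ j : Fin n, Function.update g (b + 2) (g (b + 2) + g (args 0)) (args j.succ) =
            g (args j.succ) := fun j => Function.update_of_ne (by have := hargs j.succ; omega) _ _
        simp only [e, ← hw, hS, Function.update_apply]
        split_ifs <;> first | omega | simp_all
    have h2 := Run.loop_iterate (r := b + 2)
      (a := seq (seq q (loop b skip)) (seq (loop (b + 3) (inc b)) (inc (b + 1)))) S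
      (fun j => by simp [hS]) N (fun j hj => by
        refine Run.seq (Run.seq (hq _ fun i hi => ?_) (run_clear _ _))
          (Run.seq (run_move (by omega) _) ((Run.inc _ _).congr fun i => ?_))
        · rw [Function.update_of_ne (by omega)]
          simp only [hS]
          rw [if_neg (by omega), if_neg (by omega), if_neg (by omega)]
          exact hg i (by omega)
        · have e : (List.Vector.ofFn fun i => Function.update (S (j + 1)) (b + 2) j
              ((Fin.cons (b + 1) (Fin.cons b fun i => args i.succ) : Fin (n + 2) → ℕ) i)) =
              (N - (j + 1)) ::ᵥ val (N - (j + 1)) ::ᵥ w := by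
            have e1 : ∀ i : Fin n, Function.update (S (j + 1)) (b + 2) j (args i.succ) =
                g (args i.succ) := fun i => by
              have := hargs i.succ
              rw [Function.update_of_ne (by omega)]
              simp only [hS]
              rw [if_neg (by omega), if_neg (by omega), if_neg (by omega)]
            have e2 : Function.update (S (j + 1)) (b + 2) j (b + 1) = N - (j + 1) := by
              rw [Function.update_of_ne (by omega)]
              simp [hS]
            have e3 : Function.update (S (j + 1)) (b + 2) j b = val (N - (j + 1)) := by
              rw [Function.update_of_ne (by omega)]
              simp [hS]
            simp only [List.Vector.ofFn, Fin.cons_zero, Fin.cons_succ, e1, e2, e3]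
            rfl
          have e4 : F ((N - (j + 1)) ::ᵥ val (N - (j + 1)) ::ᵥ w) = val (N - j) := by
            obtain ⟨d, hd⟩ : ∃ d, N - j = d + 1 := ⟨N - j - 1, by omega⟩
            rw [hd, show N - (j + 1) = d by omega]
          rw [e, e4]
          simp only [hS, Function.update_apply]
          split_ifs <;> first | omega | simp_all)
    refine Run.seq h1 (Run.seq h2 ((run_clear _ _).congr fun i => ?_))
    simp only [hS, Function.update_apply]
    split_ifs <;> first | omega | simp_all

end Prog

end

/-! ### Iterating a primitive recursive function on a counter machine -/

noncomputable section

/-- The registers of the main program: `x` in the first one, and `y` in the second. -/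
def twoRegs (x y : ℕ) (i : ℕ) : ℕ := if i = 0 then x else if i = 1 then y else 0

namespace Prog

theorem exists_run_twoRegs {f : ℕ → ℕ} (hf : Primrec f) :
    (∃ p : Prog, ∀ x y, p.Run (twoRegs x y) (twoRegs (f x) y)) ∧
    ∃ p : Prog, ∀ x y, p.Run (twoRegs x y) (twoRegs x (f x)) := by
  obtain ⟨p, hp⟩ := exists_computes (Nat.Primrec'.prim_iff₁.2 hf) 2 (fun _ => 0) (by simp)
  have h : ∀ x y, p.Run (twoRegs x y) (Function.update (twoRegs x y) 2 (f x)) := fun x y =>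
    hp _ fun i hi => by
      rw [twoRegs, if_neg (by omega), if_neg (by omega)]
  refine ⟨⟨seq p (seq (loop 0 skip) (loop 2 (inc 0))), fun x y => Run.seq (h x y)
      (Run.seq (run_clear _ _) ((run_move (by omega) _).congr fun i => ?_))⟩,
    ⟨seq p (seq (loop 1 skip) (loop 2 (inc 1))), fun x y => Run.seq (h x y)
      (Run.seq (run_clear _ _) ((run_move (by omega) _).congr fun i => ?_))⟩⟩
  · simp only [twoRegs, Function.update_apply]
    split_ifs <;> first | omega | simp_all
  · simp only [twoRegs, Function.update_apply]
    split_ifs <;> omega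

theorem codeStep_iterate_length {code : List Instr} (k : ℕ) (g : ℕ → ℕ) :
    (codeStep code)^[k] (code.length, g) = (code.length, g) := by
  induction k with
  | zero => rfl
  | succ k ih => rw [Function.iterate_succ_apply, show codeStep code (code.length, g) =
      (code.length, g) by simp [codeStep], ih]

/-- A primitive recursive iteration, with a primitive recursive test and a primitive recursive
output, is carried out by a counter machine. -/
theorem exists_code_iterate {G F O : ℕ → ℕ} (hG : Primrec G) (hF : Primrec F) (hO : Primrec O) :
    ∃ code : List Instr, ∀ x : ℕ,
      (∀ k, ((codeStep code)^[k] (0, twoRegs x 1)).1 = code.length → ∃ j, F (G^[j] x) = 0 ∧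
        (codeStep code)^[k] (0, twoRegs x 1) = (code.length, twoRegs (O (G^[j] x)) 0)) ∧
      ∀ j, 0 < j → F (G^[j] x) = 0 → ∃ k,
        ((codeStep code)^[k] (0, twoRegs x 1)).1 = code.length := by
  obtain ⟨pG, hpG⟩ := (exists_run_twoRegs hG).1
  obtain ⟨pF, hpF⟩ := (exists_run_twoRegs hF).2
  obtain ⟨pO, hpO⟩ := (exists_run_twoRegs hO).1
  -- The loop register carries the test value, which the body overwrites in each round. It starts at
  -- `1`, so the iteration is executed at least once; hence the condition `0 < j`.
  set body := seq pG pF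
  set code := (seq (loop 1 body) pO).compile 0 with hcode
  have hbody : ∀ x y, body.Run (twoRegs x y) (twoRegs (G x) (F (G x))) := fun x y =>
    (hpG x y).seq (hpF _ _)
  have hloop : (loop 1 body).PlacedAt code 0 := ⟨[], pO.compile (0 + ((loop 1 body).compile 0).length),
    by simp [hcode, compile], rfl⟩
  have hout : pO.PlacedAt code ((loop 1 body).compile 0).length :=
    ⟨(loop 1 body).compile 0, [], by
      rw [hcode, compile, zero_add, List.append_nil], rfl⟩
  have hlen : code.length = ((loop 1 body).compile 0).length +
      (pO.compile ((loop 1 body).compile 0).length).length := by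
    rw [hcode, compile, List.length_append, zero_add]
  obtain ⟨hb, h1, h2⟩ := hloop.loop
  have hcyc : ∀ x y, y ≠ 0 → ∃ k, 0 < k ∧
      (codeStep code)^[k] (0, twoRegs x y) = (0, twoRegs (G x) (F (G x))) := by
    intro x y hy
    have e : Function.update (twoRegs x y) 1 (y - 1) = twoRegs x (y - 1) := by
      funext i
      simp only [twoRegs, Function.update_apply]
      split_ifs <;> omega
    obtain ⟨k, hk⟩ := (hbody x (y - 1)).reaches hb
    refine ⟨1 + k + 1, by omega, ?_⟩
    have e1 : codeStep code (0, twoRegs x y) = (0 + 1, twoRegs x (y - 1)) := by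
      rw [h1, Instr.exec, ← e]
      exact if_neg hy
    rw [Function.iterate_succ_apply, e1, Function.iterate_add_apply, hk]
    exact h2 _
  have hexit : ∀ x, Reaches code (0, twoRegs x 0) (code.length, twoRegs (O x) 0) := by
    intro x
    have := (Run.loop_zero (a := body) (show twoRegs x 0 1 = 0 from rfl)).reaches hloop
    rw [zero_add] at this
    refine this.trans ?_
    rw [hlen]
    exact (hpO x 0).reaches hout
  have hpos : 0 < code.length := by
    rw [hlen, length_compile_loop]
    omega
  refine ⟨code, fun x => ?_⟩
  -- Every round takes at least one step, so a loop whose test never succeeds is back at position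
  -- `0` at arbitrarily late times and cannot have halted.
  have hmain : ∀ j, (∀ i, 0 < i → i ≤ j → F (G^[i] x) ≠ 0) → ∃ k, j ≤ k ∧ ∃ y, y ≠ 0 ∧
      (codeStep code)^[k] (0, twoRegs x 1) = (0, twoRegs (G^[j] x) y) := by
    intro j
    induction j with
    | zero => exact fun _ => ⟨0, le_rfl, 1, one_ne_zero, rfl⟩
    | succ j ih =>
      intro h
      obtain ⟨k, hk, y, hy, e⟩ := ih fun i hi hij => h i hi (by omega)
      obtain ⟨k', hk', e'⟩ := hcyc (G^[j] x) y hy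
      refine ⟨k' + k, by omega, F (G^[j + 1] x), h (j + 1) (by omega) le_rfl, ?_⟩
      rw [Function.iterate_add_apply, e, e', Function.iterate_succ_apply']
  have hhalt : ∀ j, 0 < j → F (G^[j] x) = 0 → ∃ i, F (G^[i] x) = 0 ∧
      Reaches code (0, twoRegs x 1) (code.length, twoRegs (O (G^[i] x)) 0) := by
    intro j hj0 hj
    classical
    have hex : ∃ j, 0 < j ∧ F (G^[j] x) = 0 := ⟨j, hj0, hj⟩
    obtain ⟨hn0, hn⟩ := Nat.find_spec hex
    obtain ⟨i, hi⟩ : ∃ i, Nat.find hex = i + 1 := ⟨Nat.find hex - 1, by omega⟩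
    rw [hi] at hn
    refine ⟨i + 1, hn, ?_⟩
    obtain ⟨k, -, y, hy, e⟩ := hmain i fun m hm hmi h0 =>
      Nat.find_min hex (show m < Nat.find hex by omega) ⟨hm, h0⟩
    obtain ⟨k', -, e'⟩ := hcyc (G^[i] x) y hy
    refine Reaches.trans ⟨k, e⟩ (Reaches.trans ⟨k', e'⟩ ?_)
    rw [← Function.iterate_succ_apply' G, hn]
    exact hexit _
  refine ⟨fun k hk => ?_, fun j hj0 hj => ?_⟩
  · by_cases hex : ∃ j, 0 < j ∧ F (G^[j] x) = 0
    · obtain ⟨j, hj0, hj⟩ := hex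
      obtain ⟨i, hi, k', e⟩ := hhalt j hj0 hj
      refine ⟨i, hi, ?_⟩
      obtain ⟨g, hg⟩ : ∃ g, (codeStep code)^[k] (0, twoRegs x 1) = (code.length, g) :=
        ⟨_, Prod.ext hk rfl⟩
      rw [hg]
      rcases le_total k k' with h | h
      · obtain ⟨d, rfl⟩ := Nat.exists_eq_add_of_le' h
        rw [Function.iterate_add_apply, hg, codeStep_iterate_length] at e
        exact e
      · obtain ⟨d, rfl⟩ := Nat.exists_eq_add_of_le' h
        rw [Function.iterate_add_apply, e, codeStep_iterate_length] at hg
        exact hg.symm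
    · obtain ⟨k', hk', y, -, e⟩ := hmain k fun i hi _ h => hex ⟨i, hi, h⟩
      obtain ⟨d, rfl⟩ := Nat.exists_eq_add_of_le' hk'
      rw [Function.iterate_add_apply, ← Prod.mk.eta (p := (codeStep code)^[k] (0, twoRegs x 1)),
        hk, codeStep_iterate_length] at e
      have := congrArg Prod.fst e
      simp only at this
      omega
  · obtain ⟨i, -, k, e⟩ := hhalt j hj0 hj
    exact ⟨k, by rw [e]⟩

end Prog

end

noncomputable section

/-! ### Digits -/

theorem mul_add_div_pow_succ {b a : ℕ} (ha : a < b) (n i : ℕ) :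
    (n * b + a) / b ^ (i + 1) = n / b ^ i := by
  rw [pow_succ', ← Nat.div_div_eq_div_mul, Nat.mul_comm n, Nat.mul_add_div (by omega),
    Nat.div_eq_of_lt ha, add_zero]

theorem div_div_pow (b n i : ℕ) : n / b / b ^ i = n / b ^ (i + 1) := by
  rw [Nat.div_div_eq_div_mul, pow_succ']

theorem digit_sum {b : ℕ} {d : ℕ → ℕ} (hd : ∀ i, d i < b) (n j : ℕ) :
    (∑ i ∈ Finset.range n, d i * b ^ i) / b ^ j % b = if j < n then d j else 0 := by
  induction n generalizing d j with
  | zero => simp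
  | succ n ih =>
    have e : ∑ i ∈ Finset.range (n + 1), d i * b ^ i =
        (∑ i ∈ Finset.range n, d (i + 1) * b ^ i) * b + d 0 := by
      rw [Finset.sum_range_succ', Finset.sum_mul, pow_zero, mul_one]
      congr 1
      exact Finset.sum_congr rfl fun i _ => by ring
    rw [e]
    cases j with
    | zero => simp [Nat.mod_eq_of_lt (hd 0)]
    | succ j =>
      rw [mul_add_div_pow_succ (hd 0), ih fun i => hd (i + 1)]
      simp

theorem mod_pow_eq_sum (A b n : ℕ) :
    A % b ^ n = ∑ i ∈ Finset.range n, (A / b ^ i % b) * b ^ i := by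
  induction n with
  | zero => simp [Nat.mod_one]
  | succ n ih => rw [Nat.mod_pow_succ, ih, Finset.sum_range_succ, mul_comm (b ^ n)]

theorem mod_pow_eq_sum_iff {b : ℕ} (hb : 0 < b) {d : ℕ → ℕ} (hd : ∀ i, d i < b) (A n : ℕ) :
    A % b ^ n = ∑ i ∈ Finset.range n, d i * b ^ i ↔ ∀ i < n, A / b ^ i % b = d i := by
  rw [mod_pow_eq_sum]
  constructor
  · intro h i hi
    have h1 := digit_sum (b := b) (d := fun i => A / b ^ i % b) (fun i => Nat.mod_lt _ hb) n i
    rw [h, digit_sum hd, if_pos hi, if_pos hi] at h1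
    exact h1.symm
  · exact fun h => Finset.sum_congr rfl fun i hi => by rw [h i (Finset.mem_range.1 hi)]

theorem sum_digits_lt {b : ℕ} {d : ℕ → ℕ} (hd : ∀ i, d i < b) (n : ℕ) :
    ∑ i ∈ Finset.range n, d i * b ^ i < b ^ n := by
  induction n with
  | zero => simp
  | succ n ih =>
    rw [Finset.sum_range_succ]
    calc _ < b ^ n + d n * b ^ n := by gcongr
      _ = (d n + 1) * b ^ n := by ring
      _ ≤ b * b ^ n := Nat.mul_le_mul_right _ (hd n)
      _ = b ^ (n + 1) := (pow_succ' b n).symm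

theorem div_pow_eq_zero_of_le {b n i : ℕ} (hb : 1 < b) (h : n ≤ i) : n / b ^ i = 0 :=
  Nat.div_eq_of_lt (lt_of_le_of_lt h (Nat.lt_pow_self hb))

/-! ### Configurations of Turing machines as numbers -/

/-- The tape whose two halves are given by the digits of `L` and `R`. -/
def digitTape (b L R : ℕ) : ℤ → ℕ
  | Int.ofNat i => R / b ^ i % b
  | Int.negSucc i => L / b ^ i % b

/-- The configuration of a machine of the given code, in numbers. -/
abbrev NumConfig : Type := List ℕ × ℕ × ℕ × ℕ

/-- The basis of the representation of tapes. -/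
def tmBase (code : List ℕ) : ℕ := code.getD 1 0 + 2

/-- The entry of the transition table. -/
def tmEntry (c : NumConfig) (j : ℕ) : ℕ :=
  c.1.getD (4 + ((c.2.1 * tmBase c.1 + c.2.2.2 % tmBase c.1) * 3 + j)) 0

/-- One step of a Turing machine, in numbers. -/
def numStep (c : NumConfig) : NumConfig :=
  if c.2.1 = c.1.getD 3 0 then c
  else
    let b := tmBase c.1
    let L := c.2.2.1
    let R := c.2.2.2 / b
    let a := tmEntry c 1
    (c.1, tmEntry c 0,
      -- The table stores the shift increased by one: `0` is the right shift of the tape, `1` no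
      -- shift, and every other value is treated as the left shift.
      if tmEntry c 2 = 0 then (L / b, (R * b + a) * b + L % b)
      else if tmEntry c 2 = 1 then (L, R * b + a)
      else (L * b + a, R))

theorem digitTape_stay {b L R a : ℕ} (ha : a < b) (i : ℤ) :
    digitTape b L (R / b * b + a) i = if i = 0 then a else digitTape b L R i := by
  rcases i with i | i
  · rcases i with _ | i
    · simp [digitTape, Nat.mod_eq_of_lt ha]
    · rw [if_neg (by simp; omega)]
      simp only [digitTape]
      rw [mul_add_div_pow_succ ha, div_div_pow]
  · rw [if_neg (by simp)]
    rfl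

theorem digitTape_left {b L R a : ℕ} (ha : a < b) (i : ℤ) :
    digitTape b (L * b + a) (R / b) i = if i + 1 = 0 then a else digitTape b L R (i + 1) := by
  rcases i with i | i
  · rw [if_neg (by simp; omega)]
    have : (Int.ofNat i + 1 : ℤ) = Int.ofNat (i + 1) := rfl
    rw [this]
    simp only [digitTape]
    rw [div_div_pow]
  · rcases i with _ | i
    · simp [digitTape, Nat.mod_eq_of_lt ha]
    · have : (Int.negSucc (i + 1) + 1 : ℤ) = Int.negSucc i := rfl
      rw [this, if_neg (by simp)]
      simp only [digitTape]
      rw [mul_add_div_pow_succ ha]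

theorem digitTape_right {b L R a : ℕ} (ha : a < b) (i : ℤ) :
    digitTape b (L / b) ((R / b * b + a) * b + L % b) i =
      if i - 1 = 0 then a else digitTape b L R (i - 1) := by
  have hL : L % b < b := Nat.mod_lt _ (by omega)
  rcases i with i | i
  · rcases i with _ | i
    · have : (Int.ofNat 0 - 1 : ℤ) = Int.negSucc 0 := rfl
      rw [this]
      simp [digitTape]
    · have : (Int.ofNat (i + 1) - 1 : ℤ) = Int.ofNat i := by simp
      rw [this, ← digitTape_stay (L := L) ha]
      simp only [digitTape]
      rw [mul_add_div_pow_succ hL]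
  · have : (Int.negSucc i - 1 : ℤ) = Int.negSucc (i + 1) := rfl
    rw [this, if_neg (by simp)]
    simp only [digitTape]
    rw [div_div_pow]

theorem getD_flatMap_finRange {n m : ℕ} (f : Fin n → List ℕ) (hf : ∀ i, (f i).length = m) (i : Fin n)
    {j : ℕ} (hj : j < m) :
    ((List.finRange n).flatMap f).getD (i * m + j) 0 = (f i).getD j 0 := by
  induction n with
  | zero => exact i.elim0
  | succ n ih =>
    rw [List.finRange_succ, List.flatMap_cons, List.flatMap_map]
    refine Fin.cases ?_ (fun i => ?_) i
    · rw [Fin.val_zero, zero_mul, zero_add, List.getD_append _ _ _ _ (by rw [hf]; exact hj)]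
    · have h1 : (i.succ : ℕ) * m + j = m + (i * m + j) := by
        rw [Fin.val_succ]; ring
      rw [List.getD_append_right _ _ _ _ (by rw [hf, h1]; omega), hf, h1, Nat.add_sub_cancel_left]
      exact ih (fun i => f i.succ) (fun i => hf i.succ) i

namespace TM

variable {T : TM}

theorem getD_code (q : Fin (T.r + 1)) (a : T.Symbol) {j : ℕ} (hj : j < 3) :
    T.code.getD (4 + ((q * (T.s + 2) + a) * 3 + j)) 0 =
      [((T.δ q a).1 : ℕ), ((T.δ q a).2.1 : ℕ), (((T.δ q a).2.2 : ℤ) + 1).toNat].getD j 0 := by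
  have h3 : ∀ q : Fin (T.r + 1), ((List.finRange (T.s + 2)).flatMap fun a =>
      [((T.δ q a).1 : ℕ), ((T.δ q a).2.1 : ℕ), (((T.δ q a).2.2 : ℤ) + 1).toNat]).length =
        (T.s + 2) * 3 := fun q => by
    simp [List.length_flatMap]
  rw [code, List.getD_append_right _ _ _ _ (by simp)]
  have e : 4 + ((q * (T.s + 2) + a) * 3 + j) -
      [T.r, T.s, (T.start : ℕ), (T.halt : ℕ)].length =
      (q : ℕ) * ((T.s + 2) * 3) + ((a : ℕ) * 3 + j) := by
    simp only [List.length_cons, List.length_nil]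
    rw [show 0 + 1 + 1 + 1 + 1 = 4 from rfl, Nat.add_sub_cancel_left]
    ring
  rw [e, getD_flatMap_finRange _ h3 q (by have := a.2; omega),
    getD_flatMap_finRange _ (fun a => by simp) a hj]

theorem tmBase_code (T : TM) : tmBase T.code = T.s + 2 := rfl

/-- The numbers represent the configuration. -/
def Represents (T : TM) (c : T.Config) (d : NumConfig) : Prop :=
  d.1 = T.code ∧ d.2.1 = c.1 ∧ ∀ i, (c.2 i : ℕ) = digitTape (T.s + 2) d.2.2.1 d.2.2.2 i

theorem Represents.step {c : T.Config} {d : NumConfig} (h : T.Represents c d) :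
    T.Represents (T.step c) (numStep d) := by
  obtain ⟨code, q, L, R⟩ := d
  obtain ⟨h1, h2, h3⟩ := h
  simp only at h1 h2 h3
  subst h1 h2
  have hhalt : T.code.getD 3 0 = T.halt := rfl
  rw [TM.step, numStep]
  simp only [hhalt, Fin.val_inj]
  by_cases hq : c.1 = T.halt
  · rw [if_pos hq, if_pos hq]
    exact ⟨rfl, rfl, h3⟩
  rw [if_neg hq, if_neg hq]
  have hR : R % (T.s + 2) = (c.2 0 : ℕ) := by
    rw [h3 0]
    simp [digitTape]
  have he : ∀ j < 3, tmEntry (T.code, (c.1 : ℕ), L, R) j = [((T.δ c.1 (c.2 0)).1 : ℕ),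
      ((T.δ c.1 (c.2 0)).2.1 : ℕ), (((T.δ c.1 (c.2 0)).2.2 : ℤ) + 1).toNat].getD j 0 := by
    intro j hj
    rw [← getD_code _ _ hj, tmEntry]
    simp only [tmBase_code, hR]
  have he0 := he 0 (by omega)
  have he1 := he 1 (by omega)
  have he2 := he 2 (by omega)
  simp only [List.getD_cons_zero, List.getD_cons_succ] at he0 he1 he2
  set δ := T.δ c.1 (c.2 0) with hδ
  have ha : (δ.2.1 : ℕ) < T.s + 2 := δ.2.1.2
  simp only [he0, he1, he2, tmBase_code]
  refine ⟨rfl, rfl, fun i => ?_⟩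
  have hup : ∀ j : ℤ, ((Function.update c.2 0 δ.2.1 j : T.Symbol) : ℕ) =
      if j = 0 then (δ.2.1 : ℕ) else digitTape (T.s + 2) L R j := by
    intro j
    rw [Function.update_apply]
    split_ifs
    · rfl
    · exact h3 j
  simp only [hup]
  rcases hd : δ.2.2 with _ | _ | _
  · have e : ((SignType.zero : SignType) : ℤ) = 0 := rfl
    simp only [e, add_zero, zero_add, Int.toNat_one, one_ne_zero, if_false, if_true]
    exact (digitTape_stay ha i).symm
  · have e : ((SignType.neg : SignType) : ℤ) = -1 := rfl
    simp only [e, neg_add_cancel, Int.toNat_zero, if_true]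
    exact (digitTape_right ha i).symm
  · have e : ((SignType.pos : SignType) : ℤ) = 1 := rfl
    have e2 : ((1 : ℤ) + 1).toNat = 2 := rfl
    simp only [e, e2]
    exact (digitTape_left ha i).symm

theorem Represents.iterate {c : T.Config} {d : NumConfig} (h : T.Represents c d) (j : ℕ) :
    T.Represents (T.step^[j] c) (numStep^[j] d) := by
  induction j with
  | zero => exact h
  | succ j ih =>
    rw [Function.iterate_succ_apply', Function.iterate_succ_apply']
    exact ih.step

end TM

/-- The initial configuration for the given code and window. -/
def numInit (p : List ℕ × List ℕ) : NumConfig :=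
  (p.1, p.1.getD 2 0,
    ∑ i ∈ Finset.range p.2.length,
      (if i < p.2.length / 2 then p.2.getD (p.2.length / 2 - 1 - i) 0 else 0) * tmBase p.1 ^ i,
    ∑ i ∈ Finset.range p.2.length, p.2.getD (p.2.length / 2 + i) 0 * tmBase p.1 ^ i)

/-- The entries of a word in the order of the positions `0, -1, 1, -2, 2, …`. -/
def foldWord (p : List ℕ) (i : ℕ) : ℕ :=
  if i % 2 = 0 then p.getD (p.length / 2 + i / 2) 0 else p.getD (p.length / 2 - 1 - i / 2) 0

/-- The number whose digits are the entries of the word, in the order of `foldWord`. -/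
def wordNum (p : List ℕ × List ℕ) : ℕ :=
  ∑ i ∈ Finset.range p.2.length, foldWord p.2 i * tmBase p.1 ^ i

/-- The number whose digits are the entries of the tape, in the order of the positions
`0, -1, 1, -2, 2, …`. -/
def tapeNum (c : NumConfig) : ℕ :=
  ∑ i ∈ Finset.range (2 * (c.2.2.1 + c.2.2.2) + 2),
    (if i % 2 = 0 then c.2.2.2 / tmBase c.1 ^ (i / 2) % tmBase c.1
      else c.2.2.1 / tmBase c.1 ^ (i / 2) % tmBase c.1) * tmBase c.1 ^ i

namespace TM

variable {T : TM}

theorem getD_wordCode {m : ℕ} (w : Fin m → T.Symbol) (j : ℕ) :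
    (T.wordCode w).getD j 0 = if h : j < m then (w ⟨j, h⟩ : ℕ) else 0 := by
  rw [wordCode, List.getD_eq_getElem?_getD, List.getElem?_ofFn]
  split_ifs <;> simp

theorem length_wordCode {m : ℕ} (w : Fin m → T.Symbol) : (T.wordCode w).length = m := by
  simp [wordCode]

theorem getD_wordCode_lt {m : ℕ} (w : Fin m → T.Symbol) (j : ℕ) :
    (T.wordCode w).getD j 0 < T.s + 2 := by
  rw [getD_wordCode]
  split_ifs with h
  · exact (w ⟨j, h⟩).2
  · omega

theorem foldWord_wordCode_lt {m : ℕ} (w : Fin m → T.Symbol) (i : ℕ) :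
    foldWord (T.wordCode w) i < T.s + 2 := by
  rw [foldWord]
  split_ifs <;> exact getD_wordCode_lt _ _

theorem wordNum_lt {m : ℕ} (w : Fin m → T.Symbol) :
    wordNum (T.code, T.wordCode w) < (T.s + 2) ^ m := by
  rw [wordNum]
  simp only [tmBase_code, length_wordCode]
  exact sum_digits_lt (foldWord_wordCode_lt w) m

theorem represents_numInit {t : T.Tape} {k₀ : ℕ} (ht : T.SupportedIn t k₀) :
    T.Represents (T.start, t) (numInit (T.code, T.wordCode (T.window t k₀))) := by
  refine ⟨rfl, rfl, fun i => ?_⟩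
  have hk : (2 * k₀ + 1) / 2 = k₀ := by omega
  simp only [numInit, tmBase_code, length_wordCode, hk]
  rcases i with i | i
  · simp only [digitTape]
    rw [digit_sum fun i => getD_wordCode_lt _ _, getD_wordCode]
    by_cases h : i < k₀ + 1
    · rw [if_pos (by omega), dif_pos (by omega)]
      simp only [window, pos]
      congr 2
      push_cast
      simp
    · have h0 : t (Int.ofNat i) = 0 := ht _ (by simp; omega)
      rw [h0, dif_neg (by omega)]
      simp
  · simp only [digitTape]
    rw [digit_sum fun i => by
      split_ifs
      · exact getD_wordCode_lt _ _
      · omega]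
    by_cases h : i < k₀
    · rw [if_pos (by omega), if_pos h, getD_wordCode, dif_pos (by omega)]
      simp only [window, pos]
      congr 2
      omega
    · have h0 : t (Int.negSucc i) = 0 := ht _ (by rw [Int.negSucc_eq, abs_neg, abs_of_nonneg (by omega)]; omega)
      rw [h0]
      simp [h]

/-- The range in `tapeNum` misses no digit: beyond it `i / 2` exceeds both halves `L` and `R` as
numbers, and `L / b ^ j = 0` for `j ≥ L`. -/
theorem digit_tapeNum {c : T.Config} {d : NumConfig} (h : T.Represents c d) (i : ℕ) :
    tapeNum d / (T.s + 2) ^ i % (T.s + 2) =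
      (c.2 (if i % 2 = 0 then Int.ofNat (i / 2) else Int.negSucc (i / 2)) : ℕ) := by
  obtain ⟨code, q, L, R⟩ := d
  obtain ⟨h1, h2, h3⟩ := h
  simp only at h1 h2 h3
  subst h1
  simp only [tapeNum, tmBase_code]
  rw [digit_sum fun i => by split_ifs <;> exact Nat.mod_lt _ (by omega), h3]
  split_ifs with h4 h5 h5
  · rfl
  · rfl
  · simp only [digitTape]
    rw [div_pow_eq_zero_of_le (by omega) (by omega), Nat.zero_mod]
  · simp only [digitTape]
    rw [div_pow_eq_zero_of_le (by omega) (by omega), Nat.zero_mod]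

/-- In the alternating order of positions the window `-k, …, k` consists of the lowest `2k + 1`
digits. One output number, independent of `k`, thus answers all questions by congruences. -/
theorem tapeNum_mod_eq_iff {c : T.Config} {d : NumConfig} (h : T.Represents c d) {k : ℕ}
    (w : Fin (2 * k + 1) → T.Symbol) :
    tapeNum d % (T.s + 2) ^ (2 * k + 1) = wordNum (T.code, T.wordCode w) ↔
      ∀ i, c.2 (pos k i) = w i := by
  have hk : (2 * k + 1) / 2 = k := by omega
  rw [wordNum]
  simp only [tmBase_code, length_wordCode]
  rw [mod_pow_eq_sum_iff (by omega) (foldWord_wordCode_lt w)]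
  simp only [digit_tapeNum h, foldWord, length_wordCode, hk]
  constructor
  · intro H i
    have hi := i.2
    rcases Nat.lt_or_ge i k with hik | hik
    · have := H (2 * (k - 1 - i) + 1) (by omega)
      rw [if_neg (by omega), if_neg (by omega), getD_wordCode, dif_pos (by omega)] at this
      have h2 := Fin.val_injective this
      have e1 : Int.negSucc ((2 * (k - 1 - i) + 1) / 2) = pos k i := by
        rw [pos, Int.negSucc_eq]; omega
      rw [e1] at h2
      rw [h2]
      congr 1
      ext
      simp only
      omega
    · have := H (2 * (i - k)) (by omega)
      rw [if_pos (by omega), if_pos (by omega), getD_wordCode, dif_pos (by omega)] at this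
      have h2 := Fin.val_injective this
      have e1 : Int.ofNat (2 * (i - k) / 2) = pos k i := by
        rw [pos, Int.ofNat_eq_natCast]; omega
      rw [e1] at h2
      rw [h2]
      congr 1
      ext
      simp only
      omega
  · intro H i hi
    split_ifs with h2
    · rw [getD_wordCode, dif_pos (by omega), ← H]
      refine congrArg (fun j => (c.2 j : ℕ)) ?_
      rw [pos, Int.ofNat_eq_natCast]
      simp only
      omega
    · rw [getD_wordCode, dif_pos (by omega), ← H]
      refine congrArg (fun j => (c.2 j : ℕ)) ?_
      rw [pos, Int.negSucc_eq]
      simp only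
      omega

theorem step_iterate_of_halt {c : T.Config} (h : c.1 = T.halt) (j : ℕ) : T.step^[j] c = c := by
  induction j with
  | zero => rfl
  | succ j ih => rw [Function.iterate_succ_apply, show T.step c = c from if_pos h, ih]

theorem halt_unique {c : T.Config} {i j : ℕ} (hi : (T.step^[i] c).1 = T.halt)
    (hj : (T.step^[j] c).1 = T.halt) : T.step^[i] c = T.step^[j] c := by
  rcases le_total i j with h | h
  · obtain ⟨d, rfl⟩ := Nat.exists_eq_add_of_le' h
    rw [Function.iterate_add_apply, step_iterate_of_halt hi]
  · obtain ⟨d, rfl⟩ := Nat.exists_eq_add_of_le' h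
    rw [Function.iterate_add_apply, step_iterate_of_halt hj]

end TM

end

/-! ### Primitive recursiveness of the simulation -/

noncomputable section

namespace Primrec

variable {α : Type*} [Primcodable α]

theorem natPow {f g : α → ℕ} (hf : Primrec f) (hg : Primrec g) : Primrec fun a => f a ^ g a :=
  (Primrec.nat_rec' hg (Primrec.const 1) (Primrec.nat_mul.comp (Primrec.snd.comp Primrec.snd)
    (hf.comp Primrec.fst)).to₂).of_eq fun a => by
      induction g a with
      | zero => rfl
      | succ k ih => rw [pow_succ, ← ih]

theorem sumRange {f : α → ℕ → ℕ} {g : α → ℕ} (hf : Primrec₂ f) (hg : Primrec g) :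
    Primrec fun a => ∑ i ∈ Finset.range (g a), f a i :=
  (Primrec.nat_rec' hg (Primrec.const 0) (Primrec.nat_add.comp (Primrec.snd.comp Primrec.snd)
    (hf.comp Primrec.fst (Primrec.fst.comp Primrec.snd))).to₂).of_eq fun a => by
      induction g a with
      | zero => rfl
      | succ k ih => rw [Finset.sum_range_succ, ← ih]

theorem natGetD {f : α → List ℕ} {g : α → ℕ} (hf : Primrec f) (hg : Primrec g) :
    Primrec fun a => (f a).getD (g a) 0 :=
  (Primrec.list_getD 0).comp hf hg

end Primrec

theorem primrec_tmBase : Primrec tmBase :=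
  Primrec.nat_add.comp (Primrec.natGetD Primrec.id (Primrec.const 1)) (Primrec.const 2)

theorem primrec_numConfig : Primrec (fun c : NumConfig => c.1) ∧
    Primrec (fun c : NumConfig => c.2.1) ∧ Primrec (fun c : NumConfig => c.2.2.1) ∧
    Primrec fun c : NumConfig => c.2.2.2 :=
  ⟨Primrec.fst, Primrec.fst.comp Primrec.snd, Primrec.fst.comp (Primrec.snd.comp Primrec.snd),
    Primrec.snd.comp (Primrec.snd.comp Primrec.snd)⟩

theorem primrec_tmEntry (j : ℕ) : Primrec fun c : NumConfig => tmEntry c j := by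
  obtain ⟨h1, h2, h3, h4⟩ := primrec_numConfig
  have hb := primrec_tmBase.comp h1
  exact Primrec.natGetD h1 (Primrec.nat_add.comp (Primrec.const 4) (Primrec.nat_add.comp
    (Primrec.nat_mul.comp (Primrec.nat_add.comp (Primrec.nat_mul.comp h2 hb)
      (Primrec.nat_mod.comp h4 hb)) (Primrec.const 3)) (Primrec.const j)))

theorem primrec_numStep : Primrec numStep := by
  obtain ⟨h1, h2, h3, h4⟩ := primrec_numConfig
  have hb := primrec_tmBase.comp h1
  have hR := Primrec.nat_div.comp h4 hb
  have ha := primrec_tmEntry 1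
  have hd := primrec_tmEntry 2
  have hRa := Primrec.nat_add.comp (Primrec.nat_mul.comp hR hb) ha
  refine Primrec.ite (Primrec.eq.comp h2 (Primrec.natGetD h1 (Primrec.const 3))) Primrec.id
    (h1.pair ((primrec_tmEntry 0).pair
      (Primrec.ite (Primrec.eq.comp hd (Primrec.const 0)) ?_
        (Primrec.ite (Primrec.eq.comp hd (Primrec.const 1)) ?_ ?_))))
  · exact (Primrec.nat_div.comp h3 hb).pair (Primrec.nat_add.comp (Primrec.nat_mul.comp hRa hb)
      (Primrec.nat_mod.comp h3 hb))
  · exact h3.pair hRa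
  · exact (Primrec.nat_add.comp (Primrec.nat_mul.comp h3 hb) ha).pair hR

theorem primrec_numInit : Primrec numInit := by
  have h1 : Primrec fun p : List ℕ × List ℕ => p.1 := Primrec.fst
  have hl : Primrec fun p : List ℕ × List ℕ => p.2.length :=
    Primrec.list_length.comp Primrec.snd
  have hk : Primrec fun q : (List ℕ × List ℕ) × ℕ => q.1.2.length / 2 :=
    Primrec.nat_div.comp (hl.comp Primrec.fst) (Primrec.const 2)
  have hw : Primrec fun q : (List ℕ × List ℕ) × ℕ => q.1.2 := Primrec.snd.comp Primrec.fst
  have hi : Primrec fun q : (List ℕ × List ℕ) × ℕ => q.2 := Primrec.snd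
  have hp : Primrec fun q : (List ℕ × List ℕ) × ℕ => tmBase q.1.1 ^ q.2 :=
    Primrec.natPow (primrec_tmBase.comp (Primrec.fst.comp Primrec.fst)) hi
  refine h1.pair ((Primrec.natGetD h1 (Primrec.const 2)).pair (Primrec.pair
    (Primrec.sumRange (Primrec.nat_mul.comp (Primrec.ite (Primrec.nat_lt.comp hi hk)
      (Primrec.natGetD hw (Primrec.nat_sub.comp (Primrec.nat_sub.comp hk (Primrec.const 1)) hi))
      (Primrec.const 0)) hp).to₂ hl)
    (Primrec.sumRange (Primrec.nat_mul.comp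
      (Primrec.natGetD hw (Primrec.nat_add.comp hk hi)) hp).to₂ hl)))

theorem primrec_wordNum : Primrec wordNum := by
  have hl : Primrec fun p : List ℕ × List ℕ => p.2.length :=
    Primrec.list_length.comp Primrec.snd
  have hk : Primrec fun q : (List ℕ × List ℕ) × ℕ => q.1.2.length / 2 :=
    Primrec.nat_div.comp (hl.comp Primrec.fst) (Primrec.const 2)
  have hw : Primrec fun q : (List ℕ × List ℕ) × ℕ => q.1.2 := Primrec.snd.comp Primrec.fst
  have hi : Primrec fun q : (List ℕ × List ℕ) × ℕ => q.2 := Primrec.snd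
  have hi2 := Primrec.nat_div.comp hi (Primrec.const 2)
  have hp : Primrec fun q : (List ℕ × List ℕ) × ℕ => tmBase q.1.1 ^ q.2 :=
    Primrec.natPow (primrec_tmBase.comp (Primrec.fst.comp Primrec.fst)) hi
  exact Primrec.sumRange (Primrec.nat_mul.comp (Primrec.ite
    (Primrec.eq.comp (Primrec.nat_mod.comp hi (Primrec.const 2)) (Primrec.const 0))
    (Primrec.natGetD hw (Primrec.nat_add.comp hk hi2))
    (Primrec.natGetD hw (Primrec.nat_sub.comp (Primrec.nat_sub.comp hk (Primrec.const 1)) hi2)))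
    hp).to₂ hl

theorem primrec_tapeNum : Primrec tapeNum := by
  obtain ⟨h1, h2, h3, h4⟩ := primrec_numConfig
  have hi : Primrec fun q : NumConfig × ℕ => q.2 := Primrec.snd
  have hb : Primrec fun q : NumConfig × ℕ => tmBase q.1.1 :=
    primrec_tmBase.comp (h1.comp Primrec.fst)
  have hp := Primrec.natPow hb (Primrec.nat_div.comp hi (Primrec.const 2))
  exact Primrec.sumRange (Primrec.nat_mul.comp (Primrec.ite
    (Primrec.eq.comp (Primrec.nat_mod.comp hi (Primrec.const 2)) (Primrec.const 0))
    (Primrec.nat_mod.comp (Primrec.nat_div.comp (h4.comp Primrec.fst) hp) hb)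
    (Primrec.nat_mod.comp (Primrec.nat_div.comp (h3.comp Primrec.fst) hp) hb))
    (Primrec.natPow hb hi)).to₂
    (Primrec.nat_add.comp (Primrec.nat_mul.comp (Primrec.const 2)
      (Primrec.nat_add.comp h3 h4)) (Primrec.const 2))

/-- A counter machine that simulates all Turing machines. -/
theorem exists_universal_code : ∃ code : List Instr, ∀ (T : TM) (t : T.Tape) (k₀ : ℕ),
    T.SupportedIn t k₀ →
    let c₀ := (0, twoRegs (Encodable.encode (numInit (T.code, T.wordCode (T.window t k₀)))) 1)
    ∀ (k : ℕ) (w : Fin (2 * k + 1) → T.Symbol),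
      (T.HaltsWith t k w → ∃ j, ((codeStep code)^[j] c₀).1 = code.length) ∧
      ∀ j, ((codeStep code)^[j] c₀).1 = code.length → ∃ A,
        (codeStep code)^[j] c₀ = (code.length, twoRegs A 0) ∧
        (T.HaltsWith t k w ↔
          A % (T.s + 2) ^ (2 * k + 1) = wordNum (T.code, T.wordCode w)) := by
  obtain ⟨h1, h2, h3, h4⟩ := primrec_numConfig
  have hdec := Primrec.ofNat NumConfig
  obtain ⟨code, hcode⟩ := Prog.exists_code_iterate
    (G := fun x => Encodable.encode (numStep (Denumerable.ofNat NumConfig x)))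
    (F := fun x => if (Denumerable.ofNat NumConfig x).2.1 =
      (Denumerable.ofNat NumConfig x).1.getD 3 0 then 0 else 1)
    (O := fun x => tapeNum (Denumerable.ofNat NumConfig x))
    (Primrec.encode.comp (primrec_numStep.comp hdec))
    (Primrec.ite (Primrec.eq.comp (h2.comp hdec)
      (Primrec.natGetD (h1.comp hdec) (Primrec.const 3))) (Primrec.const 0) (Primrec.const 1))
    (primrec_tapeNum.comp hdec)
  refine ⟨code, fun T t k₀ ht => ?_⟩
  intro c₀ k w
  obtain ⟨ha, hb⟩ := hcode (Encodable.encode (numInit (T.code, T.wordCode (T.window t k₀))))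
  have hit : ∀ j, (fun x => Encodable.encode (numStep (Denumerable.ofNat NumConfig x)))^[j]
      (Encodable.encode (numInit (T.code, T.wordCode (T.window t k₀)))) =
      Encodable.encode (numStep^[j] (numInit (T.code, T.wordCode (T.window t k₀)))) := by
    intro j
    induction j with
    | zero => rfl
    | succ j ih =>
      rw [Function.iterate_succ_apply', ih, Denumerable.ofNat_encode, Function.iterate_succ_apply']
  simp only [hit, Denumerable.ofNat_encode] at ha hb
  have hrep := fun j => (TM.represents_numInit ht).iterate j
  have hF : ∀ j, ((if (numStep^[j] (numInit (T.code, T.wordCode (T.window t k₀)))).2.1 =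
      (numStep^[j] (numInit (T.code, T.wordCode (T.window t k₀)))).1.getD 3 0 then 0 else 1) = 0) ↔
        (T.step^[j] (T.start, t)).1 = T.halt := by
    intro j
    rw [(hrep j).1, (hrep j).2.1, show T.code.getD 3 0 = T.halt from rfl]
    simp [Fin.val_inj]
  simp only [hF] at ha hb
  -- The counter machine detects halting only after a positive number of rounds; a halted
  -- configuration does not change, so `j + 1` serves.
  refine ⟨fun ⟨j, hj, _⟩ => hb (j + 1) (Nat.succ_pos j) ?_, fun j hj => ?_⟩
  · rw [Function.iterate_succ_apply', TM.step, if_pos hj]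
    exact hj
  · obtain ⟨i, hi, e⟩ := ha j hj
    refine ⟨_, e, ?_⟩
    rw [TM.tapeNum_mod_eq_iff (hrep i)]
    constructor
    · rintro ⟨i', hi', hw⟩
      rw [TM.halt_unique hi hi']
      exact hw
    · exact fun hw => ⟨i, hi, hw⟩

/-! ### The output regions -/

/-- Modulo `2 ^ B - 1` the powers of `2` have period `B` and are distinct for exponents below `B`. A
congruence for an exponent thus becomes an arithmetic progression for the power, which periodic
slabs can express. -/
theorem two_pow_eq_iff {A B r : ℕ} (hB : 2 ≤ B) (hr : r < B) :
    (∃ m : ℕ, 2 ^ A = 2 ^ r + m * (2 ^ B - 1)) ↔ A % B = r := by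
  have h1 : 1 ≤ 2 ^ B := Nat.one_le_two_pow
  have hmod : ∀ A, 2 ^ A ≡ 2 ^ (A % B) [MOD 2 ^ B - 1] := by
    intro A
    have hone : 2 ^ B ≡ 1 [MOD 2 ^ B - 1] := by
      have : 2 ^ B = 1 + (2 ^ B - 1) := by omega
      conv_lhs => rw [this]
      simp [Nat.ModEq]
    conv_lhs => rw [← Nat.mod_add_div A B, pow_add, pow_mul]
    simpa using (hone.pow (A / B)).mul_left (2 ^ (A % B))
  have hlt : ∀ i < B, 2 ^ i < 2 ^ B - 1 := by
    intro i hi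
    have h2 : 2 ^ i ≤ 2 ^ (B - 1) := Nat.pow_le_pow_right two_pos (by omega)
    have h3 : 2 ^ B = 2 * 2 ^ (B - 1) := by
      rw [← pow_succ']; congr 1; omega
    have h4 : 2 ^ 1 ≤ 2 ^ (B - 1) := Nat.pow_le_pow_right two_pos (by omega)
    omega
  constructor
  · rintro ⟨m, hm⟩
    have h2 : 2 ^ r ≡ 2 ^ (A % B) [MOD 2 ^ B - 1] := by
      refine Nat.ModEq.trans ?_ (hmod A)
      rw [hm]
      simp [Nat.ModEq]
    have h3 := Nat.ModEq.eq_of_lt_of_lt h2 (hlt r hr) (hlt _ (Nat.mod_lt _ (by omega)))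
    exact (Nat.pow_right_injective le_rfl h3).symm
  · rintro rfl
    have h2 : 2 ^ (A % B) ≤ 2 ^ A := Nat.pow_le_pow_right two_pos (Nat.mod_le _ _)
    obtain ⟨m, hm⟩ := (Nat.modEq_iff_dvd' h2).1 (hmod A).symm
    exact ⟨m, by rw [mul_comm m, ← hm]; omega⟩

/-- The slabs that show the halting, and the word, in the relay field; `Q` is the prime of the halting
position. -/
def outputSlabs (Q : ℕ) (p : List ℕ × List ℕ) : List (SlabData 17) :=
  -- With denominator `2` this is `1/2 < h < 2`. The second slab, with denominator `4`, consists of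
  -- the intervals of radius `1/4` about the integers `Q (2 ^ r + m (2 ^ B - 1))`.
  [(2, ((1 : ℕ) : ℤ), ((4 : ℕ) : ℤ), ((0 : ℕ) : ℤ), 1),
    (1, ((4 * (Q * 2 ^ wordNum p) - 1 : ℕ) : ℤ), ((4 * (Q * 2 ^ wordNum p) + 1 : ℕ) : ℤ),
      ((4 * (Q * (2 ^ (tmBase p.1 ^ p.2.length) - 1)) : ℕ) : ℤ), 3)]

theorem primrec_outputSlabs (Q : ℕ) : Primrec (outputSlabs Q) := by
  have hw : Primrec fun p => 4 * (Q * 2 ^ wordNum p) :=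
    Primrec.nat_mul.comp (Primrec.const 4) (Primrec.nat_mul.comp (Primrec.const Q)
      (Primrec.natPow (Primrec.const 2) primrec_wordNum))
  have hB : Primrec fun p : List ℕ × List ℕ => tmBase p.1 ^ p.2.length :=
    Primrec.natPow (primrec_tmBase.comp Primrec.fst) (Primrec.list_length.comp Primrec.snd)
  have hB' : Primrec fun p : List ℕ × List ℕ => 4 * (Q * (2 ^ (tmBase p.1 ^ p.2.length) - 1)) :=
    Primrec.nat_mul.comp (Primrec.const 4) (Primrec.nat_mul.comp (Primrec.const Q)
      (Primrec.nat_sub.comp (Primrec.natPow (Primrec.const 2) hB) (Primrec.const 1)))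
  have hz := fun {f : List ℕ × List ℕ → ℕ} (hf : Primrec f) => Primrec.int_natCast.comp hf
  refine Primrec.list_cons.comp (Primrec.const _) (Primrec.list_cons.comp
    ((Primrec.const (1 : Fin 17)).pair ((hz (Primrec.nat_sub.comp hw (Primrec.const 1))).pair
      ((hz (Primrec.nat_add.comp hw (Primrec.const 1))).pair ((hz hB').pair (Primrec.const 3)))))
    (Primrec.const []))

theorem mem_outputSlabs {Q : ℕ} (hQ : 0 < Q) (p : List ℕ × List ℕ) (x : E 17) :
    x ∈ slabs (outputSlabs Q p) ↔ (1 / 2 < x 2 ∧ x 2 < 2) ∧ ∃ m : ℕ,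
      |x 1 - (Q * (2 ^ wordNum p + m * (2 ^ (tmBase p.1 ^ p.2.length) - 1)) : ℕ)| < 1 / 4 := by
  have h1 : 1 ≤ 4 * (Q * 2 ^ wordNum p) := by
    have : 0 < Q * 2 ^ wordNum p := by positivity
    omega
  simp only [slabs, outputSlabs, slab, Set.mem_ofPred_eq, List.mem_cons, List.not_mem_nil, or_false,
    forall_eq_or_imp, forall_eq]
  refine and_congr ?_ (exists_congr fun m => ?_)
  · push_cast
    simp only [mul_zero, add_zero, exists_const]
    constructor
    · rintro ⟨h1, h2⟩; constructor <;> linarith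
    · rintro ⟨h1, h2⟩; constructor <;> linarith
  · rw [abs_lt]
    push_cast [Nat.cast_sub h1]
    constructor
    · rintro ⟨h1, h2⟩; constructor <;> linarith
    · rintro ⟨h1, h2⟩; constructor <;> linarith

theorem abs_sub_lt_iff_of_near {y : ℝ} {a b : ℕ} (ha : |y - a| < 1 / 4) :
    |y - b| < 1 / 4 ↔ a = b := by
  constructor
  · intro hb
    have h := abs_sub_lt_iff.1 ha
    have h' := abs_sub_lt_iff.1 hb
    have h1 : (a : ℝ) < b + 1 := by linarith
    have h2 : (b : ℝ) < a + 1 := by linarith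
    have h1' : a < b + 1 := by exact_mod_cast h1
    have h2' : b < a + 1 := by exact_mod_cast h2
    omega
  · rintro rfl
    exact ha

theorem confCode_twoRegs {R : ℕ} (hR : 2 ≤ R) (q x y : ℕ) :
    confCode R (q, twoRegs x y) = nthPrime (R + q) * (2 ^ x * 3 ^ y) := by
  obtain ⟨d, rfl⟩ := Nat.exists_eq_add_of_le hR
  have h0 : nthPrime 0 = 2 := Nat.nth_prime_zero_eq_two
  have h1 : nthPrime 1 = 3 := Nat.nth_prime_one_eq_three
  have e : regCode (2 + d) (twoRegs x y) = 2 ^ x * 3 ^ y := by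
    rw [regCode, Finset.prod_range_add, Finset.prod_eq_one (s := Finset.range d), mul_one,
      Finset.prod_range_succ, Finset.prod_range_one, h0, h1]
    · rfl
    · intro i _
      rw [twoRegs, if_neg (by omega), if_neg (by omega), pow_zero]
  rw [confCode, e]

end

/-! ### The encodings and the conclusion -/

noncomputable section

/-- The first coordinate of the initial point. -/
def inputNum (R : ℕ) (p : List ℕ × List ℕ) : ℕ :=
  nthPrime R * (2 ^ Encodable.encode (numInit p) * 3)

theorem primrec_inputNum (R : ℕ) : Primrec (inputNum R) :=
  Primrec.nat_mul.comp (Primrec.const _) (Primrec.nat_mul.comp (Primrec.natPow (Primrec.const 2)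
    (Primrec.encode.comp primrec_numInit)) (Primrec.const 3))

/-- The encodings for the relay field. -/
def relayEncoding (M C R Q : ℕ) : Encoding 17 where
  base := ![0, 0, 0, 0, 1, (2 * Real.pi / M) ^ 2, 0, 0, 1, 1, 1, 0, 0, 0, 0, 0, 0]
  base_computable i := by
    have h0 : IsComputableReal 0 := by simpa using isComputableReal_ratCast 0
    have h1 : IsComputableReal 1 := by simpa using isComputableReal_ratCast 1
    have h2 := isComputableReal_sq_two_pi_div M
    fin_cases i <;> first | exact h0 | exact h1 | exact h2
  -- Besides the initial integer only the initial gain exponent depends on the input; it was chosen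
  -- as a natural number for this purpose.
  input p := ![inputNum R p, 0, 0, 0, 0, 0, 3840 * C ^ 5 * (inputNum R p + 1) ^ 2, 0, 0, 0, 0, 0,
    0, 0, 0, 0, 0]
  input_computable := by
    refine Primrec.to_comp (Primrec.fin_curry.2 (Primrec.fin_curry₁.2 fun i => ?_).swap)
    have h0 : Primrec fun _ : List ℕ × List ℕ => 0 := Primrec.const 0
    have h1 := primrec_inputNum R
    have h2 : Primrec fun p => 3840 * C ^ 5 * (inputNum R p + 1) ^ 2 :=
      Primrec.nat_mul.comp (Primrec.const _) (Primrec.natPow (Primrec.succ.comp h1)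
        (Primrec.const 2))
    fin_cases i <;> first | exact h0 | exact h1 | exact h2
  output := outputSlabs Q
  output_computable := (primrec_outputSlabs Q).to_comp

theorem relayEncoding_point (M C R Q : ℕ) (T : TM) (t : T.Tape) (k₀ : ℕ) :
    (relayEncoding M C R Q).point T t k₀ = WithLp.toLp 2
      ![(inputNum R (T.code, T.wordCode (T.window t k₀)) : ℝ), 0, 0, 0, 1, (2 * Real.pi / M) ^ 2,
        ((3840 * C ^ 5 * (inputNum R (T.code, T.wordCode (T.window t k₀)) + 1) ^ 2 : ℕ) : ℝ), 0, 1,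
        1, 1, 0, 0, 0, 0, 0, 0] := by
  rw [Encoding.point]
  congr 1
  funext i
  fin_cases i <;> simp [relayEncoding]

/-- There is a constructible polynomial vector field on `ℝ¹⁷` whose curves carry out the computations
of all Turing machines. -/
theorem exists_simulating_polyField : ∃ (P : PolyField 17) (e : Encoding 17), P.IsConstructible ∧
    ∀ (T : TM) (t : T.Tape) (k₀ : ℕ), T.SupportedIn t k₀ →
      ∃ x : ℝ → E 17, x 0 = e.point T t k₀ ∧ (∀ τ, HasDerivAt x (P.val (x τ)) τ) ∧
        ∀ (k : ℕ) (w : Fin (2 * k + 1) → T.Symbol),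
          (T.HaltsWith t k w → ∀ᶠ τ in Filter.atTop, x τ ∈ e.region T w) ∧
          ∀ τ, x τ ∈ e.region T w → T.HaltsWith t k w := by
  obtain ⟨code, hcode⟩ := exists_universal_code
  obtain ⟨M, C, R, p, q, hR, hfield⟩ := exists_relayField_of_code code
  set Q := nthPrime (R + code.length) with hQ
  have hQ0 : 0 < Q := (prime_nthPrime _).pos
  refine ⟨relayField M (C ^ 2) p q, relayEncoding M C R Q, relayField_isConstructible _ _ _ _,
    fun T t k₀ ht => ?_⟩
  obtain ⟨x, hx0, hx, hx1, hx2⟩ := hfield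
    (twoRegs (Encodable.encode (numInit (T.code, T.wordCode (T.window t k₀)))) 1)
  have hH := hcode T t k₀ ht
  refine ⟨x, ?_, hx, fun k w => ?_⟩
  · rw [hx0, relayEncoding_point, confCode_twoRegs hR, add_zero, pow_one, inputNum]
  have hB : 2 ≤ (T.s + 2) ^ (2 * k + 1) :=
    le_trans (by omega) (Nat.le_self_pow (by omega) (T.s + 2))
  have hr : wordNum (T.code, T.wordCode w) < (T.s + 2) ^ (2 * k + 1) :=
    TM.wordNum_lt w
  -- A point within `1/4` of an integer can lie only in the interval about that same integer, so
  -- near a halting code membership is decided by `A` modulo `B`.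
  have hmem : ∀ (y : E 17) (A : ℕ), 1 / 2 < y 2 → |y 1 - (Q * 2 ^ A : ℕ)| < 1 / 4 →
      (y ∈ (relayEncoding M C R Q).region T w ↔ y 2 < 2 ∧
        A % (T.s + 2) ^ (2 * k + 1) = wordNum (T.code, T.wordCode w)) := by
    intro y A h1 h2
    rw [Encoding.region, show (relayEncoding M C R Q).output = outputSlabs Q from rfl,
      mem_outputSlabs hQ0, ← two_pow_eq_iff hB hr]
    simp only [abs_sub_lt_iff_of_near h2, h1, true_and, TM.length_wordCode, TM.tmBase_code,
      Nat.mul_right_inj hQ0.ne']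
  have hconf : ∀ j, ((codeStep code)^[j] (0, twoRegs (Encodable.encode (numInit (T.code,
      T.wordCode (T.window t k₀)))) 1)).1 = code.length → ∃ A,
      confCode R ((codeStep code)^[j] (0, twoRegs (Encodable.encode (numInit (T.code,
        T.wordCode (T.window t k₀)))) 1)) = Q * 2 ^ A ∧
      (T.HaltsWith t k w ↔
          A % (T.s + 2) ^ (2 * k + 1) = wordNum (T.code, T.wordCode w)) := by
    intro j hj
    obtain ⟨A, hA, hA'⟩ := (hH k w).2 j hj
    exact ⟨A, by rw [hA, confCode_twoRegs hR, pow_zero, mul_one], hA'⟩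
  constructor
  · intro hh
    obtain ⟨j, hj⟩ := (hH k w).1 hh
    obtain ⟨A, hA, hA'⟩ := hconf j hj
    have := hx2 j hj
    rw [hA] at this
    filter_upwards [this] with τ hτ
    exact (hmem _ A hτ.1 hτ.2.2).2 ⟨hτ.2.1, hA'.1 hh⟩
  · intro τ hτ
    -- The slab for `h` excludes false positives: at any time, `h > 1/2` certifies that the nearby
    -- integer is a halting code.
    have h2 : 1 / 2 < x τ 2 := ((mem_outputSlabs hQ0 _ _).1 hτ).1.1
    obtain ⟨j, hj, hj'⟩ := hx1 τ h2
    obtain ⟨A, hA, hA'⟩ := hconf j hj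
    rw [hA] at hj'
    exact hA'.2 ((hmem _ A h2 hj').1 hτ).2

end

theorem theorem2 :
    ∃ (F : Diffeomorph (𝓡 17) (𝓡 17) (Sph 17) (Sph 17) ω) (e : Encoding 17),
      IsTuringCompleteVia e F.toEquiv ∧
      ∃ (P : PolyField 17) (Y : PolyField (17 + 1)) (ρ : ℝ → Sph 17 → Sph 17) (δ : ℝ),
        P.IsConstructible ∧ P.IsTuringCompleteVia e ∧
        Y.TangentToSphere ∧ Y.IsStereoLift P.reparam ∧ Y.IsSphereFlow ρ ∧
        0 < δ ∧ ∀ y : Sph 17, F y = ρ δ y := by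
  obtain ⟨P, e, hP, H⟩ := exists_simulating_polyField
  obtain ⟨ρ, hρ⟩ := P.exists_isSphereFlow
  obtain ⟨δ, hδ, F, hF⟩ := hρ.exists_diffeomorph
  obtain ⟨h1, h2⟩ := isTuringCompleteVia_of_curves H
  exact ⟨F, e, h2 ρ δ F.toEquiv hρ hδ hF, P, P.lift, ρ, δ, hP, h1, P.lift_tangentToSphere,
    P.lift_isStereoLift, hρ, hδ, hF⟩
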